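/- **Poisson problem, $\ell$ polynomial.** Let $k\ge 1$ be an integer and $\ell(\theta)=\theta^k$. For a prior $\pi$ on $\mathbb R_+=[0,\infty)$ let $(\theta_1,X_1),\dots,(\theta_n,X_n)$ be i.i.d. with $\theta_i\sim\pi$ and $X_i\mid\theta_i\sim\mathrm{Poi}(\theta_i)$. Put $\mathsf{mmse}_k(\pi)=\inf_{t:\mathbb Z_+\to\mathbb R}\mathbb E[(t(X_1)-\theta_1^k)^2]$. For an estimator $T:\mathbb Z_+^n\to\mathbb R^n$ and a class $\mathcal G$ of priors let $$\mathsf{TotRegret}_{\pi,k,n}(T)=\mathbb E\Big[\sum_{j=1}^n(T_j(X_1,\dots,X_n)-\theta_j^k)^2\Big]-n\,\mathsf{mmse}_k(\pi),\qquad \mathsf{TotRegret}_{k,n}(\mathcal G)=\inf_T\sup_{\pi\in\mathcal G}\mathsf{TotRegret}_{\pi,k,n}(T).$$ Let $\mathcal P([0,h])$ be the class of priors supported on $[0,h]$, and $\mathsf{SubE}(s)$ the class of priors on $\mathbb R_+$ with $\pi[\theta\ge t]\le 2e^{-t/s}$ for all $t>0$. Write $(x)_k=x(x+1)\cdots(x+k-1)$,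 $N(x)=\#\{j: X_j=x\}$, $p^{\mathsf{emp}}(x)=N(x)/n$ and $f_\pi(x)=\int e^{-\theta}\frac{\theta^x}{x!}\,d\pi(\theta)$. Consider the following estimators. * *Modified Robbins*: $\hat T_{\mathsf{Rob},k}=\big((X_i+1)_k\,N(X_i+k)/N(X_i)\big)_{i\le n}$. * *Plug-in*: $\hat T_{\hat\pi}=(\hat t_{\hat\pi}(X_i))_{i\le n}$ with $\hat t_{\hat\pi}(x)=(x+1)_k f_{\hat\pi}(x+k)/f_{\hat\pi}(x)$ (and $0/0=0$), where $\hat\pi=\hat\pi(X_1,\dots,X_n)$ is one of * *NPMLE* over a class $\mathcal C$ of priors: $\hat\pi\in\arg\max_{\pi\in\mathcal C}\prod_i f_\pi(X_i)$; * *minimum distance* over $\mathcal C$: $\hat\pi\in\arg\min_{\pi\in\mathcal C}d(p^{\mathsf{emp}}\|f_\pi)$, where $d$ is a $[0,\infty]$-valued function of pairs of distributions on $\mathbb Z_+$ which is $(a_1,a_2)$-admissible: for all $p,q$ with $p$ finitely supported, (i) $d(p\|q)=\varphi(p)+\sum_x L(p(x),q(x))$ with $\varphi$ real-valued, $L$ extended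 real-valued, $L(0,\cdot)=0$ and $L(a,\cdot)$ strictly decreasing and convex on $[0,1]$ for $0<a\le 1$; (ii) $a_1H^2(p,q)\le d(p\|q)\le a_2\chi^2(p\|q)$, with $H^2(p,q)=\sum_x(\sqrt{p(x)}-\sqrt{q(x)})^2$ and $\chi^2(p\|q)=\sum_x (p(x)-q(x))^2/q(x)$. * *ERM* over a class $\mathcal F$ of functions: $(\hat t(X_i))_{i\le n}$ with $\hat t\in\arg\min_{t\in\mathcal F}\frac1n\sum_i\big[t(X_i)^2-2(X_i-k+1)_k\,t(X_i-k)\big]$ (the terms $(X_i-k+1)_k\,t(X_i-k)$ with $X_i<k$ are $0$). Let $\mathcal F_\uparrow$ be the class of nondecreasing $t:\mathbb Z_+\to\mathbb R_+$, and $\mathcal F_{\uparrow,b}$ that of nondecreasing $t:\mathbb Z_+\to[0,b]$. Then the following hold. 1. *(Bounded priors.)* There is $n_0=n_0(k)$ such that for every $h>0$ there are $c_1,c_2>0$, depending only on $h,k$, with, for all $n\ge n_0$, $$c_1\Big(\frac{\log n}{\log\log n}\Big)^{k+1}\le\mathsf{TotRegret}_{k,n}(\mathcal P([0,h]))\le c_2\Big(\frac{\log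 n}{\log\log n}\Big)^{k+1}.$$ Moreover $\sup_{\pi\in\mathcal P([0,h])}\mathsf{TotRegret}_{\pi,k,n}(\hat T)\le c_2\big(\frac{\log n}{\log\log n}\big)^{k+1}$ for all $n\ge n_0$ when $\hat T$ is $\hat T_{\mathsf{Rob},k}$, the plug-in of any NPMLE over $\mathcal P([0,h])$, or any ERM over $\mathcal F_{\uparrow,h^k}$ (an NPMLE and an ERM exist). For all $a_1,a_2>0$ the same bound holds, with a constant depending only on $h,k,a_1,a_2$ in place of $c_2$, for the plug-in of any minimum distance estimator over $\mathcal P([0,h])$ with respect to an $(a_1,a_2)$-admissible $d$. 2. *(Subexponential priors.)* There is $n_0=n_0(k)$ such that for every $s>0$ there are $c_3,c_4>0$, depending only on $s,k$, with, for all $n\ge n_0$, $$c_3(\log n)^{2k+1}\le\mathsf{TotRegret}_{k,n}(\mathsf{SubE}(s))\le c_4(\log n)^{2k+1}.$$ Moreover $\sup_{\pi\in\mathsf{SubE}(s)}\mathsf{TotRegret}_{\pi,k,n}(\hat T)\le c_4(\log n)^{2k+1}$ for all $n\ge n_0$ when $\hat T$ is $\hat T_{\mathsf{Rob},k}$, the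 plug-in of any NPMLE over all priors on $\mathbb R_+$, or any ERM over $\mathcal F_\uparrow$ (an NPMLE and an ERM exist). For all $a_1,a_2>0$ the same bound holds, with a constant depending only on $s,k,a_1,a_2$ in place of $c_4$, for the plug-in of any minimum distance estimator over all priors on $\mathbb R_+$ with respect to an $(a_1,a_2)$-admissible $d$. -/

import Mathlib

open MeasureTheory ProbabilityTheory
open scoped NNReal ENNReal

noncomputable section

namespace PoissonEB

/-! ### The Poisson empirical Bayes model -/

/-- A prior on the parameter space `ℝ₊ = [0, ∞)`. -/
abbrev Prior : Type := ProbabilityMeasure ℝ≥0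

theorem measurable_poissonMeasure : Measurable (fun θ : ℝ≥0 => poissonMeasure θ) := by
  refine Measure.measurable_of_measurable_coe _ (fun s hs => ?_)
  simp only [poissonMeasure, Measure.sum_apply _ hs, Measure.smul_apply, smul_eq_mul]
  fun_prop

/-- The channel `θ ↦ Poi(θ)`. -/
def poissonChannel : Kernel ℝ≥0 ℕ where
  toFun θ := poissonMeasure θ
  measurable' := measurable_poissonMeasure

instance : IsMarkovKernel poissonChannel :=
  ⟨fun θ => inferInstanceAs (IsProbabilityMeasure (poissonMeasure θ))⟩

/-- The joint law of `(θ, X)`, where `θ ∼ π` and `X ∣ θ ∼ Poi(θ)`. -/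
def jointLaw (π : Prior) : Measure (ℝ≥0 × ℕ) :=
  (π : Measure ℝ≥0).compProd poissonChannel

/-- The law of `n` i.i.d. pairs `(θ₁, X₁), …, (θₙ, Xₙ)`. -/
def sampleLaw (π : Prior) (n : ℕ) : Measure (Fin n → ℝ≥0 × ℕ) :=
  Measure.pi (fun _ => jointLaw π)

/-- The minimum mean squared error `inf_t E[(t(X) - ℓ(θ))²]`. -/
def mmse (ℓ : ℝ≥0 → ℝ) (π : Prior) : ℝ≥0∞ :=
  ⨅ t : ℕ → ℝ, ∫⁻ z, ENNReal.ofReal ((t z.2 - ℓ z.1) ^ 2) ∂(jointLaw π)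

/-- An estimator: from the data `X₁, …, Xₙ` it produces estimates of `ℓ(θ₁), …, ℓ(θₙ)`. -/
abbrev Estimator (n : ℕ) : Type := (Fin n → ℕ) → Fin n → ℝ

/-- The total squared error `E[∑ⱼ (Tⱼ(X₁, …, Xₙ) - ℓ(θⱼ))²]`, possibly infinite. -/
def totalRisk (ℓ : ℝ≥0 → ℝ) {n : ℕ} (T : Estimator n) (π : Prior) : ℝ≥0∞ :=
  ∫⁻ z, ∑ j, ENNReal.ofReal ((T (fun i => (z i).2) j - ℓ (z j).1) ^ 2) ∂(sampleLaw π n)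

/-- The total regret `E[∑ⱼ (Tⱼ(X₁, …, Xₙ) - ℓ(θⱼ))²] - n · mmse(π)`. Each of the `n` summands of the
risk is at least the mmse, so the subtraction in `[0, ∞]` is the true one when the mmse is finite. -/
def totalRegret (ℓ : ℝ≥0 → ℝ) {n : ℕ} (T : Estimator n) (π : Prior) : ℝ≥0∞ :=
  totalRisk ℓ T π - n * mmse ℓ π

/-- The worst total regret of `T` over the class `G`, for the functional `ℓ(θ) = θ ^ k`. -/
def worstRegret (k : ℕ) (G : Set Prior) {n : ℕ} (T : Estimator n) : ℝ≥0∞ :=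
  ⨆ π ∈ G, totalRegret (fun θ => (θ : ℝ) ^ k) T π

/-- The minimax total regret over the class `G`, for the functional `ℓ(θ) = θ ^ k`. -/
def minimaxRegret (k n : ℕ) (G : Set Prior) : ℝ≥0∞ :=
  ⨅ T : Estimator n, worstRegret k G T

/-- The class `𝒫([0, h])` of priors supported on `[0, h]`. -/
def boundedPriors (h : ℝ) : Set Prior :=
  {π | (π : Measure ℝ≥0) {θ | (θ : ℝ) ≤ h} = 1}

/-- The class `SubE(s)` of priors with `π[θ ≥ t] ≤ 2 exp(-t / s)` for all `t > 0`. -/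
def subexpPriors (s : ℝ) : Set Prior :=
  {π | ∀ t : ℝ, 0 < t →
    (π : Measure ℝ≥0) {θ | t ≤ (θ : ℝ)} ≤ ENNReal.ofReal (2 * Real.exp (-t / s))}

/-- The mixture probability mass function `f_π(x) = ∫ e^{-θ} θ^x / x! dπ(θ)`. -/
def mixture (π : Prior) (x : ℕ) : ℝ :=
  ∫ θ : ℝ≥0, Real.exp (-(θ : ℝ)) * (θ : ℝ) ^ x / (x.factorial : ℝ) ∂(π : Measure ℝ≥0)

/-! ### The modified Robbins estimator -/

/-- `N(x)`, the number of observations that are equal to `x`. -/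
def count {n : ℕ} (X : Fin n → ℕ) (x : ℕ) : ℕ :=
  (Finset.univ.filter (fun j => X j = x)).card

/-- The modified Robbins estimator `(X_i + 1)(X_i + 2)⋯(X_i + k) N(X_i + k) / N(X_i)`. -/
def robbins (k n : ℕ) : Estimator n := fun X i =>
  ((X i + 1).ascFactorial k : ℝ) * (count X (X i + k) : ℝ) / (count X (X i) : ℝ)

/-! ### Minimum distance estimators -/

/-- The Bayes estimate of `θ ^ k` at `x` for the prior `π`, by Tweedie's formula:
`(x + 1)(x + 2)⋯(x + k) f_π(x + k) / f_π(x)`. -/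
def bayes (k : ℕ) (π : Prior) (x : ℕ) : ℝ :=
  ((x + 1).ascFactorial k : ℝ) * mixture π (x + k) / mixture π x

/-- The plug-in estimator `(t_{π̂}(X₁), …, t_{π̂}(Xₙ))` of an estimated prior `π̂ = π̂(X₁, …, Xₙ)`. -/
def plugIn (k : ℕ) {n : ℕ} (πhat : (Fin n → ℕ) → Prior) : Estimator n := fun X i =>
  bayes k (πhat X) (X i)

/-- The empirical probability mass function of the sample. -/
def empirical {n : ℕ} (X : Fin n → ℕ) (x : ℕ) : ℝ := (count X x : ℝ) / (n : ℝ)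

/-- `p` is a probability mass function on `ℕ`. -/
def IsMassFunction (p : ℕ → ℝ) : Prop := (∀ x, 0 ≤ p x) ∧ HasSum p 1

/-- The squared Hellinger distance `∑ₓ (√p(x) - √q(x))²`. -/
def hellingerSq (p q : ℕ → ℝ) : ℝ≥0∞ :=
  ∑' x, ENNReal.ofReal ((Real.sqrt (p x) - Real.sqrt (q x)) ^ 2)

/-- The `χ²`-divergence `∑ₓ (p(x) - q(x))² / q(x)`, with `0 / 0 = 0` and `a / 0 = ∞` for `a > 0`. -/
def chiSq (p q : ℕ → ℝ) : ℝ≥0∞ :=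
  ∑' x, ENNReal.ofReal ((p x - q x) ^ 2) / ENNReal.ofReal (q x)

/-- The two standing assumptions on the divergence `d` of a minimum distance estimator, where the
first argument is a finitely supported distribution (as empirical distributions are).
* `separable`: `d(p ‖ q) = φ(p) + ∑ₓ L(p(x), q(x))`, where `L(0, ·) = 0`, and `L(a, ·)` is strictly
  decreasing and convex for `a > 0`. The value `∞` of `L` and `d` is allowed, so that the
  Kullback-Leibler divergence, with `L(a, b) = a log(1 / b)`, is covered.
* `comparable`: `a₁ H²(p, q) ≤ d(p ‖ q) ≤ a₂ χ²(p ‖ q)`. -/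
structure IsAdmissibleDivergence (a₁ a₂ : ℝ) (d : (ℕ → ℝ) → (ℕ → ℝ) → ℝ≥0∞) : Prop where
  separable : ∃ (φ : (ℕ → ℝ) → ℝ) (L : ℝ → ℝ → EReal),
    (∀ b ∈ Set.Icc (0 : ℝ) 1, L 0 b = 0) ∧
    (∀ a ∈ Set.Ioc (0 : ℝ) 1, StrictAntiOn (L a) (Set.Icc 0 1)) ∧
    (∀ a ∈ Set.Ioc (0 : ℝ) 1, ∀ b ∈ Set.Icc (0 : ℝ) 1, ∀ b' ∈ Set.Icc (0 : ℝ) 1,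
      ∀ t ∈ Set.Icc (0 : ℝ) 1,
        L a (t * b + (1 - t) * b') ≤ (t : EReal) * L a b + ((1 - t : ℝ) : EReal) * L a b') ∧
    (∀ p q, IsMassFunction p → IsMassFunction q → p.support.Finite →
      (d p q : EReal) = (φ p : EReal) + ∑ᶠ x, L (p x) (q x))
  comparable : ∀ p q, IsMassFunction p → IsMassFunction q → p.support.Finite →
    ENNReal.ofReal a₁ * hellingerSq p q ≤ d p q ∧ d p q ≤ ENNReal.ofReal a₂ * chiSq p q

/-- `π̂` is a minimum distance estimator over the class `G` of priors: for every sample,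
`π̂ ∈ argmin_{π ∈ G} d(p_emp ‖ f_π)`. -/
def IsMinDistance (d : (ℕ → ℝ) → (ℕ → ℝ) → ℝ≥0∞) (G : Set Prior) {n : ℕ}
    (πhat : (Fin n → ℕ) → Prior) : Prop :=
  ∀ X, πhat X ∈ G ∧ IsMinOn (fun π => d (empirical X) (mixture π)) G (πhat X)

/-- `π̂` is a nonparametric maximum likelihood estimator over the class `G` of priors: for every
sample, `π̂ ∈ argmax_{π ∈ G} ∏ᵢ f_π(X_i)`. -/
def IsNPMLE (G : Set Prior) {n : ℕ} (πhat : (Fin n → ℕ) → Prior) : Prop :=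
  ∀ X, πhat X ∈ G ∧ IsMaxOn (fun π => ∏ i, mixture π (X i)) G (πhat X)

/-! ### The monotone empirical risk minimizer -/

/-- The class of nondecreasing functions from `ℕ` to `ℝ₊`. -/
def monotoneClass : Set (ℕ → ℝ) := {t | Monotone t ∧ ∀ x, 0 ≤ t x}

/-- The class of nondecreasing functions from `ℕ` to `[0, b]`. -/
def clippedMonotoneClass (b : ℝ) : Set (ℕ → ℝ) := {t | Monotone t ∧ ∀ x, t x ∈ Set.Icc 0 b}

/-- The empirical objective `n⁻¹ ∑ᵢ [t(X_i)² - 2 X_i (X_i - 1)⋯(X_i - k + 1) t(X_i - k)]`. The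
falling factorial vanishes when `X_i < k`, where `X_i - k` is truncated. -/
def empiricalObjective (k : ℕ) {n : ℕ} (X : Fin n → ℕ) (t : ℕ → ℝ) : ℝ :=
  (1 / (n : ℝ)) * ∑ i, (t (X i) ^ 2 - 2 * ((X i).descFactorial k : ℝ) * t (X i - k))

/-- `T` is an empirical risk minimizer over the function class `F`: for every sample,
`T(X) = (t(X₁), …, t(Xₙ))` for some `t ∈ argmin_F` of the empirical objective. -/
def IsERM (k : ℕ) (F : Set (ℕ → ℝ)) {n : ℕ} (T : Estimator n) : Prop :=
  ∀ X, ∃ t ∈ F, IsMinOn (empiricalObjective k X) F t ∧ T X = fun i => t (X i)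

/-! ### The rates -/

/-- `(log n / log log n) ^ (k + 1)`. -/
def boundedRate (k n : ℕ) : ℝ := (Real.log n / Real.log (Real.log n)) ^ (k + 1)

/-- `(log n) ^ (2 k + 1)`. -/
def subexpRate (k n : ℕ) : ℝ := Real.log n ^ (2 * k + 1)

end PoissonEB

end

/-! Upper bounds. `bayes` minimizes the conditional risk at every data value, so by orthogonality
the total risk is n times the mmse plus `excess`, the expected squared distance of the estimates to
the Bayes rule at the data (`totalRisk_eq`). Let K be a level that the observations exceed only with
negligible probability, and let M bound the Bayes rule (and the estimates, for ERM and plug-ins).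
Each family then has excess at most a constant times `regretSize`, namely (K + 1)((K + k)^k M + M²):
each value x ≤ K contributes order (x + 1)_k M + M², with no factor n.

For Robbins this is a second moment computation with the Palm formula for the counts, in which the
terms of order n cancel (`integral_robbins_le`). For ERM, the Bayes rule is monotone
(`bayes_monotone`), hence a competitor; comparing objectives reduces the excess to the Robbins
deviations plus a term from values x with N(x) = 0 < N(x + k) (`sum_sq_le_of_objective_le`,
`integral_count_zero_le`). For plug-ins, the difference of two Bayes ratios is controlled by
Hellinger increments of the mixtures (`mul_sq_sub_le_hellinger`), both mixtures are compared with
the empirical law, and minimality bounds the Hellinger distance by a χ²-divergence whose expectation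
is about K / n (`IsHellingerMin`, `excess_plugIn_le`). Unrestricted NPMLE and minimum distance
priors automatically live on [0, max X], because moving mass from above R to R raises f(x) for all x
≤ R (`mixture_lt_capPrior`).

Unbounded priors are conditioned on θ ≤ h; what happens off the event that all parameters are at
most h and all observations at most K costs O(1) for estimators of polynomial size
(`totalRegret_le_excess_add`, `totalRegret_le_of_excess_le`). On [0, h] one takes K of order log n /
log log n and M = h^k; for SubE(s), K is of order log n and M = K^k. These choices give the two
rates.

Lower bounds. On {1, …, D} the mixture of a discrete prior with nodes lh / D can be perturbed at
each point independently, by inverting a Vandermonde matrix with explicit entry bounds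
(`exists_vandermonde_inverse`, `exists_perturbed_priors`). Changing f(x + k) by order √(f(x + k) /
n) while keeping f(x) changes the Bayes estimate at x, yet the two samples stay statistically close
(`three_quarters_le_affinity_pow`). The two point bound at x then costs order m^k h^k, and the
hypercube argument `card_mul_le_minimaxRegret` adds this over the m values x in (m, 2m], which gives
m^(k+1) h^k (`ofReal_le_minimaxRegret`). With h fixed and m of order log n / log log n, respectively
h and m of order log n, these are the same rates for large n. The remaining n only require the
minimax regret to be positive (`minimaxRegret_pos`). -/

noncomputable section
namespace PoissonEB

/-! ### The model -/

/-- The Poisson probability `e^{-θ} θ^x / x!`. -/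
def pw (θ : ℝ≥0) (x : ℕ) : ℝ := Real.exp (-(θ : ℝ)) * (θ : ℝ) ^ x / (x.factorial : ℝ)

lemma pw_nonneg (θ : ℝ≥0) (x : ℕ) : 0 ≤ pw θ x := by unfold pw; positivity

lemma hasSum_pw (θ : ℝ≥0) : HasSum (pw θ) 1 := hasSum_one_poissonMeasure θ

lemma pw_le_one (θ : ℝ≥0) (x : ℕ) : pw θ x ≤ 1 :=
  le_hasSum (hasSum_pw θ) x (fun y _ => pw_nonneg θ y)

lemma continuous_pw (x : ℕ) : Continuous (fun θ => pw θ x) := by unfold pw; fun_prop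

@[fun_prop] lemma measurable_pw (x : ℕ) : Measurable (fun θ => pw θ x) :=
  (continuous_pw x).measurable

lemma poissonChannel_singleton (θ : ℝ≥0) (x : ℕ) :
    poissonChannel θ {x} = ENNReal.ofReal (pw θ x) := poissonMeasure_singleton θ x

lemma integrable_pw (π : Prior) (x : ℕ) : Integrable (fun θ => pw θ x) (π : Measure ℝ≥0) :=
  Integrable.of_bound (measurable_pw x).aestronglyMeasurable 1
    (Filter.Eventually.of_forall fun θ => by
      rw [Real.norm_of_nonneg (pw_nonneg θ x)]; exact pw_le_one θ x)

lemma mixture_eq (π : Prior) (x : ℕ) : mixture π x = ∫ θ, pw θ x ∂(π : Measure ℝ≥0) := rfl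

lemma mixture_nonneg (π : Prior) (x : ℕ) : 0 ≤ mixture π x :=
  integral_nonneg fun θ => pw_nonneg θ x

lemma ofReal_mixture (π : Prior) (x : ℕ) :
    ENNReal.ofReal (mixture π x) = ∫⁻ θ, ENNReal.ofReal (pw θ x) ∂(π : Measure ℝ≥0) :=
  ofReal_integral_eq_lintegral_ofReal (integrable_pw π x)
    (Filter.Eventually.of_forall fun θ => pw_nonneg θ x)

instance (π : Prior) : IsProbabilityMeasure (jointLaw π) := by unfold jointLaw; infer_instance

instance (π : Prior) (n : ℕ) : IsProbabilityMeasure (sampleLaw π n) := by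
  unfold sampleLaw; infer_instance

lemma lintegral_jointLaw (π : Prior) {F : ℝ≥0 × ℕ → ℝ≥0∞} (hF : Measurable F) :
    ∫⁻ z, F z ∂(jointLaw π)
      = ∫⁻ θ, ∑' x, F (θ, x) * ENNReal.ofReal (pw θ x) ∂(π : Measure ℝ≥0) := by
  rw [jointLaw, Measure.lintegral_compProd hF]
  refine lintegral_congr fun θ => ?_
  rw [lintegral_countable']
  simp_rw [poissonChannel_singleton]

/-- The law of a single observation. -/
def obsLaw (π : Prior) : Measure ℕ := (jointLaw π).map Prod.snd

instance (π : Prior) : IsProbabilityMeasure (obsLaw π) :=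
  Measure.isProbabilityMeasure_map measurable_snd.aemeasurable

lemma measurableSet_snd_eq (x : ℕ) : MeasurableSet {z : ℝ≥0 × ℕ | z.2 = x} :=
  measurable_snd (measurableSet_singleton x)

lemma setLIntegral_jointLaw (π : Prior) (x : ℕ) {g : ℝ≥0 → ℝ≥0∞} (hg : Measurable g) :
    ∫⁻ z in {z | z.2 = x}, g z.1 ∂(jointLaw π)
      = ∫⁻ θ, g θ * ENNReal.ofReal (pw θ x) ∂(π : Measure ℝ≥0) := by
  rw [← lintegral_indicator (measurableSet_snd_eq x), lintegral_jointLaw]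
  · refine lintegral_congr fun θ => ?_
    rw [tsum_eq_single x]
    · simp
    · intro y hy; simp [hy]
  · exact (hg.comp measurable_fst).indicator (measurableSet_snd_eq x)

lemma jointLaw_snd_eq (π : Prior) (x : ℕ) :
    jointLaw π {z | z.2 = x} = ENNReal.ofReal (mixture π x) := by
  have := setLIntegral_jointLaw π x (g := fun _ => 1) measurable_const
  simpa [← ofReal_mixture] using this

lemma obsLaw_singleton (π : Prior) (x : ℕ) : obsLaw π {x} = ENNReal.ofReal (mixture π x) := by
  rw [obsLaw, Measure.map_apply measurable_snd (measurableSet_singleton x), ← jointLaw_snd_eq]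
  rfl

lemma tsum_ofReal_mixture (π : Prior) : ∑' x, ENNReal.ofReal (mixture π x) = 1 := by
  simp_rw [← obsLaw_singleton]
  have := lintegral_countable' (μ := obsLaw π) (fun _ => (1 : ℝ≥0∞))
  simpa using this.symm

lemma hasSum_mixture (π : Prior) : HasSum (mixture π) 1 := by
  have h := tsum_ofReal_mixture π
  have hs : Summable (mixture π) := by
    have := ENNReal.summable_toReal (f := fun x => ENNReal.ofReal (mixture π x)) (by simp [h])
    simpa [ENNReal.toReal_ofReal (mixture_nonneg π _)] using this
  rw [← ENNReal.ofReal_tsum_of_nonneg (mixture_nonneg π) hs] at h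
  have h1 : ∑' x, mixture π x = 1 := by simpa using h
  exact h1 ▸ hs.hasSum

lemma isMassFunction_mixture (π : Prior) : IsMassFunction (mixture π) :=
  ⟨mixture_nonneg π, hasSum_mixture π⟩

lemma obsLaw_real_singleton (π : Prior) (x : ℕ) : (obsLaw π).real {x} = mixture π x := by
  rw [measureReal_def, obsLaw_singleton, ENNReal.toReal_ofReal (mixture_nonneg π x)]

/-- The law of the observations `X₁, …, Xₙ`. -/
def dataLaw (π : Prior) (n : ℕ) : Measure (Fin n → ℕ) := Measure.pi fun _ => obsLaw π

instance (π : Prior) (n : ℕ) : IsProbabilityMeasure (dataLaw π n) := by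
  unfold dataLaw; infer_instance

lemma measurable_obs (n : ℕ) : Measurable (fun (z : Fin n → ℝ≥0 × ℕ) i => (z i).2) := by
  fun_prop

lemma lintegral_sampleLaw_eval (π : Prior) {n : ℕ} (j : Fin n) {g : ℝ≥0 × ℕ → ℝ≥0∞}
    (hg : Measurable g) :
    ∫⁻ z, g (z j) ∂(sampleLaw π n) = ∫⁻ z, g z ∂(jointLaw π) :=
  (measurePreserving_eval (fun _ : Fin n => jointLaw π) j).lintegral_comp hg

lemma dataLaw_singleton (π : Prior) {n : ℕ} (X : Fin n → ℕ) :
    dataLaw π n {X} = ∏ i, ENNReal.ofReal (mixture π (X i)) := by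
  rw [dataLaw, ← Set.univ_pi_singleton, Measure.pi_pi]
  simp_rw [obsLaw_singleton]

/-- Disintegration of the sample along the observations, for a function of the observations and of
one of the parameters. -/
lemma lintegral_sampleLaw_eq_tsum (π : Prior) {n : ℕ} (j : Fin n)
    {F : (Fin n → ℕ) → ℝ≥0 → ℝ≥0∞} (hF : ∀ X, Measurable (F X)) :
    ∫⁻ z, F (fun i => (z i).2) (z j).1 ∂(sampleLaw π n)
      = ∑' X : Fin n → ℕ, (∏ i ∈ Finset.univ.erase j, ENNReal.ofReal (mixture π (X i))) *
          ∫⁻ θ, F X θ * ENNReal.ofReal (pw θ (X j)) ∂(π : Measure ℝ≥0) := by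
  -- The sample space is cut into the countably many cylinders on which the observations are a fixed
  -- vector. On each, the restricted product law is the product of the restricted laws, so every
  -- coordinate except j integrates to its mass.
  have hU : (⋃ X : Fin n → ℕ, Set.univ.pi fun i => {z : ℝ≥0 × ℕ | z.2 = X i}) = Set.univ := by
    ext z
    simp only [Set.mem_iUnion, Set.mem_pi, Set.mem_univ, iff_true]
    exact ⟨fun i => (z i).2, fun i _ => rfl⟩
  have hm : ∀ X : Fin n → ℕ,
      MeasurableSet (Set.univ.pi fun i => {z : ℝ≥0 × ℕ | z.2 = X i}) := fun X =>
    MeasurableSet.univ_pi fun i => measurableSet_snd_eq (X i)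
  have hd : Pairwise (Function.onFun Disjoint
      fun X : Fin n → ℕ => Set.univ.pi fun i => {z : ℝ≥0 × ℕ | z.2 = X i}) := by
    intro X Y hXY
    refine Set.disjoint_left.2 fun z hz hz' => hXY ?_
    funext i
    exact (hz i trivial).symm.trans (hz' i trivial)
  rw [← setLIntegral_univ, ← hU, lintegral_iUnion hm hd]
  refine tsum_congr fun X => ?_
  have h1 : ∫⁻ z in Set.univ.pi fun i => {z : ℝ≥0 × ℕ | z.2 = X i},
      F (fun i => (z i).2) (z j).1 ∂(sampleLaw π n)
      = ∫⁻ z in Set.univ.pi fun i => {z : ℝ≥0 × ℕ | z.2 = X i}, F X (z j).1 ∂(sampleLaw π n) := by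
    refine setLIntegral_congr_fun (hm X) fun z hz => ?_
    have : (fun i => (z i).2) = X := funext fun i => hz i trivial
    simp only [this]
  rw [h1, sampleLaw, Measure.restrict_pi_pi]
  have h2 := lintegral_map (μ := Measure.pi fun i => (jointLaw π).restrict {z | z.2 = X i})
    ((hF X).comp measurable_fst) (measurable_pi_apply j)
  have h3 : ∀ z : Fin n → ℝ≥0 × ℕ, F X (z j).1 = (F X ∘ Prod.fst) (z j) := fun z => rfl
  simp_rw [h3]
  rw [← h2]
  have h4 := Measure.pi_map_eval (μ := fun i => (jointLaw π).restrict {z | z.2 = X i}) j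
  have h5 : (Function.eval j : (Fin n → ℝ≥0 × ℕ) → ℝ≥0 × ℕ) = fun z => z j := rfl
  rw [h5] at h4
  rw [h4, lintegral_smul_measure, smul_eq_mul, ← setLIntegral_jointLaw π (X j) (hF X)]
  congr 1
  refine Finset.prod_congr rfl fun i _ => ?_
  rw [Measure.restrict_apply_univ, jointLaw_snd_eq]

/-! ### The Bayes estimator -/

lemma ascFactorial_pos' (x k : ℕ) : (0 : ℝ) < ((x + 1).ascFactorial k : ℝ) := by
  exact_mod_cast Nat.ascFactorial_pos x k

/-- Since (x + k)! = x! (x + 1)_k, multiplying by θ^k shifts the Poisson mass function by k. This is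
the source of Tweedie's formula and of all moment computations below. -/
lemma pow_mul_pw (θ : ℝ≥0) (x k : ℕ) :
    (θ : ℝ) ^ k * pw θ x = ((x + 1).ascFactorial k : ℝ) * pw θ (x + k) := by
  unfold pw
  have h := Nat.factorial_mul_ascFactorial x k
  have h' : ((x + k).factorial : ℝ) = (x.factorial : ℝ) * ((x + 1).ascFactorial k : ℝ) := by
    exact_mod_cast h.symm
  have h1 : (x.factorial : ℝ) ≠ 0 := by positivity
  have h2 := (ascFactorial_pos' x k).ne'
  rw [h', pow_add]
  field_simp

lemma integrable_pow_mul_pw (π : Prior) (x k : ℕ) :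
    Integrable (fun θ : ℝ≥0 => (θ : ℝ) ^ k * pw θ x) (π : Measure ℝ≥0) := by
  simp_rw [pow_mul_pw]
  exact (integrable_pw π (x + k)).const_mul _

lemma integral_pow_mul_pw (π : Prior) (x k : ℕ) :
    ∫ θ, (θ : ℝ) ^ k * pw θ x ∂(π : Measure ℝ≥0)
      = ((x + 1).ascFactorial k : ℝ) * mixture π (x + k) := by
  simp_rw [pow_mul_pw]
  rw [integral_const_mul, mixture_eq]

/-- Makes the convention 0 / 0 = 0 harmless: where the denominator of the Bayes rule vanishes, so
does its numerator. -/
lemma mixture_add_eq_zero {π : Prior} {x : ℕ} (h : mixture π x = 0) (k : ℕ) :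
    mixture π (x + k) = 0 := by
  have h1 := (integral_eq_zero_iff_of_nonneg (fun θ => pw_nonneg θ x) (integrable_pw π x)).1 h
  have h2 : ∫ θ, (θ : ℝ) ^ k * pw θ x ∂(π : Measure ℝ≥0) = 0 := by
    refine integral_eq_zero_of_ae ?_
    filter_upwards [h1] with θ hθ
    simp only [Pi.zero_apply] at hθ ⊢
    rw [hθ, mul_zero]
  rw [integral_pow_mul_pw] at h2
  exact (mul_eq_zero.1 h2).resolve_left (ascFactorial_pos' x k).ne'

lemma bayes_mul_mixture (k : ℕ) (π : Prior) (x : ℕ) :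
    bayes k π x * mixture π x = ((x + 1).ascFactorial k : ℝ) * mixture π (x + k) := by
  unfold bayes
  by_cases h : mixture π x = 0
  · rw [h, mixture_add_eq_zero h k]; simp
  · field_simp

lemma bayes_nonneg (k : ℕ) (π : Prior) (x : ℕ) : 0 ≤ bayes k π x := by
  unfold bayes
  have := mixture_nonneg π x
  have := mixture_nonneg π (x + k)
  positivity

lemma ae_le_of_mem_boundedPriors {h : ℝ} {π : Prior} (hπ : π ∈ boundedPriors h) :
    ∀ᵐ θ : ℝ≥0 ∂(π : Measure ℝ≥0), (θ : ℝ) ≤ h := by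
  have hm : MeasurableSet {θ : ℝ≥0 | (θ : ℝ) ≤ h} :=
    measurableSet_le (by fun_prop) measurable_const
  exact (prob_compl_eq_zero_iff hm).2 hπ

lemma nonneg_of_mem_boundedPriors {h : ℝ} {π : Prior} (hπ : π ∈ boundedPriors h) : 0 ≤ h := by
  obtain ⟨θ, hθ⟩ := (ae_le_of_mem_boundedPriors hπ).exists
  exact θ.2.trans hθ

lemma bayes_le {k : ℕ} {h : ℝ} {π : Prior} (hπ : π ∈ boundedPriors h) (x : ℕ) :
    bayes k π x ≤ h ^ k := by
  have h0 := nonneg_of_mem_boundedPriors hπ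
  rcases (mixture_nonneg π x).eq_or_lt with h1 | h1
  · unfold bayes; rw [← h1]; simp; positivity
  · rw [← mul_le_mul_iff_left₀ h1, bayes_mul_mixture, ← integral_pow_mul_pw, mixture_eq,
      ← integral_const_mul]
    refine integral_mono_ae (integrable_pow_mul_pw π x k) ((integrable_pw π x).const_mul _) ?_
    filter_upwards [ae_le_of_mem_boundedPriors hπ] with θ hθ
    have := pw_nonneg θ x
    gcongr

/-- Either π charges θ > 0, where every Poisson weight is positive, or π is the point mass at 0. -/
lemma mixture_pos_or (π : Prior) :
    (∀ x, 0 < mixture π x) ∨ (∀ x, 1 ≤ x → mixture π x = 0) := by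
  by_contra! hc
  obtain ⟨⟨x, hx⟩, ⟨y, hy, hy'⟩⟩ := hc
  have hx0 : mixture π x = 0 := le_antisymm hx (mixture_nonneg π x)
  have h1 := (integral_eq_zero_iff_of_nonneg (fun θ => pw_nonneg θ x) (integrable_pw π x)).1 hx0
  refine hy' (integral_eq_zero_of_ae ?_)
  filter_upwards [h1] with θ hθ
  simp only [Pi.zero_apply, pw] at hθ ⊢
  have : (θ : ℝ) = 0 := by
    by_contra hne
    have : (0 : ℝ) < θ := lt_of_le_of_ne θ.2 (Ne.symm hne)
    have : 0 < Real.exp (-(θ : ℝ)) * (θ : ℝ) ^ x / (x.factorial : ℝ) := by positivity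
    linarith
  rw [this, zero_pow (by omega)]; simp

lemma integral_add_four {α : Type*} [MeasurableSpace α] {μ : Measure α} {f₁ f₂ f₃ f₄ : α → ℝ}
    (h₁ : Integrable f₁ μ) (h₂ : Integrable f₂ μ) (h₃ : Integrable f₃ μ) (h₄ : Integrable f₄ μ)
    (c₁ c₂ c₃ c₄ : ℝ) :
    ∫ a, (c₁ * f₁ a + c₂ * f₂ a + c₃ * f₃ a + c₄ * f₄ a) ∂μ
      = c₁ * ∫ a, f₁ a ∂μ + c₂ * ∫ a, f₂ a ∂μ + c₃ * ∫ a, f₃ a ∂μ + c₄ * ∫ a, f₄ a ∂μ := by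
  have i₂ : Integrable (fun a => c₁ * f₁ a + c₂ * f₂ a) μ := (h₁.const_mul _).add (h₂.const_mul _)
  have i₃ : Integrable (fun a => c₁ * f₁ a + c₂ * f₂ a + c₃ * f₃ a) μ := i₂.add (h₃.const_mul _)
  rw [integral_add i₃ (h₄.const_mul _), integral_add i₂ (h₃.const_mul _),
    integral_add (h₁.const_mul _) (h₂.const_mul _)]
  simp only [integral_const_mul]

/-- The inequality between the moments of `e^{-θ} dπ(θ)` behind the monotonicity of the Bayes
estimator. -/
lemma moment_ineq (π : Prior) (x k : ℕ) :
    (∫ θ : ℝ≥0, (θ : ℝ) ^ k * pw θ x ∂(π : Measure ℝ≥0)) *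
        (∫ θ : ℝ≥0, (θ : ℝ) ^ 1 * pw θ x ∂(π : Measure ℝ≥0)) ≤
      (∫ θ : ℝ≥0, (θ : ℝ) ^ (k + 1) * pw θ x ∂(π : Measure ℝ≥0)) *
        (∫ θ : ℝ≥0, (θ : ℝ) ^ 0 * pw θ x ∂(π : Measure ℝ≥0)) := by
  set m : ℕ → ℝ := fun j => ∫ θ : ℝ≥0, (θ : ℝ) ^ j * pw θ x ∂(π : Measure ℝ≥0) with hm
  have hint : ∀ j, Integrable (fun θ : ℝ≥0 => (θ : ℝ) ^ j * pw θ x) (π : Measure ℝ≥0) :=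
    fun j => integrable_pow_mul_pw π x j
  -- Chebyshev's association inequality, done one variable at a time: (θ - a)(θ^k - a^k) ≥ 0 is
  -- integrated first in θ, then in a, which avoids a double integral.
  have key : ∀ a : ℝ≥0, 0 ≤ m (k + 1) - a * m k - a ^ k * m 1 + a ^ (k + 1) * m 0 := by
    intro a
    have h1 : ∫ θ : ℝ≥0, ((θ : ℝ) - a) * ((θ : ℝ) ^ k - a ^ k) * pw θ x ∂(π : Measure ℝ≥0)
        = m (k + 1) - a * m k - a ^ k * m 1 + a ^ (k + 1) * m 0 := by
      have : ∀ θ : ℝ≥0, ((θ : ℝ) - a) * ((θ : ℝ) ^ k - a ^ k) * pw θ x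
          = 1 * ((θ : ℝ) ^ (k + 1) * pw θ x) + (-a) * ((θ : ℝ) ^ k * pw θ x)
            + (-a ^ k) * ((θ : ℝ) ^ 1 * pw θ x) + a ^ (k + 1) * ((θ : ℝ) ^ 0 * pw θ x) := by
        intro θ; ring
      simp_rw [this]
      rw [integral_add_four (hint _) (hint _) (hint _) (hint _)]
      simp only [hm]
      ring
    rw [← h1]
    refine integral_nonneg fun θ => mul_nonneg ?_ (pw_nonneg θ x)
    rcases le_total (θ : ℝ) a with h | h
    · exact mul_nonneg_of_nonpos_of_nonpos (by linarith)
        (by have := pow_le_pow_left₀ θ.2 h k; exact sub_nonpos.2 this)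
    · exact mul_nonneg (by linarith)
        (by have := pow_le_pow_left₀ a.2 h k; exact sub_nonneg.2 this)
  have h2 : ∫ a : ℝ≥0, (m (k + 1) - a * m k - a ^ k * m 1 + a ^ (k + 1) * m 0) * pw a x
      ∂(π : Measure ℝ≥0) = 2 * (m (k + 1) * m 0 - m k * m 1) := by
    have : ∀ a : ℝ≥0, (m (k + 1) - a * m k - a ^ k * m 1 + a ^ (k + 1) * m 0) * pw a x
        = m (k + 1) * ((a : ℝ) ^ 0 * pw a x) + (-m k) * ((a : ℝ) ^ 1 * pw a x)
          + (-m 1) * ((a : ℝ) ^ k * pw a x) + m 0 * ((a : ℝ) ^ (k + 1) * pw a x) := by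
      intro a; ring
    simp_rw [this]
    rw [integral_add_four (hint _) (hint _) (hint _) (hint _)]
    simp only [hm]
    ring
  have h3 : 0 ≤ 2 * (m (k + 1) * m 0 - m k * m 1) := by
    rw [← h2]
    exact integral_nonneg fun a => mul_nonneg (key a) (pw_nonneg a x)
  linarith

/-- `moment_ineq` in terms of the mixture, after (x + 1)_{k+1} = (x + 1)(x + 2)_k, is the claim
cross-multiplied. The remaining case is the point mass at 0, where the Bayes rule is 0 because k ≥
1. -/
lemma bayes_monotone {k : ℕ} (hk : 1 ≤ k) (π : Prior) : Monotone (bayes k π) := by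
  refine monotone_nat_of_le_succ fun x => ?_
  rcases mixture_pos_or π with hp | hz
  · have h := moment_ineq π x k
    simp only [integral_pow_mul_pw] at h
    simp only [bayes]
    rw [div_le_div_iff₀ (hp _) (hp _)]
    have e1 : ((x + 1).ascFactorial (k + 1) : ℝ) = (x + 1) * ((x + 1 + 1).ascFactorial k : ℝ) := by
      have h1 := Nat.succ_ascFactorial (x + 1) k
      rw [← Nat.ascFactorial_succ] at h1
      exact_mod_cast h1.symm
    have e2 : x + (k + 1) = x + 1 + k := by ring
    rw [e1, e2] at h
    simp only [Nat.ascFactorial_zero, Nat.cast_one, one_mul, add_zero] at h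
    have e3 : ((x + 1).ascFactorial 1 : ℝ) = x + 1 := by simp [Nat.ascFactorial_succ]
    rw [e3] at h
    have hx : (0 : ℝ) < x + 1 := by positivity
    nlinarith [h]
  · have : bayes k π x = 0 := by
      unfold bayes; rw [hz (x + k) (by omega)]; simp
    rw [this]; exact bayes_nonneg _ _ _

/-! ### Decomposition of the risk -/

lemma measurable_sqErr_snd (k : ℕ) (t : ℕ → ℝ) :
    Measurable (fun z : ℝ≥0 × ℕ => ENNReal.ofReal ((t z.2 - (z.1 : ℝ) ^ k) ^ 2)) := by
  have : Measurable (fun z : ℝ≥0 × ℕ => t z.2) := Measurable.of_discrete.comp measurable_snd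
  fun_prop

/-- No moment of π is needed: at a fixed x the Poisson weight makes every power of θ integrable, and
the shift identity evaluates the integrals. -/
lemma lintegral_sqErr_mul_pw (k : ℕ) (π : Prior) (x : ℕ) (c : ℝ) :
    ∫⁻ θ, ENNReal.ofReal ((c - (θ : ℝ) ^ k) ^ 2) * ENNReal.ofReal (pw θ x) ∂(π : Measure ℝ≥0)
      = ENNReal.ofReal (c ^ 2 * mixture π x
          - 2 * c * (((x + 1).ascFactorial k : ℝ) * mixture π (x + k))
          + ((x + 1).ascFactorial (2 * k) : ℝ) * mixture π (x + 2 * k)) := by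
  have h1 : ∀ θ : ℝ≥0, ENNReal.ofReal ((c - (θ : ℝ) ^ k) ^ 2) * ENNReal.ofReal (pw θ x)
      = ENNReal.ofReal (c ^ 2 * pw θ x + (-2 * c) * ((θ : ℝ) ^ k * pw θ x)
        + 1 * ((θ : ℝ) ^ (2 * k) * pw θ x) + 0 * pw θ x) := by
    intro θ
    rw [← ENNReal.ofReal_mul (sq_nonneg _)]
    congr 1; ring
  simp_rw [h1]
  have i0 := integrable_pw π x
  have i1 := integrable_pow_mul_pw π x k
  have i2 := integrable_pow_mul_pw π x (2 * k)
  rw [← ofReal_integral_eq_lintegral_ofReal, integral_add_four i0 i1 i2 i0]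
  · rw [integral_pow_mul_pw, integral_pow_mul_pw, ← mixture_eq]
    congr 1; ring
  · exact (((i0.const_mul _).add (i1.const_mul _)).add (i2.const_mul _)).add (i0.const_mul _)
  · refine Filter.Eventually.of_forall fun θ => ?_
    have : c ^ 2 * pw θ x + (-2 * c) * ((θ : ℝ) ^ k * pw θ x)
        + 1 * ((θ : ℝ) ^ (2 * k) * pw θ x) + 0 * pw θ x = (c - (θ : ℝ) ^ k) ^ 2 * pw θ x := by ring
    simp only [Pi.zero_apply]
    rw [this]
    exact mul_nonneg (sq_nonneg _) (pw_nonneg θ x)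

/-- Orthogonality: the conditional risk splits into the conditional regret and the Bayes risk. -/
lemma lintegral_sqErr_eq_add (k : ℕ) (π : Prior) (x : ℕ) (c : ℝ) :
    ∫⁻ θ, ENNReal.ofReal ((c - (θ : ℝ) ^ k) ^ 2) * ENNReal.ofReal (pw θ x) ∂(π : Measure ℝ≥0)
      = ENNReal.ofReal ((c - bayes k π x) ^ 2) * ENNReal.ofReal (mixture π x)
        + ∫⁻ θ, ENNReal.ofReal ((bayes k π x - (θ : ℝ) ^ k) ^ 2) * ENNReal.ofReal (pw θ x)
            ∂(π : Measure ℝ≥0) := by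
  have hle : ∀ c : ℝ, 0 ≤ c ^ 2 * mixture π x
      - 2 * c * (((x + 1).ascFactorial k : ℝ) * mixture π (x + k))
      + ((x + 1).ascFactorial (2 * k) : ℝ) * mixture π (x + 2 * k) := by
    intro c
    have i0 := integrable_pw π x
    have i1 := integrable_pow_mul_pw π x k
    have i2 := integrable_pow_mul_pw π x (2 * k)
    have h0 : 0 ≤ ∫ θ : ℝ≥0, (c ^ 2 * pw θ x + (-2 * c) * ((θ : ℝ) ^ k * pw θ x)
        + 1 * ((θ : ℝ) ^ (2 * k) * pw θ x) + 0 * pw θ x) ∂(π : Measure ℝ≥0) := by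
      refine integral_nonneg fun θ => ?_
      have : c ^ 2 * pw θ x + (-2 * c) * ((θ : ℝ) ^ k * pw θ x)
          + 1 * ((θ : ℝ) ^ (2 * k) * pw θ x) + 0 * pw θ x = (c - (θ : ℝ) ^ k) ^ 2 * pw θ x := by
        ring
      simp only [Pi.zero_apply]
      rw [this]
      exact mul_nonneg (sq_nonneg _) (pw_nonneg θ x)
    rw [integral_add_four i0 i1 i2 i0, integral_pow_mul_pw, integral_pow_mul_pw,
      ← mixture_eq] at h0
    linarith
  rw [lintegral_sqErr_mul_pw, lintegral_sqErr_mul_pw, ← ENNReal.ofReal_mul (sq_nonneg _),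
    ← ENNReal.ofReal_add (mul_nonneg (sq_nonneg _) (mixture_nonneg π x)) (hle _)]
  congr 1
  rw [← bayes_mul_mixture]; ring

/-- The Bayes risk. -/
def bayesRisk (k : ℕ) (π : Prior) : ℝ≥0∞ :=
  ∫⁻ z, ENNReal.ofReal ((bayes k π z.2 - (z.1 : ℝ) ^ k) ^ 2) ∂(jointLaw π)

lemma lintegral_sqErr_jointLaw (k : ℕ) (π : Prior) (t : ℕ → ℝ) :
    ∫⁻ z, ENNReal.ofReal ((t z.2 - (z.1 : ℝ) ^ k) ^ 2) ∂(jointLaw π)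
      = ∑' x, ∫⁻ θ, ENNReal.ofReal ((t x - (θ : ℝ) ^ k) ^ 2) * ENNReal.ofReal (pw θ x)
          ∂(π : Measure ℝ≥0) := by
  rw [lintegral_jointLaw π (measurable_sqErr_snd k t), lintegral_tsum]
  intro x
  have := measurable_pw x
  fun_prop

/-- The infimum over t decouples over the values x, and orthogonality shows that `bayes` is optimal
at each of them. -/
lemma mmse_eq_bayesRisk (k : ℕ) (π : Prior) :
    mmse (fun θ => (θ : ℝ) ^ k) π = bayesRisk k π := by
  refine le_antisymm (iInf_le_of_le (bayes k π) le_rfl) (le_iInf fun t => ?_)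
  rw [bayesRisk, lintegral_sqErr_jointLaw, lintegral_sqErr_jointLaw]
  refine ENNReal.tsum_le_tsum fun x => ?_
  rw [lintegral_sqErr_eq_add k π x (t x)]
  exact le_add_self

/-- The expected distance of `T` to the Bayes estimator on the event that the data is in `A`. -/
def excess (k : ℕ) {n : ℕ} (T : Estimator n) (π : Prior) (A : Set (Fin n → ℕ)) : ℝ≥0∞ :=
  ∫⁻ X in A, ∑ j, ENNReal.ofReal ((T X j - bayes k π (X j)) ^ 2) ∂(dataLaw π n)

lemma measurable_sqErr_sample (k : ℕ) {n : ℕ} (T : Estimator n) (j : Fin n) :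
    Measurable (fun z : Fin n → ℝ≥0 × ℕ =>
      ENNReal.ofReal ((T (fun i => (z i).2) j - ((z j).1 : ℝ) ^ k) ^ 2)) := by
  have : Measurable (fun z : Fin n → ℝ≥0 × ℕ => T (fun i => (z i).2) j) :=
    (Measurable.of_discrete (f := fun X => T X j)).comp (measurable_obs n)
  fun_prop

lemma measurableSet_obs {n : ℕ} (A : Set (Fin n → ℕ)) :
    MeasurableSet {z : Fin n → ℝ≥0 × ℕ | (fun i => (z i).2) ∈ A} :=
  measurable_obs n (MeasurableSet.of_discrete (s := A))

/-- The event depends on the observations only, so orthogonality can be applied on each fibre and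
survives the restriction. -/
lemma setLIntegral_sqErr_sample (k : ℕ) {n : ℕ} (T : Estimator n) (π : Prior)
    (A : Set (Fin n → ℕ)) (j : Fin n) :
    ∫⁻ z in {z | (fun i => (z i).2) ∈ A},
        ENNReal.ofReal ((T (fun i => (z i).2) j - ((z j).1 : ℝ) ^ k) ^ 2) ∂(sampleLaw π n)
      = ∫⁻ X in A, ENNReal.ofReal ((T X j - bayes k π (X j)) ^ 2) ∂(dataLaw π n)
        + ∫⁻ z in {z | (fun i => (z i).2) ∈ A},
          ENNReal.ofReal ((bayes k π (z j).2 - ((z j).1 : ℝ) ^ k) ^ 2) ∂(sampleLaw π n) := by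
  classical
  rw [← lintegral_indicator (measurableSet_obs A), ← lintegral_indicator (measurableSet_obs A),
    ← lintegral_indicator MeasurableSet.of_discrete]
  have e : ∀ c : (Fin n → ℕ) → ℝ, (fun z : Fin n → ℝ≥0 × ℕ =>
      Set.indicator {z | (fun i => (z i).2) ∈ A} (fun z : Fin n → ℝ≥0 × ℕ =>
        ENNReal.ofReal ((c (fun i => (z i).2) - ((z j).1 : ℝ) ^ k) ^ 2)) z)
      = fun z => (fun (X : Fin n → ℕ) (θ : ℝ≥0) =>
        (if X ∈ A then 1 else 0) * ENNReal.ofReal ((c X - (θ : ℝ) ^ k) ^ 2))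
          (fun i => (z i).2) (z j).1 := by
    intro c; funext z
    by_cases hz : (fun i => (z i).2) ∈ A <;> simp [Set.indicator, hz]
  have e1 := e fun X => T X j
  have e2 := e fun X => bayes k π (X j)
  simp only at e1 e2
  rw [e1, e2, lintegral_sampleLaw_eq_tsum π j
      (F := fun X θ => (if X ∈ A then 1 else 0) * ENNReal.ofReal ((T X j - (θ : ℝ) ^ k) ^ 2))
      (fun X => by fun_prop),
    lintegral_sampleLaw_eq_tsum π j
      (F := fun X θ =>
        (if X ∈ A then 1 else 0) * ENNReal.ofReal ((bayes k π (X j) - (θ : ℝ) ^ k) ^ 2))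
      (fun X => by fun_prop),
    lintegral_countable', ← ENNReal.tsum_add]
  refine tsum_congr fun X => ?_
  by_cases hX : X ∈ A
  · simp only [hX, if_true, one_mul, Set.indicator_of_mem]
    rw [lintegral_sqErr_eq_add, mul_add, dataLaw_singleton,
      ← Finset.mul_prod_erase _ _ (Finset.mem_univ j)]
    ring
  · simp [hX]

lemma totalRisk_eq (k : ℕ) {n : ℕ} (T : Estimator n) (π : Prior) :
    totalRisk (fun θ => (θ : ℝ) ^ k) T π
      = excess k T π Set.univ + n * mmse (fun θ => (θ : ℝ) ^ k) π := by
  unfold totalRisk excess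
  rw [lintegral_finsetSum _ fun j _ => measurable_sqErr_sample k T j,
    lintegral_finsetSum _ fun j _ => Measurable.of_discrete]
  have h := fun j => setLIntegral_sqErr_sample k T π Set.univ j
  simp only [Set.mem_univ, Set.ofPred_true, Measure.restrict_univ] at h
  simp_rw [h, Finset.sum_add_distrib, Measure.restrict_univ]
  congr 1
  rw [mmse_eq_bayesRisk, bayesRisk]
  have : ∀ j : Fin n, ∫⁻ z, ENNReal.ofReal ((bayes k π (z j).2 - ((z j).1 : ℝ) ^ k) ^ 2)
      ∂(sampleLaw π n) = ∫⁻ z, ENNReal.ofReal ((bayes k π z.2 - (z.1 : ℝ) ^ k) ^ 2)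
        ∂(jointLaw π) := fun j =>
    lintegral_sampleLaw_eval π j (measurable_sqErr_snd k (bayes k π))
  simp_rw [this]
  simp

/-- Finiteness is what allows the mmse to be cancelled in the truncated subtraction of [0, ∞]. -/
lemma mmse_ne_top (k : ℕ) {h : ℝ} {π : Prior} (hπ : π ∈ boundedPriors h) :
    mmse (fun θ => (θ : ℝ) ^ k) π ≠ ⊤ := by
  refine ne_top_of_le_ne_top (b := ENNReal.ofReal (h ^ k * h ^ k)) ENNReal.ofReal_ne_top ?_
  refine (iInf_le _ fun _ => 0).trans ?_
  rw [lintegral_jointLaw π (measurable_sqErr_snd k fun _ => 0)]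
  have h0 := nonneg_of_mem_boundedPriors hπ
  calc ∫⁻ θ, ∑' x, ENNReal.ofReal ((0 - (θ : ℝ) ^ k) ^ 2) * ENNReal.ofReal (pw θ x)
        ∂(π : Measure ℝ≥0)
      ≤ ∫⁻ θ, ENNReal.ofReal (h ^ k * h ^ k) ∂(π : Measure ℝ≥0) := by
        refine lintegral_mono_ae ?_
        filter_upwards [ae_le_of_mem_boundedPriors hπ] with θ hθ
        rw [ENNReal.tsum_mul_left, ← ENNReal.ofReal_tsum_of_nonneg (pw_nonneg θ)
          (hasSum_pw θ).summable, (hasSum_pw θ).tsum_eq, ENNReal.ofReal_one, mul_one]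
        refine ENNReal.ofReal_le_ofReal ?_
        have : (θ : ℝ) ^ k ≤ h ^ k := pow_le_pow_left₀ θ.2 hθ k
        have h2 : (0 : ℝ) ≤ (θ : ℝ) ^ k := by positivity
        nlinarith
    _ = _ := by simp

lemma totalRegret_eq_excess (k : ℕ) {n : ℕ} (T : Estimator n) {h : ℝ} {π : Prior}
    (hπ : π ∈ boundedPriors h) :
    totalRegret (fun θ => (θ : ℝ) ^ k) T π = excess k T π Set.univ := by
  rw [totalRegret, totalRisk_eq]
  exact ENNReal.add_sub_cancel_right (ENNReal.mul_ne_top (by simp) (mmse_ne_top k hπ))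

/-! ### Truncation of the prior -/

lemma measurableSet_le_param (h : ℝ) : MeasurableSet {θ : ℝ≥0 | (θ : ℝ) ≤ h} :=
  measurableSet_le (by fun_prop) measurable_const

/-- The prior `π` conditioned on `θ ≤ h`. -/
def condPrior (π : Prior) (h : ℝ) (hw : (π : Measure ℝ≥0) {θ | (θ : ℝ) ≤ h} ≠ 0) : Prior :=
  ⟨cond (π : Measure ℝ≥0) {θ | (θ : ℝ) ≤ h}, cond_isProbabilityMeasure hw⟩

section Truncation

variable {π : Prior} {h : ℝ} (hw : (π : Measure ℝ≥0) {θ | (θ : ℝ) ≤ h} ≠ 0)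

lemma condPrior_mem : condPrior π h hw ∈ boundedPriors h :=
  cond_apply_self hw (measure_ne_top _ _)

lemma lintegral_condPrior (G : ℝ≥0 → ℝ≥0∞) :
    (π : Measure ℝ≥0) {θ | (θ : ℝ) ≤ h} * ∫⁻ θ, G θ ∂(condPrior π h hw : Measure ℝ≥0)
      = ∫⁻ θ in {θ | (θ : ℝ) ≤ h}, G θ ∂(π : Measure ℝ≥0) := by
  have : ((condPrior π h hw : Prior) : Measure ℝ≥0)
      = cond (π : Measure ℝ≥0) {θ | (θ : ℝ) ≤ h} := rfl
  rw [this, ProbabilityTheory.cond, lintegral_smul_measure, smul_eq_mul, ← mul_assoc,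
    ENNReal.mul_inv_cancel hw (measure_ne_top _ _), one_mul]

lemma measurableSet_fst_le (h : ℝ) : MeasurableSet {z : ℝ≥0 × ℕ | (z.1 : ℝ) ≤ h} :=
  measurable_fst (measurableSet_le_param h)

lemma setLIntegral_jointLaw_le {F : ℝ≥0 × ℕ → ℝ≥0∞} (hF : Measurable F) :
    ∫⁻ z in {z | (z.1 : ℝ) ≤ h}, F z ∂(jointLaw π)
      = (π : Measure ℝ≥0) {θ | (θ : ℝ) ≤ h} * ∫⁻ z, F z ∂(jointLaw (condPrior π h hw)) := by
  rw [← lintegral_indicator (measurableSet_fst_le h),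
    lintegral_jointLaw π (hF.indicator (measurableSet_fst_le h)),
    lintegral_jointLaw _ hF, lintegral_condPrior, ← lintegral_indicator (measurableSet_le_param h)]
  refine lintegral_congr fun θ => ?_
  by_cases hθ : (θ : ℝ) ≤ h <;> simp [Set.indicator, hθ]

/-- The event that all parameters are at most h is a product event, so conditioning on it keeps the
pairs i.i.d. and only changes the prior. -/
lemma restrict_sampleLaw (n : ℕ) :
    (sampleLaw π n).restrict (Set.univ.pi fun _ => {z | (z.1 : ℝ) ≤ h})
      = (π : Measure ℝ≥0) {θ | (θ : ℝ) ≤ h} ^ n • sampleLaw (condPrior π h hw) n := by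
  unfold sampleLaw
  rw [Measure.restrict_pi_pi]
  refine Measure.pi_eq fun s hs => ?_
  rw [Measure.smul_apply, Measure.pi_pi, smul_eq_mul]
  have : ∀ i, (jointLaw π).restrict {z | (z.1 : ℝ) ≤ h} (s i)
      = (π : Measure ℝ≥0) {θ | (θ : ℝ) ≤ h} * jointLaw (condPrior π h hw) (s i) := by
    intro i
    rw [← lintegral_indicator_one (hs i), setLIntegral_jointLaw_le hw
      (measurable_one.indicator (hs i)), lintegral_indicator_one (hs i)]
  simp_rw [this, Finset.prod_mul_distrib]
  simp

/-- The expected loss of any t under π is at least its part on θ ≤ h, which is the loss under the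
conditioned prior up to the factor π[θ ≤ h]. -/
lemma mul_mmse_condPrior_le (k : ℕ) :
    (π : Measure ℝ≥0) {θ | (θ : ℝ) ≤ h} * mmse (fun θ => (θ : ℝ) ^ k) (condPrior π h hw)
      ≤ mmse (fun θ => (θ : ℝ) ^ k) π := by
  refine le_iInf fun t => ?_
  calc _ ≤ (π : Measure ℝ≥0) {θ | (θ : ℝ) ≤ h} *
        ∫⁻ z, ENNReal.ofReal ((t z.2 - (z.1 : ℝ) ^ k) ^ 2) ∂(jointLaw (condPrior π h hw)) := by
        gcongr; exact iInf_le _ t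
    _ = _ := (setLIntegral_jointLaw_le hw (measurable_sqErr_snd k t)).symm
    _ ≤ _ := setLIntegral_le_lintegral _ _

/-- The event that all parameters are at most `h` and all observations at most `K`. -/
def goodEvent (n : ℕ) (h : ℝ) (K : ℕ) : Set (Fin n → ℝ≥0 × ℕ) :=
  {z | ∀ i, ((z i).1 : ℝ) ≤ h ∧ (z i).2 ≤ K}

lemma measurableSet_goodEvent (n : ℕ) (h : ℝ) (K : ℕ) : MeasurableSet (goodEvent n h K) := by
  have : goodEvent n h K = ⋂ i, (fun z => z i) ⁻¹' ({z | (z.1 : ℝ) ≤ h} ∩ {z | z.2 ≤ K}) := by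
    ext z; simp [goodEvent]
  rw [this]
  exact MeasurableSet.iInter fun i => measurable_pi_apply i
    ((measurableSet_fst_le h).inter (measurable_snd (MeasurableSet.of_discrete (s := Set.Iic K))))

/-- With w = π[θ ≤ h], the risk on the good event is w^n times a risk under the conditioned prior,
hence its excess plus its Bayes risk. Since w^n ≤ w and w times the conditioned mmse is at most the
mmse of π, the Bayes part is absorbed by the subtracted n · mmse. -/
theorem totalRegret_le_excess_add (k : ℕ) {n : ℕ} (hn : n ≠ 0) (K : ℕ) (T : Estimator n) :
    totalRegret (fun θ => (θ : ℝ) ^ k) T π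
      ≤ excess k T (condPrior π h hw) {X | ∀ i, X i ≤ K}
        + ∫⁻ z in (goodEvent n h K)ᶜ, ∑ j,
          ENNReal.ofReal ((T (fun i => (z i).2) j - ((z j).1 : ℝ) ^ k) ^ 2) ∂(sampleLaw π n) := by
  set w := (π : Measure ℝ≥0) {θ | (θ : ℝ) ≤ h} with hwdef
  set π' := condPrior π h hw with hπ'
  set S : (Fin n → ℝ≥0 × ℕ) → ℝ≥0∞ := fun z => ∑ j,
    ENNReal.ofReal ((T (fun i => (z i).2) j - ((z j).1 : ℝ) ^ k) ^ 2) with hS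
  set A : Set (Fin n → ℕ) := {X | ∀ i, X i ≤ K} with hA
  have hw1 : w ≤ 1 := prob_le_one
  have hwn : w ^ n ≤ w := by
    obtain ⟨m, rfl⟩ := Nat.exists_eq_succ_of_ne_zero hn
    rw [pow_succ]; exact mul_le_of_le_one_left' (pow_le_one' hw1 m)
  have hgood : ∫⁻ z in goodEvent n h K, S z ∂(sampleLaw π n)
      ≤ excess k T π' A + n * mmse (fun θ => (θ : ℝ) ^ k) π := by
    have e : goodEvent n h K = {z | (fun i => (z i).2) ∈ A} ∩
        Set.univ.pi fun _ => {z : ℝ≥0 × ℕ | (z.1 : ℝ) ≤ h} := by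
      ext z; simp [goodEvent, hA, forall_and, and_comm]
    rw [e, ← Measure.restrict_restrict (measurableSet_obs A), restrict_sampleLaw hw,
      Measure.restrict_smul, lintegral_smul_measure, smul_eq_mul, hS,
      lintegral_finsetSum _ fun j _ => measurable_sqErr_sample k T j]
    simp_rw [setLIntegral_sqErr_sample]
    rw [Finset.sum_add_distrib, mul_add]
    refine add_le_add ?_ ?_
    · rw [excess, lintegral_finsetSum _ fun j _ => Measurable.of_discrete]
      exact mul_le_of_le_one_left' (pow_le_one' hw1 n)
    · calc _ ≤ w * ∑ j : Fin n, mmse (fun θ => (θ : ℝ) ^ k) π' := by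
            gcongr with j
            refine (setLIntegral_le_lintegral _ _).trans ?_
            rw [mmse_eq_bayesRisk, bayesRisk]
            exact (lintegral_sampleLaw_eval π' j (measurable_sqErr_snd k (bayes k π'))).le
        _ = n * (w * mmse (fun θ => (θ : ℝ) ^ k) π') := by simp; ring
        _ ≤ _ := by gcongr; exact mul_mmse_condPrior_le hw k
  rw [totalRegret, tsub_le_iff_right, totalRisk,
    ← lintegral_add_compl _ (measurableSet_goodEvent n h K)]
  calc _ ≤ (excess k T π' A + n * mmse (fun θ => (θ : ℝ) ^ k) π) + _ := by gcongr
    _ = _ := by ring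

end Truncation

/-! ### Moments of the counts -/

lemma count_le {n : ℕ} (X : Fin n → ℕ) (x : ℕ) : count X x ≤ n := by
  unfold count
  exact (Finset.card_le_univ _).trans (by simp)

lemma count_eq_sum {n : ℕ} (X : Fin n → ℕ) (x : ℕ) :
    count X x = ∑ i, if X i = x then 1 else 0 := by
  rw [count, Finset.card_filter]

lemma count_succAbove {n : ℕ} (X : Fin (n + 1) → ℕ) (i : Fin (n + 1)) (x : ℕ) :
    count X x = (if X i = x then 1 else 0) + count (fun j => X (i.succAbove j)) x := by
  rw [count_eq_sum, count_eq_sum, Fin.sum_univ_succAbove _ i]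

lemma integrable_count₂ (π : Prior) (n x y : ℕ) (ψ : ℕ → ℕ → ℝ) :
    Integrable (fun X : Fin n → ℕ => ψ (count X x) (count X y)) (dataLaw π n) := by
  refine Integrable.of_bound (Measurable.of_discrete).aestronglyMeasurable
    (∑ a ∈ Finset.range (n + 1), ∑ b ∈ Finset.range (n + 1), |ψ a b|)
    (Filter.Eventually.of_forall fun X => ?_)
  rw [Real.norm_eq_abs]
  have h1 : count X x ∈ Finset.range (n + 1) := by
    have := count_le X x; simp; omega
  have h2 : count X y ∈ Finset.range (n + 1) := by
    have := count_le X y; simp; omega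
  refine le_trans ?_ (Finset.single_le_sum (f := fun a => ∑ b ∈ Finset.range (n + 1), |ψ a b|)
    (fun a _ => Finset.sum_nonneg fun b _ => abs_nonneg _) h1)
  exact Finset.single_le_sum (f := fun b => |ψ (count X x) b|) (fun b _ => abs_nonneg _) h2

/-- Given X_i = y, the other n observations are still i.i.d.; deleting the i-th lowers N(y) by one
and leaves N(x) unchanged as x ≠ y. -/
lemma integral_ite_mul_count₂ (π : Prior) (n : ℕ) {x y : ℕ} (hxy : x ≠ y) (ψ : ℕ → ℕ → ℝ)
    (i : Fin (n + 1)) :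
    ∫ X, (if X i = y then 1 else 0) * ψ (count X x) (count X y) ∂(dataLaw π (n + 1))
      = mixture π y * ∫ X, ψ (count X x) (count X y + 1) ∂(dataLaw π n) := by
  have hmp := measurePreserving_piFinSuccAbove (fun _ : Fin (n + 1) => obsLaw π) i
  have h1 : ∀ X : Fin (n + 1) → ℕ,
      (if X i = y then 1 else 0) * ψ (count X x) (count X y)
      = (fun p : ℕ × (Fin n → ℕ) => (if p.1 = y then (1 : ℝ) else 0) *
          ψ (count p.2 x) (count p.2 y + 1))
        (MeasurableEquiv.piFinSuccAbove (fun _ => ℕ) i X) := by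
    intro X
    have e : MeasurableEquiv.piFinSuccAbove (fun _ => ℕ) i X
        = (X i, fun j => X (i.succAbove j)) := rfl
    rw [e]
    by_cases hX : X i = y
    · rw [count_succAbove X i x, count_succAbove X i y]
      have : X i ≠ x := fun h => hxy (h.symm.trans hX)
      simp [hX, Ne.symm hxy, add_comm]
    · simp [hX]
  simp_rw [h1]
  unfold dataLaw
  rw [hmp.integral_comp (MeasurableEquiv.measurableEmbedding _)
      (fun p : ℕ × (Fin n → ℕ) => (if p.1 = y then (1 : ℝ) else 0) *
          ψ (count p.2 x) (count p.2 y + 1)),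
    integral_prod_mul (μ := obsLaw π) (ν := Measure.pi fun _ : Fin n => obsLaw π)
      (fun a : ℕ => if a = y then (1 : ℝ) else 0)
      (fun X => ψ (count X x) (count X y + 1))]
  congr 1
  have : (fun a : ℕ => if a = y then (1 : ℝ) else 0) = Set.indicator {y} 1 := by
    funext a; simp [Set.indicator]
  rw [this, integral_indicator_one (measurableSet_singleton y), obsLaw_real_singleton]

/-- The Palm formula for the counts of an i.i.d. sample. -/
lemma integral_count_mul (π : Prior) (n : ℕ) {x y : ℕ} (hxy : x ≠ y) (ψ : ℕ → ℕ → ℝ) :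
    ∫ X, (count X y : ℝ) * ψ (count X x) (count X y) ∂(dataLaw π (n + 1))
      = (n + 1) * mixture π y * ∫ X, ψ (count X x) (count X y + 1) ∂(dataLaw π n) := by
  have h1 : ∀ X : Fin (n + 1) → ℕ, (count X y : ℝ) * ψ (count X x) (count X y)
      = ∑ i, (if X i = y then 1 else 0) * ψ (count X x) (count X y) := by
    intro X
    rw [← Finset.sum_mul]
    congr 1
    rw [count_eq_sum]; push_cast; rfl
  simp_rw [h1]
  rw [integral_finsetSum]
  · simp_rw [integral_ite_mul_count₂ π n hxy]
    simp; ring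
  · intro i _
    refine Integrable.mono' ((integrable_count₂ π (n + 1) x y ψ).abs)
      (Measurable.of_discrete).aestronglyMeasurable (Filter.Eventually.of_forall fun X => ?_)
    split_ifs <;> simp

/-- The other count does not enter, so any point distinct from x can play its role; x + 1 is taken.
-/
lemma integral_count_mul' (π : Prior) (n : ℕ) (x : ℕ) (φ : ℕ → ℝ) :
    ∫ X, (count X x : ℝ) * φ (count X x) ∂(dataLaw π (n + 1))
      = (n + 1) * mixture π x * ∫ X, φ (count X x + 1) ∂(dataLaw π n) :=
  integral_count_mul π n (x := x + 1) (y := x) (by omega) fun _ b => φ b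

lemma integrable_count (π : Prior) (n x : ℕ) (φ : ℕ → ℝ) :
    Integrable (fun X : Fin n → ℕ => φ (count X x)) (dataLaw π n) :=
  integrable_count₂ π n x x fun a _ => φ a

lemma integral_const_dataLaw (π : Prior) (n : ℕ) (c : ℝ) : ∫ _, c ∂(dataLaw π n) = c := by simp

/-- The expectation of `1 / (N(x) + 1)`. -/
def invMoment (π : Prior) (n x : ℕ) : ℝ := ∫ X, 1 / ((count X x : ℝ) + 1) ∂(dataLaw π n)

/-- By the Palm formula with φ(a) = 1 / a, the left side is the probability that N(x) > 0 in a
sample of size n + 1. -/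
lemma mul_invMoment_le (π : Prior) (n x : ℕ) :
    (n + 1) * mixture π x * invMoment π n x ≤ 1 := by
  have h := integral_count_mul' π n x fun a => 1 / (a : ℝ)
  push_cast at h
  rw [invMoment, ← h]
  refine le_trans ?_ (integral_const_dataLaw π (n + 1) 1).le
  refine integral_mono (integrable_count π (n + 1) x fun a => (a : ℝ) * (1 / (a : ℝ)))
    (integrable_const _) fun X => ?_
  simp only
  rw [mul_one_div]
  exact div_self_le_one _

lemma integral_count_one (π : Prior) (n x : ℕ) :
    ∫ X, (count X x : ℝ) ∂(dataLaw π n) = n * mixture π x := by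
  cases n with
  | zero => simp [count]
  | succ m =>
    have h := integral_count_mul' π m x fun _ => 1
    simpa using h

lemma integral_count_sq (π : Prior) (n x : ℕ) :
    ∫ X, (count X x : ℝ) ^ 2 ∂(dataLaw π n)
      = n * (n - 1) * mixture π x ^ 2 + n * mixture π x := by
  cases n with
  | zero => simp [count]
  | succ m =>
    have h := integral_count_mul' π m x fun a => (a : ℝ)
    push_cast at h
    rw [integral_add (integrable_count π m x fun a => (a : ℝ)) (integrable_const _),
      integral_count_one, integral_const_dataLaw] at h
    simp_rw [pow_two]
    rw [h]; push_cast; ring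

lemma integral_sub_sq_le (π : Prior) (n x : ℕ) :
    ∫ X, ((count X x : ℝ) - n * mixture π x) ^ 2 ∂(dataLaw π n) ≤ n * mixture π x := by
  have h : ∀ X : Fin n → ℕ, ((count X x : ℝ) - n * mixture π x) ^ 2
      = 1 * (count X x : ℝ) ^ 2 + (-2 * n * mixture π x) * (count X x : ℝ)
        + (n * mixture π x) ^ 2 * 1 + 0 * 1 := by intro X; ring
  simp_rw [h]
  rw [integral_add_four (integrable_count π n x fun a => (a : ℝ) ^ 2)
    (integrable_count π n x fun a => (a : ℝ)) (integrable_const 1) (integrable_const 1),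
    integral_count_sq, integral_count_one, integral_const_dataLaw]
  have := mixture_nonneg π x
  nlinarith [mul_nonneg (Nat.cast_nonneg (α := ℝ) n) (sq_nonneg (mixture π x))]

/-- The second moment bound behind Robbins' estimator. -/
lemma integral_robbins_le {k : ℕ} (hk : 1 ≤ k) (π : Prior) {n : ℕ} (hn : 2 ≤ n) (x : ℕ) :
    ∫ X, (((x + 1).ascFactorial k : ℝ) * (count X (x + k) : ℝ) - bayes k π x * (count X x : ℝ)) ^ 2
        / ((count X x : ℝ) + 1) ∂(dataLaw π n)
      ≤ ((x + 1).ascFactorial k : ℝ) * bayes k π x + 2 * bayes k π x ^ 2 := by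
  obtain ⟨m, rfl⟩ := Nat.exists_eq_add_of_le' hn
  set c : ℝ := ((x + 1).ascFactorial k : ℝ) with hc
  set t : ℝ := bayes k π x with ht
  set a : ℝ := mixture π x with ha
  set b : ℝ := mixture π (x + k) with hb
  have htab : t * a = c * b := bayes_mul_mixture k π x
  have hc0 : 0 < c := ascFactorial_pos' x k
  have ht0 : 0 ≤ t := bayes_nonneg k π x
  have ha0 : 0 ≤ a := mixture_nonneg π x
  have hb0 : 0 ≤ b := mixture_nonneg π _
  have hne : x ≠ x + k := by omega
  have I : ∀ (n : ℕ) (ψ : ℕ → ℕ → ℝ),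
      Integrable (fun X : Fin n → ℕ => ψ (count X x) (count X (x + k))) (dataLaw π n) :=
    fun n ψ => integrable_count₂ π n x (x + k) ψ
  have e1 : ∀ j, ∫ X, (count X (x + k) : ℝ) * (1 / ((count X x : ℝ) + 1)) ∂(dataLaw π (j + 1))
      = (j + 1) * b * invMoment π j x := fun j =>
    integral_count_mul π j hne fun p _ => 1 / ((p : ℝ) + 1)
  have e2 : ∫ X, (count X (x + k) : ℝ) * ((count X x : ℝ) / ((count X x : ℝ) + 1))
      ∂(dataLaw π (m + 1 + 1)) = (m + 2) * b * (1 - invMoment π (m + 1) x) := by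
    have h := integral_count_mul π (m + 1) hne fun p _ => (p : ℝ) / ((p : ℝ) + 1)
    rw [h]
    have : ∀ X : Fin (m + 1) → ℕ, (count X x : ℝ) / ((count X x : ℝ) + 1)
        = 1 - 1 / ((count X x : ℝ) + 1) := by
      intro X
      have : (count X x : ℝ) + 1 ≠ 0 := by positivity
      field_simp; ring
    simp_rw [this]
    rw [integral_sub (integrable_const _) (I (m + 1) fun p _ => 1 / ((p : ℝ) + 1)),
      integral_const_dataLaw]
    push_cast
    rw [invMoment]; ring
  have e3 : ∫ X, (count X (x + k) : ℝ) * (((count X (x + k) : ℝ) - 1) * (1 / ((count X x : ℝ) + 1)))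
      ∂(dataLaw π (m + 1 + 1)) = (m + 2) * b * ((m + 1) * b * invMoment π m x) := by
    have h := integral_count_mul π (m + 1) hne fun p q => ((q : ℝ) - 1) * (1 / ((p : ℝ) + 1))
    rw [h, ← e1 m]
    push_cast
    congr 1
    · ring
    · congr 1; funext X; ring
  have e4 : ∫ X, (count X x : ℝ) ^ 2 / ((count X x : ℝ) + 1) ∂(dataLaw π (m + 1 + 1))
      ≤ (m + 2) * a := by
    have h := integral_count_one π (m + 1 + 1) x
    push_cast at h
    have h2 : (m + 2 : ℝ) * a = (m + 1 + 1) * mixture π x := by rw [ha]; ring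
    rw [h2, ← h]
    refine integral_mono (I _ fun p _ => (p : ℝ) ^ 2 / ((p : ℝ) + 1)) (I _ fun p _ => (p : ℝ))
      fun X => ?_
    simp only
    have h0 : (0 : ℝ) ≤ count X x := Nat.cast_nonneg _
    rw [div_le_iff₀ (by positivity)]
    nlinarith
  -- The square is expanded with N(x + k)² = N(x + k)(N(x + k) - 1) + N(x + k), so that the Palm
  -- formula applies: twice to the first term, once to the next two.
  have key : ∀ X : Fin (m + 1 + 1) → ℕ, (c * (count X (x + k) : ℝ) - t * (count X x : ℝ)) ^ 2
        / ((count X x : ℝ) + 1)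
      = c ^ 2 * ((count X (x + k) : ℝ) * (((count X (x + k) : ℝ) - 1)
          * (1 / ((count X x : ℝ) + 1))))
        + c ^ 2 * ((count X (x + k) : ℝ) * (1 / ((count X x : ℝ) + 1)))
        + (-2 * c * t) * ((count X (x + k) : ℝ) * ((count X x : ℝ) / ((count X x : ℝ) + 1)))
        + t ^ 2 * ((count X x : ℝ) ^ 2 / ((count X x : ℝ) + 1)) := by
    intro X
    have : (count X x : ℝ) + 1 ≠ 0 := by positivity
    field_simp; ring
  rw [show m + 2 = m + 1 + 1 from rfl]
  simp_rw [key]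
  rw [integral_add_four
    (I _ fun p q => (q : ℝ) * (((q : ℝ) - 1) * (1 / ((p : ℝ) + 1))))
    (I _ fun p q => (q : ℝ) * (1 / ((p : ℝ) + 1)))
    (I _ fun p q => (q : ℝ) * ((p : ℝ) / ((p : ℝ) + 1)))
    (I _ fun p _ => (p : ℝ) ^ 2 / ((p : ℝ) + 1)), e1, e2, e3]
  have f1 := mul_invMoment_le π m x
  have f2 := mul_invMoment_le π (m + 1) x
  rw [← ha] at f1 f2
  push_cast at f2 ⊢
  set r := invMoment π m x
  set s := invMoment π (m + 1) x
  -- With c b = t a, the bounds `g1`, `g3`, `g4` contribute 1, -2, 1 times (m + 2) t² a, of order n,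
  -- which cancel. What is left is c t from `g2` and 2 t² from `g3`.
  have g1 : c ^ 2 * ((m + 2) * b * ((m + 1) * b * r)) ≤ (m + 2) * t ^ 2 * a := by
    have : c ^ 2 * ((m + 2) * b * ((m + 1) * b * r))
        = ((m + 2) * t ^ 2 * a) * ((m + 1) * a * r) := by
      have : c ^ 2 * ((m + 2) * b * ((m + 1) * b * r)) = (c * b) ^ 2 * ((m + 2) * (m + 1) * r) := by
        ring
      rw [this, ← htab]; ring
    rw [this]
    exact mul_le_of_le_one_right (by positivity) f1
  have g2 : c ^ 2 * ((m + 1 + 1) * b * s) ≤ c * t := by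
    have : c ^ 2 * ((m + 1 + 1) * b * s) = c * t * ((m + 1 + 1) * a * s) := by
      have : c ^ 2 * ((m + 1 + 1) * b * s) = c * (c * b) * ((m + 1 + 1) * s) := by ring
      rw [this, ← htab]; ring
    rw [this]
    exact mul_le_of_le_one_right (by positivity) f2
  have g3 : -2 * c * t * ((m + 2) * b * (1 - s)) ≤ -2 * ((m + 2) * t ^ 2 * a) + 2 * t ^ 2 := by
    have : -2 * c * t * ((m + 2) * b * (1 - s))
        = -2 * ((m + 2) * t ^ 2 * a) + 2 * t ^ 2 * ((m + 1 + 1) * a * s) := by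
      have : -2 * c * t * ((m + 2) * b * (1 - s)) = -2 * (c * b) * t * ((m + 2) * (1 - s)) := by
        ring
      rw [this, ← htab]; ring
    rw [this]
    have := mul_le_of_le_one_right (show (0 : ℝ) ≤ 2 * t ^ 2 by positivity) f2
    linarith
  have g4 := mul_le_mul_of_nonneg_left e4 (sq_nonneg t)
  nlinarith

/-- Two uses of the Palm formula. With q the probability of N(x) = 0 in a sample of size n - 1, the
left side is (x + 1)_k n f(x + k) q = `bayes k π x` · n f(x) q, and n f(x) q is the probability of
N(x) = 1 in a sample of size n. -/
lemma integral_count_zero_le {k : ℕ} (hk : 1 ≤ k) (π : Prior) {n : ℕ} (hn : 1 ≤ n) (x : ℕ) :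
    ∫ X, ((x + 1).ascFactorial k : ℝ) * ((count X (x + k) : ℝ) * if count X x = 0 then 1 else 0)
        ∂(dataLaw π n) ≤ bayes k π x := by
  obtain ⟨m, rfl⟩ := Nat.exists_eq_add_of_le' hn
  have h1 := integral_count_mul π m (x := x) (y := x + k) (by omega)
    fun p _ => if p = 0 then 1 else 0
  have h2 := integral_count_mul' π m x fun p => if p = 1 then 1 else 0
  have h3 : ∫ X, (count X x : ℝ) * (if count X x = 1 then 1 else 0) ∂(dataLaw π (m + 1)) ≤ 1 := by
    refine le_trans ?_ (integral_const_dataLaw π (m + 1) 1).le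
    refine integral_mono (integrable_count π (m + 1) x fun p => (p : ℝ) * if p = 1 then 1 else 0)
      (integrable_const _) fun X => ?_
    simp only
    split_ifs with h <;> simp [h]
  rw [integral_const_mul, h1]
  rw [h2] at h3
  simp only [Nat.add_eq_right] at h3
  set q := ∫ X, (if count X x = 0 then (1 : ℝ) else 0) ∂(dataLaw π m)
  have h4 := bayes_mul_mixture k π x
  have h5 := bayes_nonneg k π x
  calc _ = (((x + 1).ascFactorial k : ℝ) * mixture π (x + k)) * ((m + 1) * q) := by ring
    _ = bayes k π x * ((m + 1) * mixture π x * q) := by rw [← h4]; ring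
    _ ≤ _ := mul_le_of_le_one_right h5 h3

/-! ### Tails and the exceptional event -/

lemma hasSum_pw_mul_pow (θ : ℝ≥0) (z : ℝ) :
    HasSum (fun x => pw θ x * z ^ x) (Real.exp (θ * (z - 1))) := by
  have h := (NormedSpace.expSeries_div_hasSum_exp ((θ : ℝ) * z)).mul_left (Real.exp (-(θ : ℝ)))
  rw [← Real.exp_eq_exp_ℝ, ← Real.exp_add] at h
  have e : (fun x => pw θ x * z ^ x)
      = fun x => Real.exp (-(θ : ℝ)) * (((θ : ℝ) * z) ^ x / x.factorial) := by
    funext x; unfold pw; rw [mul_pow]; ring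
  rw [e, show (θ : ℝ) * (z - 1) = -θ + θ * z by ring]
  exact h

/-- Chernoff's bound from the generating function e^{θ(z - 1)}. The parameter z stays free: log n
and e are used for the upper bounds, √(log n) and a large constant for the lower bounds. -/
lemma tsum_tail_pw_le {θ : ℝ≥0} {h z : ℝ} (hθ : (θ : ℝ) ≤ h) (hz : 1 ≤ z) (K : ℕ) :
    ∑' x, (if K < x then 1 else 0) * ENNReal.ofReal (pw θ x)
      ≤ ENNReal.ofReal (Real.exp (h * (z - 1)) / z ^ K) := by
  have hs := (hasSum_pw_mul_pow θ z).div_const (z ^ K)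
  have hz0 : 0 < z := by linarith
  calc _ ≤ ∑' x, ENNReal.ofReal (pw θ x * z ^ x / z ^ K) := by
        refine ENNReal.tsum_le_tsum fun x => ?_
        split_ifs with hx
        · rw [one_mul]
          refine ENNReal.ofReal_le_ofReal ?_
          rw [le_div_iff₀ (by positivity)]
          exact mul_le_mul_of_nonneg_left (pow_le_pow_right₀ hz hx.le) (pw_nonneg θ x)
        · simp
    _ = ENNReal.ofReal (Real.exp (θ * (z - 1)) / z ^ K) := by
        rw [← ENNReal.ofReal_tsum_of_nonneg (fun x => ?_) hs.summable, hs.tsum_eq]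
        have := pw_nonneg θ x
        positivity
    _ ≤ _ := by
        refine ENNReal.ofReal_le_ofReal ?_
        have : (θ : ℝ) * (z - 1) ≤ h * (z - 1) := mul_le_mul_of_nonneg_right hθ (by linarith)
        gcongr

/-- The event that the parameter exceeds `h` or the observation exceeds `K`. -/
def badSet (h : ℝ) (K : ℕ) : Set (ℝ≥0 × ℕ) := {z | h < (z.1 : ℝ) ∨ K < z.2}

lemma measurableSet_badSet (h : ℝ) (K : ℕ) : MeasurableSet (badSet h K) := by
  have : badSet h K = {z : ℝ≥0 × ℕ | (z.1 : ℝ) ≤ h}ᶜ ∪ Prod.snd ⁻¹' (Set.Ioi K) := by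
    ext z; simp [badSet]
  rw [this]
  exact (measurableSet_fst_le h).compl.union (measurable_snd MeasurableSet.of_discrete)

lemma jointLaw_badSet_le (π : Prior) (h : ℝ) {z : ℝ} (hz : 1 ≤ z) (K : ℕ) :
    jointLaw π (badSet h K) ≤ (π : Measure ℝ≥0) {θ | (θ : ℝ) ≤ h}ᶜ
      + ENNReal.ofReal (Real.exp (h * (z - 1)) / z ^ K) := by
  rw [← lintegral_indicator_one (measurableSet_badSet h K),
    lintegral_jointLaw π (measurable_one.indicator (measurableSet_badSet h K)),
    ← lintegral_indicator_one (measurableSet_le_param h).compl]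
  have hm : Measurable (Set.indicator {θ : ℝ≥0 | (θ : ℝ) ≤ h}ᶜ (1 : ℝ≥0 → ℝ≥0∞)) :=
    measurable_one.indicator (measurableSet_le_param h).compl
  calc _ ≤ ∫⁻ θ, (Set.indicator {θ : ℝ≥0 | (θ : ℝ) ≤ h}ᶜ (1 : ℝ≥0 → ℝ≥0∞) θ
        + ENNReal.ofReal (Real.exp (h * (z - 1)) / z ^ K)) ∂(π : Measure ℝ≥0) := by
        refine lintegral_mono fun θ => ?_
        by_cases hθ : (θ : ℝ) ≤ h
        · refine le_add_left (le_trans (le_of_eq ?_) (tsum_tail_pw_le hθ hz K))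
          refine tsum_congr fun x => ?_
          simp [Set.indicator, badSet, not_lt.2 hθ]
        · refine le_add_right ?_
          have : ∑' x, Set.indicator (badSet h K) (1 : ℝ≥0 × ℕ → ℝ≥0∞) (θ, x)
              * ENNReal.ofReal (pw θ x) = 1 := by
            have : ∀ x, Set.indicator (badSet h K) (1 : ℝ≥0 × ℕ → ℝ≥0∞) (θ, x)
              * ENNReal.ofReal (pw θ x) = ENNReal.ofReal (pw θ x) := by
              intro x; simp [Set.indicator, badSet, not_le.1 hθ]
            simp_rw [this]
            rw [← ENNReal.ofReal_tsum_of_nonneg (pw_nonneg θ) (hasSum_pw θ).summable,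
              (hasSum_pw θ).tsum_eq, ENNReal.ofReal_one]
          rw [this]; simp [Set.indicator, hθ]
    _ = _ := by rw [lintegral_add_left hm]; simp

lemma tsum_tail_mixture_le {h : ℝ} {π : Prior} (hπ : π ∈ boundedPriors h) {z : ℝ} (hz : 1 ≤ z)
    (K : ℕ) : ∑' x, (if K < x then 1 else 0) * ENNReal.ofReal (mixture π x)
      ≤ ENNReal.ofReal (Real.exp (h * (z - 1)) / z ^ K) := by
  simp_rw [ofReal_mixture]
  have : ∀ x, (if K < x then 1 else 0) * ∫⁻ θ, ENNReal.ofReal (pw θ x) ∂(π : Measure ℝ≥0)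
      = ∫⁻ θ, (if K < x then 1 else 0) * ENNReal.ofReal (pw θ x) ∂(π : Measure ℝ≥0) := by
    intro x
    rw [lintegral_const_mul _ (by fun_prop)]
  simp_rw [this]
  rw [← lintegral_tsum fun x => by fun_prop]
  calc _ ≤ ∫⁻ θ, ENNReal.ofReal (Real.exp (h * (z - 1)) / z ^ K) ∂(π : Measure ℝ≥0) := by
        refine lintegral_mono_ae ?_
        filter_upwards [ae_le_of_mem_boundedPriors hπ] with θ hθ
        exact tsum_tail_pw_le hθ hz K
    _ = _ := by simp

/-- The size of one pair `(θ, X)`, in terms of which the crude bounds are stated. -/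
def pairSize (k : ℕ) (z : ℝ≥0 × ℕ) : ℝ := ((z.2 : ℝ) + k) ^ (2 * k) + (z.1 : ℝ) ^ (2 * k)

lemma pairSize_nonneg (k : ℕ) (z : ℝ≥0 × ℕ) : 0 ≤ pairSize k z := by unfold pairSize; positivity

@[fun_prop] lemma measurable_pairSize (k : ℕ) : Measurable (pairSize k) := by
  unfold pairSize
  have : Measurable (fun z : ℝ≥0 × ℕ => (z.2 : ℝ)) :=
    (Measurable.of_discrete (f := fun x : ℕ => (x : ℝ))).comp measurable_snd
  fun_prop

/-- A crude polynomial bound on an estimator. -/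
def IsTame (k : ℕ) (B : ℝ) {n : ℕ} (T : Estimator n) : Prop :=
  ∀ X j, (T X j) ^ 2 ≤ B * (n : ℝ) ^ 2 * ∑ i, ((X i : ℝ) + k) ^ (2 * k)

lemma sum_sqErr_le {k n : ℕ} {B : ℝ} (hB : 1 ≤ B) (hn : n ≠ 0) {T : Estimator n}
    (hT : IsTame k B T) (z : Fin n → ℝ≥0 × ℕ) :
    ∑ j, ENNReal.ofReal ((T (fun i => (z i).2) j - ((z j).1 : ℝ) ^ k) ^ 2)
      ≤ ENNReal.ofReal (2 * B * (n : ℝ) ^ 3 * ∑ i, pairSize k (z i)) := by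
  rw [← ENNReal.ofReal_sum_of_nonneg fun j _ => sq_nonneg _]
  refine ENNReal.ofReal_le_ofReal ?_
  have hn1 : (1 : ℝ) ≤ n := by exact_mod_cast Nat.one_le_iff_ne_zero.2 hn
  have hsum : ∑ i, pairSize k (z i)
      = ∑ i, (((z i).2 : ℝ) + k) ^ (2 * k) + ∑ i, ((z i).1 : ℝ) ^ (2 * k) := by
    rw [← Finset.sum_add_distrib]; rfl
  set Q := ∑ i, (((z i).2 : ℝ) + k) ^ (2 * k) with hQ
  have hQ0 : 0 ≤ Q := Finset.sum_nonneg fun i _ => by positivity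
  have hR0 : 0 ≤ ∑ i, ((z i).1 : ℝ) ^ (2 * k) := Finset.sum_nonneg fun i _ => by positivity
  calc ∑ j, (T (fun i => (z i).2) j - ((z j).1 : ℝ) ^ k) ^ 2
      ≤ ∑ j : Fin n, (2 * (B * (n : ℝ) ^ 2 * Q) + 2 * ((z j).1 : ℝ) ^ (2 * k)) := by
        refine Finset.sum_le_sum fun j _ => ?_
        have h1 := hT (fun i => (z i).2) j
        have h2 : ((z j).1 : ℝ) ^ (2 * k) = (((z j).1 : ℝ) ^ k) ^ 2 := by rw [← pow_mul]; ring_nf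
        rw [h2]
        nlinarith [sq_nonneg (T (fun i => (z i).2) j + ((z j).1 : ℝ) ^ k)]
    _ = 2 * B * (n : ℝ) ^ 3 * Q + 2 * ∑ i, ((z i).1 : ℝ) ^ (2 * k) := by
        rw [Finset.sum_add_distrib, Finset.sum_const, ← Finset.mul_sum]
        simp only [Finset.card_univ, Fintype.card_fin, nsmul_eq_mul]; ring
    _ ≤ _ := by
        rw [hsum, mul_add]
        have : (1 : ℝ) ≤ B * (n : ℝ) ^ 3 := one_le_mul_of_one_le_of_one_le hB (one_le_pow₀ hn1)
        nlinarith

/-- A union bound over the index m of a bad pair, and over the pair i that carries the loss. The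
product of the indicator and the loss is split by an arithmetic-geometric mean inequality, so
independence of the pairs plays no role. -/
theorem setLIntegral_compl_goodEvent_le {k n : ℕ} {B : ℝ} (hB : 1 ≤ B) (hn : n ≠ 0)
    {T : Estimator n} (hT : IsTame k B T) (π : Prior) (h : ℝ) (K : ℕ) :
    ∫⁻ z in (goodEvent n h K)ᶜ, ∑ j,
        ENNReal.ofReal ((T (fun i => (z i).2) j - ((z j).1 : ℝ) ^ k) ^ 2) ∂(sampleLaw π n)
      ≤ ENNReal.ofReal (2 * B * (n : ℝ) ^ 10) * jointLaw π (badSet h K)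
        + ENNReal.ofReal (2 * B) * ∫⁻ z, ENNReal.ofReal (pairSize k z ^ 2) ∂(jointLaw π) := by
  have hn0 : (0 : ℝ) < n := by exact_mod_cast Nat.pos_of_ne_zero hn
  have hind : Measurable (Set.indicator (badSet h K) (1 : ℝ≥0 × ℕ → ℝ≥0∞)) :=
    measurable_one.indicator (measurableSet_badSet h K)
  have hps : Measurable (fun z : ℝ≥0 × ℕ => ENNReal.ofReal (pairSize k z ^ 2)) := by fun_prop
  rw [← lintegral_indicator (measurableSet_goodEvent n h K).compl]
  calc _ ≤ ∫⁻ z, ∑ m, ∑ i, (ENNReal.ofReal (2 * B * (n : ℝ) ^ 8) *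
          Set.indicator (badSet h K) (1 : ℝ≥0 × ℕ → ℝ≥0∞) (z m)
          + ENNReal.ofReal (2 * B / (n : ℝ) ^ 2) * ENNReal.ofReal (pairSize k (z i) ^ 2))
          ∂(sampleLaw π n) := by
        refine lintegral_mono fun z => ?_
        by_cases hz : z ∈ goodEvent n h K
        · simp [hz]
        rw [Set.indicator_of_mem (by exact hz)]
        have hz' : ∃ m, z m ∈ badSet h K := by
          by_contra! hc
          refine hz fun i => ?_
          have := hc i
          simp only [badSet, Set.mem_ofPred_eq, not_or, not_lt] at this
          exact this
        obtain ⟨m, hm⟩ := hz'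
        refine (sum_sqErr_le hB hn hT z).trans ?_
        refine le_trans ?_ (Finset.single_le_sum (f := fun m => ∑ i : Fin n,
          (ENNReal.ofReal (2 * B * (n : ℝ) ^ 8) *
          Set.indicator (badSet h K) (1 : ℝ≥0 × ℕ → ℝ≥0∞) (z m)
          + ENNReal.ofReal (2 * B / (n : ℝ) ^ 2) * ENNReal.ofReal (pairSize k (z i) ^ 2)))
          (fun _ _ => zero_le) (Finset.mem_univ m))
        simp only [Set.indicator_of_mem hm, Pi.one_apply, mul_one]
        rw [Finset.mul_sum, ENNReal.ofReal_sum_of_nonneg fun i _ => by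
          have := pairSize_nonneg k (z i); positivity]
        refine Finset.sum_le_sum fun i _ => ?_
        rw [← ENNReal.ofReal_mul (by positivity), ← ENNReal.ofReal_add (by positivity)
          (by positivity)]
        refine ENNReal.ofReal_le_ofReal ?_
        set v := pairSize k (z i)
        -- The weight n^5 is chosen so that, with the factor n³ and the n² index pairs, the second
        -- moment enters with a factor free of n and the bad probability with n^10.
        have h1 : v ≤ (n : ℝ) ^ 5 + v ^ 2 / (n : ℝ) ^ 5 := by
          rw [← sub_nonneg]
          have : (n : ℝ) ^ 5 + v ^ 2 / (n : ℝ) ^ 5 - v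
              = ((v - (n : ℝ) ^ 5 / 2) ^ 2 + 3 / 4 * ((n : ℝ) ^ 5) ^ 2) / (n : ℝ) ^ 5 := by
            field_simp; ring
          rw [this]; positivity
        calc 2 * B * (n : ℝ) ^ 3 * v ≤ 2 * B * (n : ℝ) ^ 3 * ((n : ℝ) ^ 5 + v ^ 2 / (n : ℝ) ^ 5) :=
              by gcongr
          _ = _ := by field_simp
    _ = _ := by
        have hi : ∀ m : Fin n, Measurable fun z : Fin n → ℝ≥0 × ℕ =>
            Set.indicator (badSet h K) (1 : ℝ≥0 × ℕ → ℝ≥0∞) (z m) :=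
          fun m => hind.comp (measurable_pi_apply m)
        have hp : ∀ i : Fin n, Measurable fun z : Fin n → ℝ≥0 × ℕ =>
            ENNReal.ofReal (pairSize k (z i) ^ 2) := fun i => hps.comp (measurable_pi_apply i)
        have hme : ∀ m i : Fin n, Measurable fun z : Fin n → ℝ≥0 × ℕ =>
            ENNReal.ofReal (2 * B * (n : ℝ) ^ 8) *
            Set.indicator (badSet h K) (1 : ℝ≥0 × ℕ → ℝ≥0∞) (z m)
            + ENNReal.ofReal (2 * B / (n : ℝ) ^ 2) * ENNReal.ofReal (pairSize k (z i) ^ 2) :=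
          fun m i => ((hi m).const_mul _).add ((hp i).const_mul _)
        rw [lintegral_finsetSum _ fun m _ => Finset.measurable_fun_sum _ fun i _ => hme m i]
        have : ∀ m i : Fin n, ∫⁻ z, (ENNReal.ofReal (2 * B * (n : ℝ) ^ 8) *
          Set.indicator (badSet h K) (1 : ℝ≥0 × ℕ → ℝ≥0∞) (z m)
          + ENNReal.ofReal (2 * B / (n : ℝ) ^ 2) * ENNReal.ofReal (pairSize k (z i) ^ 2))
          ∂(sampleLaw π n) = ENNReal.ofReal (2 * B * (n : ℝ) ^ 8) * jointLaw π (badSet h K)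
            + ENNReal.ofReal (2 * B / (n : ℝ) ^ 2)
              * ∫⁻ z, ENNReal.ofReal (pairSize k z ^ 2) ∂(jointLaw π) := by
          intro m i
          rw [lintegral_add_left ((hi m).const_mul _), lintegral_const_mul _ (hi m),
            lintegral_const_mul _ (hp i),
            lintegral_sampleLaw_eval π m hind, lintegral_sampleLaw_eval π i hps,
            lintegral_indicator_one (measurableSet_badSet h K)]
        have h2 : ∀ m : Fin n, ∫⁻ z, ∑ i, (ENNReal.ofReal (2 * B * (n : ℝ) ^ 8) *
          Set.indicator (badSet h K) (1 : ℝ≥0 × ℕ → ℝ≥0∞) (z m)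
          + ENNReal.ofReal (2 * B / (n : ℝ) ^ 2) * ENNReal.ofReal (pairSize k (z i) ^ 2))
          ∂(sampleLaw π n) = _ := fun m => lintegral_finsetSum _ fun i _ => hme m i
        simp_rw [h2, this]
        have e : ∀ r : ℝ, (n : ℝ≥0∞) * (n * ENNReal.ofReal r) = ENNReal.ofReal (n * (n * r)) := by
          intro r
          rw [ENNReal.ofReal_mul hn0.le, ENNReal.ofReal_mul hn0.le, ENNReal.ofReal_natCast]
        simp only [Finset.sum_const, Finset.card_univ, Fintype.card_fin, nsmul_eq_mul]
        rw [mul_add, mul_add, ← mul_assoc, ← mul_assoc, ← mul_assoc, ← mul_assoc,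
          mul_assoc (n : ℝ≥0∞), mul_assoc (n : ℝ≥0∞) _ (ENNReal.ofReal (2 * B / _)), e, e]
        congr 3
        · ring
        · field_simp

/-! ### Exponential moments -/

lemma pow_le_factorial_mul_exp {μ y : ℝ} (hμ : 0 < μ) (hy : 0 ≤ y) (p : ℕ) :
    y ^ p ≤ (p.factorial : ℝ) / μ ^ p * Real.exp (μ * y) := by
  have h := Real.pow_div_factorial_le_exp (μ * y) (by positivity) p
  rw [div_le_iff₀ (by positivity), mul_pow] at h
  rw [div_mul_eq_mul_div, le_div_iff₀ (by positivity)]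
  linarith

/-- Polynomials are absorbed by exponentials: (x + k)^(4k) is at most a constant times (1 + lam)^x,
whose Poisson mean is exactly e^{lam θ}. -/
lemma exists_tsum_pairSize_le (k : ℕ) {lam : ℝ} (hlam : 0 < lam) :
    ∃ C : ℝ, 0 ≤ C ∧ ∀ θ : ℝ≥0, ∑' x, ENNReal.ofReal (pairSize k (θ, x) ^ 2)
      * ENNReal.ofReal (pw θ x) ≤ ENNReal.ofReal (C * Real.exp (lam * θ)) := by
  set μ := Real.log (1 + lam) with hμ
  have hμ0 : 0 < μ := Real.log_pos (by linarith)
  set A := ((4 * k).factorial : ℝ) / μ ^ (4 * k) * (1 + lam) ^ k with hA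
  set D := ((4 * k).factorial : ℝ) / lam ^ (4 * k) with hD
  have hA0 : 0 ≤ A := by positivity
  have hD0 : 0 ≤ D := by positivity
  refine ⟨2 * A + 2 * D, by positivity, fun θ => ?_⟩
  have h1 : ∀ x : ℕ, ((x : ℝ) + k) ^ (4 * k) ≤ A * (1 + lam) ^ x := by
    intro x
    have := pow_le_factorial_mul_exp hμ0 (show (0 : ℝ) ≤ (x : ℝ) + k by positivity) (4 * k)
    have e : Real.exp (μ * ((x : ℝ) + k)) = (1 + lam) ^ x * (1 + lam) ^ k := by
      rw [mul_comm, Real.exp_mul, hμ]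
      rw [← pow_add, ← Nat.cast_add, ← Real.exp_mul, mul_comm, Real.exp_mul,
        Real.exp_log (by linarith), Real.rpow_natCast]
    rw [e] at this
    calc _ ≤ _ := this
      _ = _ := by rw [hA]; ring
  have h2 : (θ : ℝ) ^ (4 * k) ≤ D * Real.exp (lam * θ) :=
    pow_le_factorial_mul_exp hlam θ.2 (4 * k)
  have h3 : ∀ x, pairSize k (θ, x) ^ 2 * pw θ x
      ≤ 2 * A * (pw θ x * (1 + lam) ^ x) + 2 * (D * Real.exp (lam * θ)) * pw θ x := by
    intro x
    have e1 : (((x : ℝ) + k) ^ (2 * k)) ^ 2 = ((x : ℝ) + k) ^ (4 * k) := by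
      rw [← pow_mul]; ring_nf
    have e2 : ((θ : ℝ) ^ (2 * k)) ^ 2 = (θ : ℝ) ^ (4 * k) := by rw [← pow_mul]; ring_nf
    have : pairSize k (θ, x) ^ 2 ≤ 2 * (A * (1 + lam) ^ x) + 2 * (D * Real.exp (lam * θ)) := by
      unfold pairSize
      have := h1 x
      simp only
      nlinarith [sq_nonneg (((x : ℝ) + k) ^ (2 * k) - (θ : ℝ) ^ (2 * k))]
    have := mul_le_mul_of_nonneg_right this (pw_nonneg θ x)
    linarith
  have hs := ((hasSum_pw_mul_pow θ (1 + lam)).mul_left (2 * A)).add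
    ((hasSum_pw θ).mul_left (2 * (D * Real.exp (lam * θ))))
  calc _ ≤ ∑' x, ENNReal.ofReal (2 * A * (pw θ x * (1 + lam) ^ x)
          + 2 * (D * Real.exp (lam * θ)) * pw θ x) := by
        refine ENNReal.tsum_le_tsum fun x => ?_
        rw [← ENNReal.ofReal_mul (sq_nonneg _)]
        exact ENNReal.ofReal_le_ofReal (h3 x)
    _ = ENNReal.ofReal _ := by
        rw [← ENNReal.ofReal_tsum_of_nonneg (fun x => ?_) hs.summable, hs.tsum_eq]
        have := pw_nonneg θ x
        positivity
    _ = _ := by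
        congr 1
        have : (θ : ℝ) * (1 + lam - 1) = lam * θ := by ring
        rw [this]; ring

lemma lintegral_pairSize_le {k : ℕ} {lam C : ℝ} (hC0 : 0 ≤ C)
    (hC : ∀ θ : ℝ≥0, ∑' x, ENNReal.ofReal (pairSize k (θ, x) ^ 2)
      * ENNReal.ofReal (pw θ x) ≤ ENNReal.ofReal (C * Real.exp (lam * θ))) (π : Prior) :
    ∫⁻ z, ENNReal.ofReal (pairSize k z ^ 2) ∂(jointLaw π)
      ≤ ENNReal.ofReal C * ∫⁻ θ, ENNReal.ofReal (Real.exp (lam * θ)) ∂(π : Measure ℝ≥0) := by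
  rw [lintegral_jointLaw π (by fun_prop), ← lintegral_const_mul _ (by fun_prop)]
  refine lintegral_mono fun θ => (hC θ).trans ?_
  rw [ENNReal.ofReal_mul hC0]

/-- The half-line is sliced at the multiples of s; the m-th slice costs at most e^{(m+1)/2} ·
2e^{-m}, a geometric series that does not involve s. -/
lemma exists_lintegral_exp_le : ∃ C : ℝ, 0 ≤ C ∧ ∀ s : ℝ, 0 < s → ∀ π ∈ subexpPriors s,
    ∫⁻ θ, ENNReal.ofReal (Real.exp (1 / (2 * s) * (θ : ℝ≥0))) ∂(π : Measure ℝ≥0)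
      ≤ ENNReal.ofReal C := by
  have hsum : Summable fun m : ℕ => 2 * Real.exp (1 / 2) * Real.exp (-1 / 2) ^ m :=
    (summable_geometric_of_lt_one (Real.exp_pos _).le
      (by rw [Real.exp_lt_one_iff]; norm_num)).mul_left _
  refine ⟨∑' m : ℕ, 2 * Real.exp (1 / 2) * Real.exp (-1 / 2) ^ m, tsum_nonneg fun m => by positivity,
    fun s hs π hπ => ?_⟩
  have hm : ∀ t : ℝ, MeasurableSet {θ : ℝ≥0 | t ≤ (θ : ℝ)} := fun t =>
    measurableSet_le measurable_const (by fun_prop)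
  calc _ ≤ ∫⁻ θ, ∑' m : ℕ, ENNReal.ofReal (Real.exp ((m + 1) / 2)) *
        Set.indicator {θ : ℝ≥0 | m * s ≤ (θ : ℝ)} 1 θ ∂(π : Measure ℝ≥0) := by
        refine lintegral_mono fun θ => ?_
        refine le_trans ?_ (ENNReal.le_tsum ⌊(θ : ℝ) / s⌋₊)
        have h1 : (⌊(θ : ℝ) / s⌋₊ : ℝ) * s ≤ θ := by
          rw [← le_div_iff₀ hs]; exact Nat.floor_le (by positivity)
        have h2 := (Nat.lt_floor_add_one ((θ : ℝ) / s)).le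
        rw [Set.indicator_of_mem (by exact h1), Pi.one_apply, mul_one]
        refine ENNReal.ofReal_le_ofReal (Real.exp_le_exp.2 ?_)
        have : 1 / (2 * s) * (θ : ℝ) = (θ : ℝ) / s / 2 := by field_simp
        rw [this]; linarith
    _ = ∑' m : ℕ, ENNReal.ofReal (Real.exp ((m + 1) / 2)) *
        (π : Measure ℝ≥0) {θ : ℝ≥0 | m * s ≤ (θ : ℝ)} := by
        rw [lintegral_tsum fun m =>
          ((measurable_one.indicator (hm _)).const_mul _).aemeasurable]
        refine tsum_congr fun m => ?_
        rw [lintegral_const_mul _ (measurable_one.indicator (hm _)), lintegral_indicator_one (hm _)]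
    _ ≤ ∑' m : ℕ, ENNReal.ofReal (2 * Real.exp (1 / 2) * Real.exp (-1 / 2) ^ m) := by
        refine ENNReal.tsum_le_tsum fun m => ?_
        have hb : (π : Measure ℝ≥0) {θ : ℝ≥0 | m * s ≤ (θ : ℝ)}
            ≤ ENNReal.ofReal (2 * Real.exp (-(m : ℝ))) := by
          -- The tail condition only speaks of t > 0; at m = 0 the trivial bound 1 ≤ 2 serves.
          rcases Nat.eq_zero_or_pos m with rfl | hm0
          · refine prob_le_one.trans ?_
            simp
          · have hm1 : (0 : ℝ) < m := by exact_mod_cast hm0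
            have := hπ (m * s) (by positivity)
            have e : -((m : ℝ) * s) / s = -m := by field_simp
            rwa [e] at this
        calc _ ≤ ENNReal.ofReal (Real.exp ((m + 1) / 2)) *
              ENNReal.ofReal (2 * Real.exp (-(m : ℝ))) := by gcongr
          _ = _ := by
            rw [← ENNReal.ofReal_mul (Real.exp_pos _).le]
            congr 1
            rw [← Real.exp_nat_mul]
            have : ((m : ℝ) + 1) / 2 = 1 / 2 + m * (-1 / 2) + m := by ring
            rw [this, Real.exp_add, Real.exp_add]
            have e2 : Real.exp (m : ℝ) * Real.exp (-(m : ℝ)) = 1 := by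
              rw [← Real.exp_add]; simp
            linear_combination (2 * Real.exp (1 / 2) * Real.exp (m * (-1 / 2))) * e2
    _ = _ := (ENNReal.ofReal_tsum_of_nonneg (fun m => by positivity) hsum).symm

/-! ### The modified Robbins estimator -/

lemma sum_eq_sum_count {n K : ℕ} {X : Fin n → ℕ} (hX : ∀ i, X i ≤ K) (F : ℕ → ℝ) :
    ∑ j, F (X j) = ∑ x ∈ Finset.range (K + 1), (count X x : ℝ) * F x := by
  rw [← Finset.sum_fiberwise_of_maps_to (s := Finset.univ) (t := Finset.range (K + 1)) (g := X)
    (fun i _ => by have := hX i; simp; omega)]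
  refine Finset.sum_congr rfl fun x _ => ?_
  rw [Finset.sum_congr rfl (g := fun _ => F x) fun i hi => by
    rw [(Finset.mem_filter.1 hi).2]]
  simp [count]

lemma excess_le_of_forall_le {k n : ℕ} {T : Estimator n} {π : Prior} {A : Set (Fin n → ℕ)}
    {G : (Fin n → ℕ) → ℝ} (hG0 : ∀ X, 0 ≤ G X) (hGi : Integrable G (dataLaw π n))
    (hG : ∀ X ∈ A, ∑ j, (T X j - bayes k π (X j)) ^ 2 ≤ G X) {b : ℝ}
    (hb : ∫ X, G X ∂(dataLaw π n) ≤ b) : excess k T π A ≤ ENNReal.ofReal b := by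
  calc excess k T π A ≤ ∫⁻ X in A, ENNReal.ofReal (G X) ∂(dataLaw π n) := by
        refine setLIntegral_mono' MeasurableSet.of_discrete fun X hX => ?_
        rw [← ENNReal.ofReal_sum_of_nonneg fun j _ => sq_nonneg _]
        exact ENNReal.ofReal_le_ofReal (hG X hX)
    _ ≤ ∫⁻ X, ENNReal.ofReal (G X) ∂(dataLaw π n) := setLIntegral_le_lintegral _ _
    _ = ENNReal.ofReal (∫ X, G X ∂(dataLaw π n)) :=
        (ofReal_integral_eq_lintegral_ofReal hGi (Filter.Eventually.of_forall hG0)).symm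
    _ ≤ _ := ENNReal.ofReal_le_ofReal hb

/-- The normalized squared deviation in Robbins' estimator at `x`. -/
def robbinsErr (k : ℕ) (π : Prior) {n : ℕ} (x : ℕ) (X : Fin n → ℕ) : ℝ :=
  (((x + 1).ascFactorial k : ℝ) * (count X (x + k) : ℝ) - bayes k π x * (count X x : ℝ)) ^ 2
    / ((count X x : ℝ) + 1)

lemma robbinsErr_nonneg (k : ℕ) (π : Prior) {n : ℕ} (x : ℕ) (X : Fin n → ℕ) :
    0 ≤ robbinsErr k π x X := by unfold robbinsErr; positivity

lemma integrable_robbinsErr (k : ℕ) (π : Prior) (n x : ℕ) :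
    Integrable (fun X : Fin n → ℕ => robbinsErr k π x X) (dataLaw π n) :=
  integrable_count₂ π n x (x + k) fun p q =>
    (((x + 1).ascFactorial k : ℝ) * (q : ℝ) - bayes k π x * (p : ℝ)) ^ 2 / ((p : ℝ) + 1)

/-- The size of the bounds on the regret, for estimators that are bounded by `M` and observations
that are bounded by `K`. -/
def regretSize (k K : ℕ) (M : ℝ) : ℝ := ((K : ℝ) + 1) * (((K : ℝ) + k) ^ k * M + M ^ 2)

lemma ascFactorial_le_of_le {k x K : ℕ} (hx : x ≤ K) :
    ((x + 1).ascFactorial k : ℝ) ≤ ((K : ℝ) + k) ^ k := by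
  have h1 := Nat.ascFactorial_le_pow_add x k
  have h2 : (x + k) ^ k ≤ (K + k) ^ k := Nat.pow_le_pow_left (by omega) k
  exact_mod_cast h1.trans h2

lemma integral_robbinsErr_le {k : ℕ} (hk : 1 ≤ k) {h : ℝ} {π : Prior} (hπ : π ∈ boundedPriors h)
    {n : ℕ} (hn : 2 ≤ n) {M : ℝ} (hM : h ^ k ≤ M) {x K : ℕ} (hx : x ≤ K) :
    ∫ X : Fin n → ℕ, robbinsErr k π x X ∂(dataLaw π n) ≤ ((K : ℝ) + k) ^ k * M + 2 * M ^ 2 := by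
  refine (integral_robbins_le hk π hn x).trans ?_
  have h1 : bayes k π x ≤ M := (bayes_le hπ x).trans hM
  have h0 := bayes_nonneg k π x
  have h2 := ascFactorial_le_of_le (k := k) hx
  gcongr

lemma mul_sq_sub_le (c t N N' : ℝ) (hN : 1 ≤ N) :
    N * (c * N' / N - t) ^ 2 ≤ 2 * ((c * N' - t * N) ^ 2 / (N + 1)) := by
  have hN0 : 0 < N := by linarith
  have : N * (c * N' / N - t) ^ 2 = (c * N' - t * N) ^ 2 / N := by field_simp
  rw [this, ← mul_div_assoc, div_le_div_iff₀ hN0 (by linarith)]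
  nlinarith [sq_nonneg (c * N' - t * N)]

/-- Grouped by value, the loss at x is N(x) times the squared error of the ratio. Where N(x) ≥ 1 the
denominator N(x) may be replaced by N(x) + 1 at the price of a factor 2, and where N(x) = 0 there is
no loss. -/
theorem excess_robbins_le {k : ℕ} (hk : 1 ≤ k) {h : ℝ} {π : Prior} (hπ : π ∈ boundedPriors h)
    {n : ℕ} (hn : 2 ≤ n) {M : ℝ} (hM : h ^ k ≤ M) (K : ℕ) :
    excess k (robbins k n) π {X | ∀ i, X i ≤ K} ≤ ENNReal.ofReal (20 * regretSize k K M) := by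
  have hM0 : 0 ≤ M := (pow_nonneg (nonneg_of_mem_boundedPriors hπ) k).trans hM
  refine excess_le_of_forall_le (G := fun X => ∑ x ∈ Finset.range (K + 1), 2 * robbinsErr k π x X)
    (fun X => Finset.sum_nonneg fun x _ => mul_nonneg zero_le_two (robbinsErr_nonneg k π x X))
    (integrable_finsetSum _ fun x _ => (integrable_robbinsErr k π n x).const_mul _) ?_ ?_
  · intro X hX
    have := sum_eq_sum_count hX fun x => (((x + 1).ascFactorial k : ℝ) * (count X (x + k) : ℝ)
      / (count X x : ℝ) - bayes k π x) ^ 2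
    unfold robbins
    rw [this]
    refine Finset.sum_le_sum fun x _ => ?_
    rcases Nat.eq_zero_or_pos (count X x) with h0 | h0
    · rw [h0]; simp only [Nat.cast_zero, zero_mul]
      exact mul_nonneg zero_le_two (robbinsErr_nonneg k π x X)
    · exact mul_sq_sub_le _ _ _ _ (by exact_mod_cast h0)
  · rw [integral_finsetSum _ fun x _ => (integrable_robbinsErr k π n x).const_mul _]
    calc _ ≤ ∑ x ∈ Finset.range (K + 1), 2 * (((K : ℝ) + k) ^ k * M + 2 * M ^ 2) := by
          refine Finset.sum_le_sum fun x hx => ?_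
          rw [integral_const_mul]
          have := integral_robbinsErr_le hk hπ hn hM
            (show x ≤ K by have := Finset.mem_range.1 hx; omega)
          linarith
      _ ≤ _ := by
          rw [Finset.sum_const, Finset.card_range, nsmul_eq_mul, regretSize]
          push_cast
          have : 2 * (((K : ℝ) + k) ^ k * M + 2 * M ^ 2) ≤ 20 * (((K : ℝ) + k) ^ k * M + M ^ 2) := by
            have : 0 ≤ ((K : ℝ) + k) ^ k * M := by positivity
            nlinarith [sq_nonneg M]
          have h2 : (0 : ℝ) ≤ (K : ℝ) + 1 := by positivity
          nlinarith

lemma pow_two_mul_le_sum {k n : ℕ} (X : Fin n → ℕ) (j : Fin n) :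
    ((X j : ℝ) + k) ^ (2 * k) ≤ ∑ i, ((X i : ℝ) + k) ^ (2 * k) :=
  Finset.single_le_sum (f := fun i => ((X i : ℝ) + k) ^ (2 * k)) (fun i _ => by positivity)
    (Finset.mem_univ j)

/-- The denominator counts X_j itself, so it is at least 1. -/
lemma isTame_robbins (k n : ℕ) : IsTame k 1 (robbins k n) := by
  intro X j
  have h1 : (1 : ℝ) ≤ count X (X j) := by
    have : 0 < count X (X j) := Finset.card_pos.2 ⟨j, by simp⟩
    exact_mod_cast this
  have h2 : (count X (X j + k) : ℝ) ≤ n := by exact_mod_cast count_le X _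
  have h3 := ascFactorial_le_of_le (k := k) (le_refl (X j))
  have h4 : robbins k n X j ≤ ((X j : ℝ) + k) ^ k * n := by
    unfold robbins
    calc _ ≤ ((X j + 1).ascFactorial k : ℝ) * (count X (X j + k) : ℝ) :=
          div_le_self (by positivity) h1
      _ ≤ _ := by gcongr
  have h5 : 0 ≤ robbins k n X j := by unfold robbins; positivity
  calc (robbins k n X j) ^ 2 ≤ (((X j : ℝ) + k) ^ k * n) ^ 2 := by gcongr
    _ = 1 * (n : ℝ) ^ 2 * ((X j : ℝ) + k) ^ (2 * k) := by rw [mul_pow, ← pow_mul]; ring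
    _ ≤ _ := by gcongr; exact pow_two_mul_le_sum X j

/-! ### Empirical risk minimization -/

/-- Reindexing y = x + k turns the falling factorial of y into (x + 1)_k. Values y < k, where y - k
is truncated, drop out because their falling factorial is zero. -/
lemma sum_descFactorial_mul {k n K : ℕ} {X : Fin n → ℕ} (hX : ∀ i, X i ≤ K) (g : ℕ → ℝ) :
    ∑ i, ((X i).descFactorial k : ℝ) * g (X i - k)
      = ∑ x ∈ Finset.range (K + 1),
        ((x + 1).ascFactorial k : ℝ) * (count X (x + k) : ℝ) * g x := by
  rw [sum_eq_sum_count (K := K + k) (fun i => (hX i).trans (by omega))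
    (fun y => (y.descFactorial k : ℝ) * g (y - k)),
    show K + k + 1 = k + (K + 1) by ring, Finset.sum_range_add]
  have h0 : ∑ x ∈ Finset.range k, (count X x : ℝ) * ((x.descFactorial k : ℝ) * g (x - k)) = 0 := by
    refine Finset.sum_eq_zero fun x hx => ?_
    rw [Nat.descFactorial_of_lt (Finset.mem_range.1 hx)]; simp
  rw [h0, zero_add]
  refine Finset.sum_congr rfl fun x _ => ?_
  rw [Nat.add_comm k x, Nat.add_descFactorial_eq_ascFactorial, Nat.add_sub_cancel]
  ring

/-- The basic inequality for a minimizer of the empirical objective. -/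
lemma sum_sq_le_of_objective_le {k n K : ℕ} (hn : n ≠ 0) {π : Prior} {M : ℝ}
    {X : Fin n → ℕ} (hX : ∀ i, X i ≤ K) {t : ℕ → ℝ} (ht : Monotone t) (htM : ∀ i, t (X i) ≤ M)
    (hobj : empiricalObjective k X t ≤ empiricalObjective k X (bayes k π)) :
    ∑ j, (t (X j) - bayes k π (X j)) ^ 2 ≤ ∑ x ∈ Finset.range (K + 1),
      (8 * robbinsErr k π x X + 4 * M * (((x + 1).ascFactorial k : ℝ) *
        ((count X (x + k) : ℝ) * if count X x = 0 then 1 else 0))) := by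
  set r := bayes k π with hr
  set g : ℕ → ℝ := fun x => t x - r x with hg
  have hn0 : (0 : ℝ) < 1 / n := by
    have : (0 : ℝ) < n := by exact_mod_cast Nat.pos_of_ne_zero hn
    positivity
  unfold empiricalObjective at hobj
  have h1 := le_of_mul_le_mul_left hobj hn0
  -- The comparison of objectives with t = r + g, expanded. Grouped by x, the right side becomes 2
  -- ∑ₓ ((x + 1)_k N(x + k) - r(x) N(x)) g(x), in which the Robbins deviation appears.
  have h2 : ∑ j, g (X j) ^ 2 ≤ 2 * ∑ i, ((X i).descFactorial k : ℝ) * g (X i - k)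
      - 2 * ∑ i, r (X i) * g (X i) := by
    have : ∑ j, g (X j) ^ 2 - (2 * ∑ i, ((X i).descFactorial k : ℝ) * g (X i - k)
      - 2 * ∑ i, r (X i) * g (X i))
      = ∑ i, (t (X i) ^ 2 - 2 * ((X i).descFactorial k : ℝ) * t (X i - k))
        - ∑ i, (r (X i) ^ 2 - 2 * ((X i).descFactorial k : ℝ) * r (X i - k)) := by
      rw [Finset.mul_sum, Finset.mul_sum, ← Finset.sum_sub_distrib, ← Finset.sum_sub_distrib,
        ← Finset.sum_sub_distrib]
      refine Finset.sum_congr rfl fun i _ => ?_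
      simp only [hg]; ring
    linarith
  rw [sum_descFactorial_mul hX, sum_eq_sum_count hX fun x => r x * g x] at h2
  have h3 := sum_eq_sum_count hX fun x => g x ^ 2
  have h4 : 2 * ∑ x ∈ Finset.range (K + 1),
        ((x + 1).ascFactorial k : ℝ) * (count X (x + k) : ℝ) * g x
      - 2 * ∑ x ∈ Finset.range (K + 1), (count X x : ℝ) * (r x * g x)
      ≤ ∑ x ∈ Finset.range (K + 1), (1 / 2 * ((count X x : ℝ) * g x ^ 2)
        + (4 * robbinsErr k π x X + 2 * M * (((x + 1).ascFactorial k : ℝ) *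
          ((count X (x + k) : ℝ) * if count X x = 0 then 1 else 0)))) := by
    rw [Finset.mul_sum, Finset.mul_sum, ← Finset.sum_sub_distrib]
    refine Finset.sum_le_sum fun x _ => ?_
    unfold robbinsErr
    rw [← hr]
    set c : ℝ := ((x + 1).ascFactorial k : ℝ)
    have hc : 0 < c := ascFactorial_pos' x k
    rcases Nat.eq_zero_or_pos (count X x) with h0 | h0
    · rw [h0]
      simp only [Nat.cast_zero, if_true]
      -- No observation equals x, so the bound on t at the data does not apply at x directly;
      -- monotonicity transfers it from x + k, if that value is observed.
      have hq : c * (count X (x + k) : ℝ) * g x ≤ c * (count X (x + k) : ℝ) * M := by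
        rcases Nat.eq_zero_or_pos (count X (x + k)) with h5 | h5
        · rw [h5]; simp
        · obtain ⟨i, hi⟩ := Finset.card_pos.1 h5
          have hi' : X i = x + k := (Finset.mem_filter.1 hi).2
          have h6 : t x ≤ M := (ht (by omega)).trans (htM i)
          have h7 : 0 ≤ r x := bayes_nonneg k π x
          have : g x ≤ M := by simp only [hg]; linarith
          gcongr
      have h8 : 0 ≤ (c * (count X (x + k) : ℝ) - r x * 0) ^ 2 / ((0 : ℝ) + 1) := by positivity
      nlinarith
    · have hN : (1 : ℝ) ≤ count X x := by exact_mod_cast h0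
      rw [if_neg h0.ne']
      set N : ℝ := (count X x : ℝ)
      set W : ℝ := c * (count X (x + k) : ℝ) - r x * N with hW
      have e : 2 * (c * (count X (x + k) : ℝ) * g x) - 2 * (N * (r x * g x)) = 2 * W * g x := by
        rw [hW]; ring
      rw [e]
      -- Young's inequality with weight 1/2 on N g², so that half of the left side of `h2` can be
      -- absorbed.
      have h9 : 2 * W * g x ≤ 1 / 2 * (N * g x ^ 2) + 2 * (W ^ 2 / N) := by
        have : 1 / 2 * (N * g x ^ 2) + 2 * (W ^ 2 / N) - 2 * W * g x
            = (N * g x - 2 * W) ^ 2 / (2 * N) := by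
          field_simp; ring
        have h10 : 0 ≤ (N * g x - 2 * W) ^ 2 / (2 * N) := by positivity
        linarith
      have h11 : 2 * (W ^ 2 / N) ≤ 4 * (W ^ 2 / (N + 1)) := by
        rw [← mul_div_assoc, ← mul_div_assoc, div_le_div_iff₀ (by linarith) (by linarith)]
        nlinarith [sq_nonneg W]
      simp only [mul_zero, add_zero]
      linarith
  rw [Finset.sum_add_distrib, ← Finset.mul_sum, ← h3] at h4
  have h5 : ∑ x ∈ Finset.range (K + 1),
      (8 * robbinsErr k π x X + 4 * M * (((x + 1).ascFactorial k : ℝ) *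
        ((count X (x + k) : ℝ) * if count X x = 0 then 1 else 0)))
      = 2 * ∑ x ∈ Finset.range (K + 1),
        (4 * robbinsErr k π x X + 2 * M * (((x + 1).ascFactorial k : ℝ) *
          ((count X (x + k) : ℝ) * if count X x = 0 then 1 else 0))) := by
    rw [Finset.mul_sum]
    refine Finset.sum_congr rfl fun x _ => ?_
    ring
  rw [h5]
  change ∑ j, g (X j) ^ 2 ≤ _
  linarith

/-- Only three facts about the minimizer are used: it is monotone, bounded by M at the data, and has
no larger objective than the Bayes rule. This covers the clipped and the unclipped class at once. -/
theorem excess_erm_le {k : ℕ} (hk : 1 ≤ k) {h : ℝ} {π : Prior} (hπ : π ∈ boundedPriors h)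
    {n : ℕ} (hn : 2 ≤ n) {M : ℝ} (hM : h ^ k ≤ M) (K : ℕ) {T : Estimator n}
    (hT : ∀ X : Fin n → ℕ, (∀ i, X i ≤ K) → ∃ t : ℕ → ℝ, Monotone t ∧ (∀ i, t (X i) ≤ M) ∧
      empiricalObjective k X t ≤ empiricalObjective k X (bayes k π) ∧ T X = fun i => t (X i)) :
    excess k T π {X | ∀ i, X i ≤ K} ≤ ENNReal.ofReal (20 * regretSize k K M) := by
  have hM0 : 0 ≤ M := (pow_nonneg (nonneg_of_mem_boundedPriors hπ) k).trans hM
  have hint : ∀ x, Integrable (fun X : Fin n → ℕ => ((x + 1).ascFactorial k : ℝ) *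
      ((count X (x + k) : ℝ) * if count X x = 0 then 1 else 0)) (dataLaw π n) := fun x =>
    integrable_count₂ π n x (x + k) fun p q =>
      ((x + 1).ascFactorial k : ℝ) * ((q : ℝ) * if p = 0 then 1 else 0)
  have hi1 := fun x => (integrable_robbinsErr k π n x).const_mul 8
  have hi2 := fun x => (hint x).const_mul (4 * M)
  refine excess_le_of_forall_le (G := fun X => ∑ x ∈ Finset.range (K + 1),
      (8 * robbinsErr k π x X + 4 * M * (((x + 1).ascFactorial k : ℝ) *
        ((count X (x + k) : ℝ) * if count X x = 0 then 1 else 0)))) (fun X => ?_)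
    (integrable_finsetSum _ fun x _ => (hi1 x).add (hi2 x)) (fun X hX => ?_) ?_
  · refine Finset.sum_nonneg fun x _ => add_nonneg
      (mul_nonneg (by norm_num) (robbinsErr_nonneg k π x X)) ?_
    split_ifs <;> positivity
  · obtain ⟨t, ht, htM, hobj, hTX⟩ := hT X hX
    rw [hTX]
    exact sum_sq_le_of_objective_le (by omega) hX ht htM hobj
  · have hi3 : ∀ x, Integrable (fun X : Fin n → ℕ => 8 * robbinsErr k π x X
        + 4 * M * (((x + 1).ascFactorial k : ℝ) *
          ((count X (x + k) : ℝ) * if count X x = 0 then 1 else 0))) (dataLaw π n) :=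
      fun x => (hi1 x).add (hi2 x)
    rw [integral_finsetSum _ fun x _ => hi3 x]
    calc _ ≤ ∑ x ∈ Finset.range (K + 1), (8 * (((K : ℝ) + k) ^ k * M + 2 * M ^ 2) + 4 * M * M) := by
          refine Finset.sum_le_sum fun x hx => ?_
          rw [integral_add (hi1 x) (hi2 x), integral_const_mul, integral_const_mul]
          have h1 := integral_robbinsErr_le hk hπ hn hM
            (show x ≤ K by have := Finset.mem_range.1 hx; omega)
          have h2 := ((integral_count_zero_le hk π (by omega : 1 ≤ n) x).trans
            (bayes_le hπ x)).trans hM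
          gcongr
      _ ≤ _ := by
          rw [Finset.sum_const, Finset.card_range, nsmul_eq_mul, regretSize]
          push_cast
          have : 8 * (((K : ℝ) + k) ^ k * M + 2 * M ^ 2) + 4 * M * M
              ≤ 20 * (((K : ℝ) + k) ^ k * M + M ^ 2) := by
            have : 0 ≤ ((K : ℝ) + k) ^ k * M := by positivity
            nlinarith [sq_nonneg M]
          have h2 : (0 : ℝ) ≤ (K : ℝ) + 1 := by positivity
          nlinarith

/-- Truncating a monotone function above the largest response decreases the objective. -/
lemma objective_min_le {k n : ℕ} {X : Fin n → ℕ} {M : ℝ}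
    (hXM : ∀ i, ((X i).descFactorial k : ℝ) ≤ M) {t : ℕ → ℝ} (ht : Monotone t) :
    empiricalObjective k X (fun x => min (t x) M)
      + 1 / n * ∑ i, (t (X i) - min (t (X i)) M) ^ 2 ≤ empiricalObjective k X t := by
  unfold empiricalObjective
  rw [← mul_add, ← Finset.sum_add_distrib]
  refine mul_le_mul_of_nonneg_left (Finset.sum_le_sum fun i _ => ?_) (by positivity)
  have h0 : (0 : ℝ) ≤ ((X i).descFactorial k : ℝ) := by positivity
  have h1 := hXM i
  have h2 : t (X i - k) ≤ t (X i) := ht (by omega)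
  -- The part of t above M is itself nondecreasing. Hence truncation loses no more in the linear
  -- term, at X_i - k, than it does at X_i, where the quadratic term pays for it.
  have key : t (X i - k) - min (t (X i - k)) M ≤ t (X i) - min (t (X i)) M := by
    rcases le_total (t (X i)) M with h | h
    · rw [min_eq_left h, min_eq_left (h2.trans h)]; simp
    · rw [min_eq_right h]
      rcases le_total (t (X i - k)) M with h' | h'
      · rw [min_eq_left h']; linarith
      · rw [min_eq_right h']; linarith
  have key2 : 0 ≤ t (X i - k) - min (t (X i - k)) M := by linarith [min_le_left (t (X i - k)) M]
  have key3 : (t (X i) - min (t (X i)) M) * (min (t (X i)) M - M) = 0 := by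
    rcases le_total (t (X i)) M with h | h
    · rw [min_eq_left h]; simp
    · rw [min_eq_right h]; simp
  set u := t (X i) - min (t (X i)) M with hu
  set v := t (X i - k) - min (t (X i - k)) M with hv
  set D : ℝ := ((X i).descFactorial k : ℝ)
  have h3 : D * v ≤ M * u := mul_le_mul h1 key key2 (h0.trans h1)
  have e1 : t (X i) = u + min (t (X i)) M := by rw [hu]; ring
  have e2 : t (X i - k) = v + min (t (X i - k)) M := by rw [hv]; ring
  nlinarith [e1, e2]

lemma min_mem_clippedMonotoneClass {t : ℕ → ℝ} (ht : t ∈ monotoneClass) {M : ℝ} (hM : 0 ≤ M) :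
    (fun x => min (t x) M) ∈ clippedMonotoneClass M :=
  ⟨fun _ _ hab => min_le_min_right M (ht.1 hab), fun x => ⟨le_min (ht.2 x) hM, min_le_right _ _⟩⟩

lemma clippedMonotoneClass_subset (M : ℝ) : clippedMonotoneClass M ⊆ monotoneClass :=
  fun _ ht => ⟨ht.1, fun x => (ht.2 x).1⟩

/-- Truncation at M stays in the class and gains the mean square of the part of t above M at the
data, so for a minimizer that part vanishes. -/
lemma le_of_isMinOn_monotoneClass {k n : ℕ} {X : Fin n → ℕ} {M : ℝ}
    (hXM : ∀ i, ((X i).descFactorial k : ℝ) ≤ M) (hM : 0 ≤ M) {t : ℕ → ℝ}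
    (ht : t ∈ monotoneClass) (hmin : IsMinOn (empiricalObjective k X) monotoneClass t)
    (i : Fin n) : t (X i) ≤ M := by
  have hn : 0 < n := i.pos
  have h1 := objective_min_le hXM ht.1
  have h2 := isMinOn_iff.1 hmin _
    (clippedMonotoneClass_subset M (min_mem_clippedMonotoneClass ht hM))
  have h3 : 1 / (n : ℝ) * ∑ i, (t (X i) - min (t (X i)) M) ^ 2 ≤ 0 := by linarith
  have hn0 : (0 : ℝ) < 1 / n := by positivity
  have h4 : ∑ i, (t (X i) - min (t (X i)) M) ^ 2 ≤ 0 := by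
    by_contra! hc
    have := mul_pos hn0 hc
    linarith
  have h5 := Finset.single_le_sum (f := fun i => (t (X i) - min (t (X i)) M) ^ 2)
    (fun i _ => sq_nonneg _) (Finset.mem_univ i)
  have h6 : t (X i) - min (t (X i)) M = 0 := by
    have := h5.trans h4
    exact pow_eq_zero_iff two_ne_zero |>.1 (le_antisymm this (sq_nonneg _))
  have := min_le_right (t (X i)) M
  linarith

/-- The class is compact in the product topology by Tychonoff, and the objective is continuous since
it involves finitely many coordinates. -/
lemma exists_isMinOn_clippedMonotoneClass (k : ℕ) {n : ℕ} (X : Fin n → ℕ) {M : ℝ} (hM : 0 ≤ M) :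
    ∃ t ∈ clippedMonotoneClass M,
      IsMinOn (empiricalObjective k X) (clippedMonotoneClass M) t := by
  have hc : IsCompact (clippedMonotoneClass M) := by
    have : clippedMonotoneClass M
        = {t : ℕ → ℝ | Monotone t} ∩ Set.univ.pi fun _ : ℕ => Set.Icc 0 M := by
      ext t; simp only [clippedMonotoneClass, Set.mem_inter_iff, Set.mem_pi, Set.mem_univ,
        forall_true_left, Set.mem_ofPred_eq]
    rw [this]
    refine (isCompact_univ_pi fun _ => isCompact_Icc).inter_left ?_
    have : {t : ℕ → ℝ | Monotone t} = ⋂ a, ⋂ b, ⋂ (_ : a ≤ b), {t : ℕ → ℝ | t a ≤ t b} := by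
      ext t; simp [Monotone]
    rw [this]
    exact isClosed_iInter fun a => isClosed_iInter fun b => isClosed_iInter fun _ =>
      isClosed_le (continuous_apply a) (continuous_apply b)
  refine hc.exists_isMinOn ⟨fun _ => 0, fun _ _ _ => le_rfl, fun _ => ⟨le_rfl, hM⟩⟩ ?_
  unfold empiricalObjective
  fun_prop

/-- Truncating above every response does not raise the objective, which reduces the problem to the
compact clipped class. -/
lemma exists_isMinOn_monotoneClass (k : ℕ) {n : ℕ} (X : Fin n → ℕ) :
    ∃ t ∈ monotoneClass, IsMinOn (empiricalObjective k X) monotoneClass t := by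
  set M : ℝ := ∑ i, ((X i).descFactorial k : ℝ)
  have hM : 0 ≤ M := Finset.sum_nonneg fun i _ => by positivity
  have hXM : ∀ i, ((X i).descFactorial k : ℝ) ≤ M := fun i =>
    Finset.single_le_sum (f := fun i => ((X i).descFactorial k : ℝ)) (fun i _ => by positivity)
      (Finset.mem_univ i)
  obtain ⟨t, ht, hmin⟩ := exists_isMinOn_clippedMonotoneClass k X hM
  refine ⟨t, clippedMonotoneClass_subset M ht, isMinOn_iff.2 fun r hr => ?_⟩
  have h1 := isMinOn_iff.1 hmin _ (min_mem_clippedMonotoneClass hr hM)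
  have h2 := objective_min_le hXM hr.1
  have h3 : 0 ≤ 1 / (n : ℝ) * ∑ i, (r (X i) - min (r (X i)) M) ^ 2 :=
    mul_nonneg (by positivity) (Finset.sum_nonneg fun i _ => sq_nonneg _)
  linarith

lemma exists_isERM {k n : ℕ} {F : Set (ℕ → ℝ)}
    (h : ∀ X : Fin n → ℕ, ∃ t ∈ F, IsMinOn (empiricalObjective k X) F t) :
    ∃ T : Estimator n, IsERM k F T := by
  choose t ht hmin using h
  exact ⟨fun X i => t X (X i), fun X => ⟨t X, ht X, hmin X, rfl⟩⟩

lemma descFactorial_le_pow_cast {k x K : ℕ} (hx : x ≤ K) :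
    (x.descFactorial k : ℝ) ≤ (K : ℝ) ^ k := by
  exact_mod_cast (Nat.descFactorial_le_pow x k).trans (Nat.pow_le_pow_left hx k)

lemma exists_forall_le {n : ℕ} (hn : n ≠ 0) (X : Fin n → ℕ) : ∃ i₀, ∀ i, X i ≤ X i₀ := by
  have : Nonempty (Fin n) := ⟨⟨0, Nat.pos_of_ne_zero hn⟩⟩
  exact Finite.exists_max X

lemma isTame_of_le_pow {k n : ℕ} (hn : n ≠ 0) {B : ℝ} (hB : 1 ≤ B) {T : Estimator n}
    (hT : ∀ X j, 0 ≤ T X j ∧ ∃ i, T X j ≤ (X i : ℝ) ^ k) : IsTame k B T := by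
  intro X j
  obtain ⟨h0, i, hi⟩ := hT X j
  have hn1 : (1 : ℝ) ≤ n := by exact_mod_cast Nat.one_le_iff_ne_zero.2 hn
  have hB2 : 1 ≤ B * (n : ℝ) ^ 2 := one_le_mul_of_one_le_of_one_le hB (one_le_pow₀ hn1)
  calc (T X j) ^ 2 ≤ ((X i : ℝ) ^ k) ^ 2 := by gcongr
    _ = (X i : ℝ) ^ (2 * k) := by rw [← pow_mul]; ring_nf
    _ ≤ ((X i : ℝ) + k) ^ (2 * k) := by gcongr; linarith [Nat.cast_nonneg (α := ℝ) k]
    _ ≤ ∑ i, ((X i : ℝ) + k) ^ (2 * k) := pow_two_mul_le_sum X i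
    _ ≤ _ := le_mul_of_one_le_left (Finset.sum_nonneg fun i _ => by positivity) hB2

lemma isTame_of_le {k n : ℕ} (hk : 1 ≤ k) (hn : n ≠ 0) {B M : ℝ} (hB : 1 ≤ B) (hMB : M ^ 2 ≤ B)
    {T : Estimator n} (hT : ∀ X j, 0 ≤ T X j ∧ T X j ≤ M) : IsTame k B T := by
  intro X j
  obtain ⟨h0, h1⟩ := hT X j
  have hn1 : (1 : ℝ) ≤ n := by exact_mod_cast Nat.one_le_iff_ne_zero.2 hn
  have h2 : (1 : ℝ) ≤ ∑ i, ((X i : ℝ) + k) ^ (2 * k) := by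
    refine le_trans (one_le_pow₀ ?_) (pow_two_mul_le_sum X j)
    have : (1 : ℝ) ≤ k := by exact_mod_cast hk
    linarith [Nat.cast_nonneg (α := ℝ) (X j)]
  calc (T X j) ^ 2 ≤ M ^ 2 := by gcongr
    _ ≤ B := hMB
    _ ≤ B * (n : ℝ) ^ 2 := le_mul_of_one_le_right (by linarith) (one_le_pow₀ hn1)
    _ ≤ _ := le_mul_of_one_le_right (by positivity) h2

/-! ### Plug-in estimators -/

lemma isMassFunction_empirical {n : ℕ} (hn : n ≠ 0) {K : ℕ} {X : Fin n → ℕ}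
    (hX : ∀ i, X i ≤ K) : IsMassFunction (empirical X) := by
  refine ⟨fun x => by unfold empirical; positivity, ?_⟩
  have h0 : ∀ x ∉ Finset.range (K + 1), empirical X x = 0 := by
    intro x hx
    have : count X x = 0 := by
      rw [count, Finset.card_eq_zero, Finset.filter_eq_empty_iff]
      intro i _ hi
      have := hX i
      exact hx (Finset.mem_range.2 (by omega))
    simp [empirical, this]
  have h1 : ∑ x ∈ Finset.range (K + 1), empirical X x = 1 := by
    have := sum_eq_sum_count hX fun _ => 1
    simp only [mul_one, Finset.sum_const, Finset.card_univ, Fintype.card_fin, nsmul_eq_mul] at this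
    have hn0 : (n : ℝ) ≠ 0 := by exact_mod_cast hn
    unfold empirical
    rw [← Finset.sum_div, ← this, div_self hn0]
  rw [← h1]
  exact hasSum_sum_of_ne_finset_zero h0

lemma empirical_eq_zero {n K : ℕ} {X : Fin n → ℕ} (hX : ∀ i, X i ≤ K) {x : ℕ} (hx : K < x) :
    empirical X x = 0 := by
  have : count X x = 0 := by
    rw [count, Finset.card_eq_zero, Finset.filter_eq_empty_iff]
    intro i _ hi
    have := hX i
    omega
  simp [empirical, this]

lemma empirical_support_finite {n : ℕ} (X : Fin n → ℕ) : (empirical X).support.Finite := by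
  refine (Set.finite_range X).subset fun x hx => ?_
  have : count X x ≠ 0 := by
    intro h; exact hx (by simp [empirical, h])
  obtain ⟨i, hi⟩ := Finset.card_pos.1 (Nat.pos_of_ne_zero this)
  exact ⟨i, (Finset.mem_filter.1 hi).2⟩

lemma exists_eq_of_empirical_ne_zero {n : ℕ} {X : Fin n → ℕ} {x : ℕ} (hx : empirical X x ≠ 0) :
    ∃ i, X i = x := by
  have : count X x ≠ 0 := by
    intro h; exact hx (by simp [empirical, h])
  obtain ⟨i, hi⟩ := Finset.card_pos.1 (Nat.pos_of_ne_zero this)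
  exact ⟨i, (Finset.mem_filter.1 hi).2⟩

lemma empirical_pos {n : ℕ} (X : Fin n → ℕ) (i : Fin n) : 0 < empirical X (X i) := by
  have h1 : 0 < count X (X i) := Finset.card_pos.2 ⟨i, by simp⟩
  have : 0 < n := i.pos
  unfold empirical; positivity

lemma sum_empirical_mul {n : ℕ} {K : ℕ} {X : Fin n → ℕ} (hX : ∀ i, X i ≤ K)
    (F : ℕ → ℝ) :
    ∑ x ∈ Finset.range (K + 1), empirical X x * F x = 1 / n * ∑ i, F (X i) := by
  rw [sum_eq_sum_count hX, Finset.mul_sum]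
  refine Finset.sum_congr rfl fun x _ => ?_
  unfold empirical; ring

/-! ### Differences of Bayes ratios against Hellinger increments -/

section Pointwise

variable {b b' B B' c s t M : ℝ}

/-- Half of `mul_sq_sub_le_hellinger`, when the denominator is the larger one. -/
lemma mul_sq_sub_le_of_le (hb : 0 ≤ b) (hb' : 0 ≤ b') (hB : 0 ≤ B) (hB' : 0 ≤ B') (hc : 0 ≤ c)
    (hs0 : 0 ≤ s) (hsM : s ≤ M) (htM : t ≤ M) (hs : s * b = c * b') (ht : t * B = c * B')
    (hbB : b ≤ B) :
    B * (s - t) ^ 2 ≤ 8 * (c * M * (√b' - √B') ^ 2 + M ^ 2 * (√b - √B) ^ 2) := by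
  have hM : 0 ≤ M := hs0.trans hsM
  rcases hB.eq_or_lt with h0 | h0
  · rw [← h0]; have : 0 ≤ c * M * (√b' - √B') ^ 2 + M ^ 2 * (√b - √0) ^ 2 := by positivity
    linarith
  -- The ratios s = c b' / b and t = c B' / B are compared without division, so vanishing
  -- denominators are allowed.
  have e1 : B * (s - t) = c * (b' - B') + s * (B - b) := by linear_combination hs - ht
  have sq : ∀ {u v : ℝ}, 0 ≤ u → 0 ≤ v → (u - v) ^ 2 ≤ (√u - √v) ^ 2 * (2 * (u + v)) := by
    intro u v hu hv
    have h1 := Real.sq_sqrt hu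
    have h2 := Real.sq_sqrt hv
    have : (u - v) ^ 2 = (√u - √v) ^ 2 * (√u + √v) ^ 2 := by
      have : u - v = (√u - √v) * (√u + √v) := by nlinarith
      rw [this]; ring
    rw [this]
    have : (√u + √v) ^ 2 ≤ 2 * (u + v) := by nlinarith [sq_nonneg (√u - √v)]
    gcongr
  have h1 := sq hb' hB'
  have h2 := sq hb hB
  set P := (√b' - √B') ^ 2 with hP
  set Q := (√b - √B) ^ 2 with hQ
  have hP0 : 0 ≤ P := sq_nonneg _
  have hQ0 : 0 ≤ Q := sq_nonneg _
  have h3 : c ^ 2 * (b' - B') ^ 2 ≤ 4 * B * (c * M * P) := by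
    -- The left side is s b + t B; this is the one place where b ≤ B is essential.
    have h4 : c * (b' + B') ≤ 2 * M * B := by
      have : s * b ≤ M * B := mul_le_mul hsM hbB hb hM
      nlinarith
    calc c ^ 2 * (b' - B') ^ 2 ≤ c ^ 2 * (P * (2 * (b' + B'))) := by gcongr
      _ = 2 * c * P * (c * (b' + B')) := by ring
      _ ≤ 2 * c * P * (2 * M * B) := by gcongr
      _ = _ := by ring
  have h5 : s ^ 2 * (B - b) ^ 2 ≤ 4 * B * (M ^ 2 * Q) := by
    calc s ^ 2 * (B - b) ^ 2 ≤ M ^ 2 * (Q * (2 * (b + B))) := by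
          have : (B - b) ^ 2 = (b - B) ^ 2 := by ring
          rw [this]; gcongr
      _ ≤ M ^ 2 * (Q * (2 * (B + B))) := by gcongr
      _ = _ := by ring
  have h6 : B * (B * (s - t) ^ 2) ≤ B * (8 * (c * M * P + M ^ 2 * Q)) := by
    have : B * (B * (s - t) ^ 2) = (c * (b' - B') + s * (B - b)) ^ 2 := by rw [← e1]; ring
    rw [this]
    nlinarith [sq_nonneg (c * (b' - B') - s * (B - b))]
  exact le_of_mul_le_mul_left h6 h0

lemma mul_sq_sub_le_hellinger (hb : 0 ≤ b) (hb' : 0 ≤ b') (hB : 0 ≤ B) (hB' : 0 ≤ B')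
    (hc : 0 ≤ c) (hs0 : 0 ≤ s) (hsM : s ≤ M) (ht0 : 0 ≤ t) (htM : t ≤ M)
    (hs : s * b = c * b') (ht : t * B = c * B') :
    B * (s - t) ^ 2 ≤ 8 * (c * M * (√b' - √B') ^ 2 + M ^ 2 * (√b - √B) ^ 2) := by
  rcases le_total b B with h | h
  · exact mul_sq_sub_le_of_le hb hb' hB hB' hc hs0 hsM htM hs ht h
  · have := mul_sq_sub_le_of_le hB hB' hb hb' hc ht0 htM hsM ht hs h
    calc B * (s - t) ^ 2 ≤ b * (t - s) ^ 2 := by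
          rw [show (t - s) ^ 2 = (s - t) ^ 2 by ring]; gcongr
      _ ≤ _ := this
      _ = _ := by ring

/-- Passes from the weight B to the empirical weight p through p ≤ 2B + 2(√p - √B)², and inserts p
and p' into the Hellinger increments. The constant is 34 = 2 · 8 · 2 + 2. -/
lemma mul_sq_sub_le_three {p p' : ℝ} (hp : 0 ≤ p) (hb : 0 ≤ b) (hb' : 0 ≤ b') (hB : 0 ≤ B)
    (hB' : 0 ≤ B') (hc : 0 ≤ c) (hs0 : 0 ≤ s) (hsM : s ≤ M) (ht0 : 0 ≤ t) (htM : t ≤ M)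
    (hs : s * b = c * b') (ht : t * B = c * B') :
    p * (s - t) ^ 2 ≤ 34 * (c * M) * ((√p' - √b') ^ 2 + (√p' - √B') ^ 2)
      + 34 * M ^ 2 * ((√p - √b) ^ 2 + (√p - √B) ^ 2) := by
  have h1 := mul_sq_sub_le_hellinger hb hb' hB hB' hc hs0 hsM ht0 htM hs ht
  have hM : 0 ≤ M := hs0.trans hsM
  have h2 : p ≤ 2 * B + 2 * (√p - √B) ^ 2 := by
    nlinarith [Real.sq_sqrt hp, Real.sq_sqrt hB, sq_nonneg (√p - 2 * √B)]
  have h3 : (s - t) ^ 2 ≤ M ^ 2 := by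
    rw [sq_le_sq, abs_of_nonneg hM, abs_le]; constructor <;> linarith
  have h4 : p * (s - t) ^ 2 ≤ 2 * (B * (s - t) ^ 2) + 2 * (√p - √B) ^ 2 * M ^ 2 := by
    calc p * (s - t) ^ 2 ≤ (2 * B + 2 * (√p - √B) ^ 2) * (s - t) ^ 2 := by gcongr
      _ = 2 * (B * (s - t) ^ 2) + 2 * (√p - √B) ^ 2 * (s - t) ^ 2 := by ring
      _ ≤ _ := by gcongr
  have h5 : (√b' - √B') ^ 2 ≤ 2 * ((√p' - √b') ^ 2 + (√p' - √B') ^ 2) := by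
    nlinarith [sq_nonneg (√p' - √b' + (√p' - √B'))]
  have h6 : (√b - √B) ^ 2 ≤ 2 * ((√p - √b) ^ 2 + (√p - √B) ^ 2) := by
    nlinarith [sq_nonneg (√p - √b + (√p - √B))]
  have hcM : 0 ≤ c * M := by positivity
  have h7 := mul_le_mul_of_nonneg_left h5 hcM
  have h8 := mul_le_mul_of_nonneg_left h6 (sq_nonneg M)
  have h9 : 0 ≤ c * M * ((√p' - √b') ^ 2 + (√p' - √B') ^ 2) := by positivity
  have h10 : 0 ≤ M ^ 2 * (√p - √b) ^ 2 := by positivity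
  nlinarith

end Pointwise

/-- The squared loss of a plug-in estimator on a sample, in terms of Hellinger distances. -/
lemma sum_sq_plugIn_le {k n K : ℕ} (hn : n ≠ 0) {π π' : Prior} {M : ℝ} {X : Fin n → ℕ}
    (hX : ∀ i, X i ≤ K) (h1 : ∀ x, bayes k π' x ≤ M) (h2 : ∀ x, bayes k π x ≤ M) :
    ENNReal.ofReal (∑ j, (bayes k π' (X j) - bayes k π (X j)) ^ 2)
      ≤ ENNReal.ofReal (34 * (((K : ℝ) + k) ^ k * M + M ^ 2)) * (n *
        (hellingerSq (empirical X) (mixture π') + hellingerSq (empirical X) (mixture π))) := by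
  have hM : 0 ≤ M := (bayes_nonneg k π 0).trans (h2 0)
  set p := empirical X with hp
  have hp0 : ∀ x, 0 ≤ p x := fun x => by rw [hp]; unfold empirical; positivity
  set D : ℕ → ℝ := fun x => (√(p x) - √(mixture π' x)) ^ 2 + (√(p x) - √(mixture π x)) ^ 2 with hD
  have hD0 : ∀ x, 0 ≤ D x := fun x => by positivity
  set c : ℝ := ((K : ℝ) + k) ^ k with hc
  have hc0 : 0 ≤ c := by positivity
  have hn0 : (0 : ℝ) < n := by exact_mod_cast Nat.pos_of_ne_zero hn
  have e1 : ∑ j, (bayes k π' (X j) - bayes k π (X j)) ^ 2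
      = n * ∑ x ∈ Finset.range (K + 1), p x * (bayes k π' x - bayes k π x) ^ 2 := by
    rw [sum_empirical_mul hX fun x => (bayes k π' x - bayes k π x) ^ 2]
    field_simp
  have e2 : ∀ x ∈ Finset.range (K + 1), p x * (bayes k π' x - bayes k π x) ^ 2
      ≤ 34 * (c * M) * D (x + k) + 34 * M ^ 2 * D x := by
    intro x hx
    have hxK : x ≤ K := by have := Finset.mem_range.1 hx; omega
    refine (mul_sq_sub_le_three (p' := p (x + k)) (hp0 x) (mixture_nonneg π' x)
      (mixture_nonneg π' (x + k))
      (mixture_nonneg π x) (mixture_nonneg π (x + k)) (ascFactorial_pos' x k).le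
      (bayes_nonneg k π' x) (h1 x) (bayes_nonneg k π x) (h2 x) (bayes_mul_mixture k π' x)
      (bayes_mul_mixture k π x)).trans ?_
    have := ascFactorial_le_of_le (k := k) hxK
    have h3 := hD0 (x + k)
    simp only [hD] at h3 ⊢
    gcongr
  have e3 : hellingerSq p (mixture π') + hellingerSq p (mixture π)
      = ∑' x, ENNReal.ofReal (D x) := by
    unfold hellingerSq
    rw [← ENNReal.tsum_add]
    refine tsum_congr fun x => ?_
    rw [← ENNReal.ofReal_add (sq_nonneg _) (sq_nonneg _)]
  have e4 : ∀ a : ℕ, ENNReal.ofReal (∑ x ∈ Finset.range (K + 1), D (x + a))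
      ≤ ∑' x, ENNReal.ofReal (D x) := by
    intro a
    rw [ENNReal.ofReal_sum_of_nonneg fun x _ => hD0 _]
    refine (ENNReal.sum_le_tsum _).trans ?_
    exact ENNReal.tsum_comp_le_tsum_of_injective (add_left_injective a)
      fun x => ENNReal.ofReal (D x)
  rw [e1, e3]
  calc _ ≤ ENNReal.ofReal (n * (34 * (c * M) * ∑ x ∈ Finset.range (K + 1), D (x + k)
        + 34 * M ^ 2 * ∑ x ∈ Finset.range (K + 1), D (x + 0))) := by
        refine ENNReal.ofReal_le_ofReal ?_
        refine mul_le_mul_of_nonneg_left ?_ hn0.le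
        rw [Finset.mul_sum _ _ (34 * (c * M)), Finset.mul_sum _ _ (34 * M ^ 2),
          ← Finset.sum_add_distrib]
        exact Finset.sum_le_sum e2
    _ = n * (ENNReal.ofReal (34 * (c * M)) * ENNReal.ofReal (∑ x ∈ Finset.range (K + 1), D (x + k))
        + ENNReal.ofReal (34 * M ^ 2)
          * ENNReal.ofReal (∑ x ∈ Finset.range (K + 1), D (x + 0))) := by
        have s0 : ∀ a, 0 ≤ ∑ x ∈ Finset.range (K + 1), D (x + a) :=
          fun a => Finset.sum_nonneg fun x _ => hD0 _
        rw [ENNReal.ofReal_mul hn0.le, ENNReal.ofReal_natCast,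
          ENNReal.ofReal_add (mul_nonneg (by positivity) (s0 k))
            (mul_nonneg (by positivity) (s0 0)),
          ENNReal.ofReal_mul (p := 34 * (c * M)) (by positivity),
          ENNReal.ofReal_mul (p := 34 * M ^ 2) (by positivity)]
    _ ≤ n * (ENNReal.ofReal (34 * (c * M)) * ∑' x, ENNReal.ofReal (D x)
        + ENNReal.ofReal (34 * M ^ 2) * ∑' x, ENNReal.ofReal (D x)) := by
        gcongr
        · exact e4 k
        · exact e4 0
    _ = _ := by
        rw [← add_mul, ← ENNReal.ofReal_add (by positivity) (by positivity),
          show 34 * (c * M) + 34 * M ^ 2 = 34 * (c * M + M ^ 2) by ring]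
        ring

/-- The mixture with its mass above `K` moved to `K + 1`. -/
def lumped (π : Prior) (K x : ℕ) : ℝ :=
  if x ≤ K then mixture π x
  else if x = K + 1 then 1 - ∑ y ∈ Finset.range (K + 1), mixture π y else 0

lemma lumped_of_le {π : Prior} {K x : ℕ} (hx : x ≤ K) : lumped π K x = mixture π x := if_pos hx

lemma sum_mixture_le_one (π : Prior) (K : ℕ) :
    ∑ y ∈ Finset.range (K + 1), mixture π y ≤ 1 :=
  sum_le_hasSum _ (fun y _ => mixture_nonneg π y) (hasSum_mixture π)

lemma isMassFunction_lumped (π : Prior) (K : ℕ) : IsMassFunction (lumped π K) := by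
  refine ⟨fun x => ?_, ?_⟩
  · have := sum_mixture_le_one π K
    have := mixture_nonneg π x
    unfold lumped; split_ifs <;> linarith
  · have h0 : ∀ x ∉ Finset.range (K + 2), lumped π K x = 0 := by
      intro x hx
      have : K + 2 ≤ x := by simpa using hx
      rw [lumped, if_neg (by omega), if_neg (by omega)]
    have h1 : ∑ x ∈ Finset.range (K + 2), lumped π K x = 1 := by
      rw [Finset.sum_range_succ, Finset.sum_congr rfl (g := mixture π) fun x hx =>
        lumped_of_le (by have := Finset.mem_range.1 hx; omega)]
      rw [lumped, if_neg (by omega), if_pos rfl]; ring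
    rw [← h1]
    exact hasSum_sum_of_ne_finset_zero h0

lemma ofReal_one_sub_sum_mixture (π : Prior) (K : ℕ) :
    ENNReal.ofReal (1 - ∑ y ∈ Finset.range (K + 1), mixture π y)
      = ∑' x, ENNReal.ofReal (mixture π (x + (K + 1))) := by
  rw [← ENNReal.ofReal_tsum_of_nonneg (fun x => mixture_nonneg π _)
    ((summable_nat_add_iff (K + 1)).2 (hasSum_mixture π).summable)]
  congr 1
  have := (hasSum_mixture π).summable.sum_add_tsum_nat_add (K + 1)
  rw [(hasSum_mixture π).tsum_eq] at this
  linarith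

lemma tsum_tail_eq (π : Prior) (K : ℕ) :
    ∑' x, (if K < x then 1 else 0) * ENNReal.ofReal (mixture π x)
      = ∑' x, ENNReal.ofReal (mixture π (x + (K + 1))) := by
  rw [← ENNReal.summable.sum_add_tsum_nat_add' (k := K + 1), Finset.sum_eq_zero, zero_add]
  · refine tsum_congr fun x => ?_
    rw [if_pos (by omega), one_mul]
  · intro x hx
    have := Finset.mem_range.1 hx
    rw [if_neg (by omega), zero_mul]

/-- No observation falls in the cell K + 1, so if its mass is ε it contributes (0 - ε)² / ε = ε;
later cells are empty. -/
lemma chiSq_lumped_eq {n K : ℕ} {π : Prior} {X : Fin n → ℕ} (hX : ∀ i, X i ≤ K) :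
    chiSq (empirical X) (lumped π K)
      = ∑ x ∈ Finset.range (K + 1),
          ENNReal.ofReal ((empirical X x - mixture π x) ^ 2) / ENNReal.ofReal (mixture π x)
        + ENNReal.ofReal (1 - ∑ y ∈ Finset.range (K + 1), mixture π y) := by
  unfold chiSq
  rw [← ENNReal.summable.sum_add_tsum_nat_add' (k := K + 1)]
  congr 1
  · refine Finset.sum_congr rfl fun x hx => ?_
    rw [lumped_of_le (by have := Finset.mem_range.1 hx; omega)]
  · rw [tsum_eq_single 0]
    · rw [empirical_eq_zero hX (by omega), lumped, if_neg (by omega), if_pos (by omega)]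
      set ε := 1 - ∑ y ∈ Finset.range (K + 1), mixture π y
      have h0 : 0 ≤ ε := by have := sum_mixture_le_one π K; simp only [ε]; linarith
      rcases h0.eq_or_lt with h | h
      · rw [← h]; simp
      · rw [← ENNReal.ofReal_div_of_pos h]; congr 1; field_simp; ring
    · intro x hx
      rw [empirical_eq_zero hX (by omega), lumped, if_neg (by omega), if_neg (by omega)]
      simp

/-- Follows from (p - f)² = (√p - √f)² (√p + √f)² and (√p + √f)² ≥ f. -/
lemma ofReal_sqrt_sub_sq_le {p f : ℝ} (hp : 0 ≤ p) (hf : 0 ≤ f) :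
    ENNReal.ofReal ((√p - √f) ^ 2) ≤ ENNReal.ofReal ((p - f) ^ 2) / ENNReal.ofReal f := by
  rcases hf.eq_or_lt with h | h
  · rw [← h]
    rcases hp.eq_or_lt with h' | h'
    · rw [← h']; simp
    · rw [ENNReal.ofReal_zero, ENNReal.div_zero]
      · exact le_top
      · simp; positivity
  · rw [← ENNReal.ofReal_div_of_pos h]
    refine ENNReal.ofReal_le_ofReal ?_
    rw [le_div_iff₀ h]
    have h1 := Real.sq_sqrt hp
    have h2 := Real.sq_sqrt hf
    have e : (p - f) ^ 2 = (√p - √f) ^ 2 * (√p + √f) ^ 2 := by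
      have : p - f = (√p - √f) * (√p + √f) := by nlinarith
      rw [this]; ring
    rw [e]
    refine mul_le_mul_of_nonneg_left ?_ (sq_nonneg _)
    nlinarith [Real.sqrt_nonneg p, Real.sqrt_nonneg f, mul_nonneg (Real.sqrt_nonneg p)
      (Real.sqrt_nonneg f)]

lemma hellingerSq_mixture_le {n K : ℕ} {π : Prior} {X : Fin n → ℕ} (hX : ∀ i, X i ≤ K) :
    hellingerSq (empirical X) (mixture π) ≤ chiSq (empirical X) (lumped π K) := by
  rw [chiSq_lumped_eq hX, ofReal_one_sub_sum_mixture, hellingerSq,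
    ← ENNReal.summable.sum_add_tsum_nat_add' (k := K + 1)]
  refine add_le_add (Finset.sum_le_sum fun x _ => ofReal_sqrt_sub_sq_le
    (by unfold empirical; positivity) (mixture_nonneg π x)) (ENNReal.tsum_le_tsum fun x => ?_)
  rw [empirical_eq_zero hX (by omega)]
  simp [Real.sq_sqrt (mixture_nonneg π _)]

/-- The binomial variance of N(x) is at most n f(x), so each cell contributes at most 1 / n to the
expected χ²-divergence. -/
lemma lintegral_sq_div_le (π : Prior) {n : ℕ} (hn : n ≠ 0) (x : ℕ) :
    ∫⁻ X : Fin n → ℕ, n * (ENNReal.ofReal ((empirical X x - mixture π x) ^ 2)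
      / ENNReal.ofReal (mixture π x)) ∂(dataLaw π n) ≤ 1 := by
  have hn0 : (0 : ℝ) < n := by exact_mod_cast Nat.pos_of_ne_zero hn
  have h1 : ∀ X : Fin n → ℕ, n * (ENNReal.ofReal ((empirical X x - mixture π x) ^ 2)
      / ENNReal.ofReal (mixture π x))
      = ENNReal.ofReal (1 / n * ((count X x : ℝ) - n * mixture π x) ^ 2)
        * (ENNReal.ofReal (mixture π x))⁻¹ := by
    intro X
    rw [div_eq_mul_inv, ← mul_assoc, ← ENNReal.ofReal_natCast n, ← ENNReal.ofReal_mul hn0.le]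
    congr 2
    unfold empirical; field_simp
  simp_rw [h1]
  rw [lintegral_mul_const _ Measurable.of_discrete, ← ofReal_integral_eq_lintegral_ofReal
    (integrable_count π n x fun a => 1 / n * ((a : ℝ) - n * mixture π x) ^ 2)
    (Filter.Eventually.of_forall fun X => by simp only [Pi.zero_apply]; positivity),
    integral_const_mul, ← div_eq_mul_inv]
  refine ENNReal.div_le_of_le_mul ?_
  rw [one_mul]
  refine ENNReal.ofReal_le_ofReal ?_
  have h2 := integral_sub_sq_le π n x
  calc _ ≤ 1 / n * (n * mixture π x) := by gcongr
    _ = _ := by field_simp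

/-- The property of an estimated prior on which the analysis of the plug-in estimator rests. -/
def IsHellingerMin (R : ℝ) (π : Prior) {n : ℕ} (πhat : (Fin n → ℕ) → Prior) : Prop :=
  ∀ X q, IsMassFunction q → (∀ i, q (X i) = mixture π (X i)) →
    hellingerSq (empirical X) (mixture (πhat X)) ≤ ENNReal.ofReal R * chiSq (empirical X) q

/-- Both Hellinger distances to the empirical law are bounded by its χ²-divergence to the lumped
mixture. In expectation, n times the latter is at most K + 2: one for each of the K + 1 cells and
one for the tail. -/
theorem excess_plugIn_le {k : ℕ} {R : ℝ} (hR : 0 ≤ R) {h : ℝ} {π : Prior}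
    (hπ : π ∈ boundedPriors h)
    {n : ℕ} (hn : n ≠ 0) {M : ℝ} (hM : h ^ k ≤ M) {K : ℕ} {πhat : (Fin n → ℕ) → Prior}
    (hmin : IsHellingerMin R π πhat)
    (hbd : ∀ X : Fin n → ℕ, (∀ i, X i ≤ K) → ∀ x, bayes k (πhat X) x ≤ M)
    (htail : n * ∑' x, (if K < x then 1 else 0) * ENNReal.ofReal (mixture π x) ≤ 1) :
    excess k (plugIn k πhat) π {X | ∀ i, X i ≤ K}
      ≤ ENNReal.ofReal (68 * (R + 1) * regretSize k K M) := by
  have hM0 : 0 ≤ M := (pow_nonneg (nonneg_of_mem_boundedPriors hπ) k).trans hM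
  set c : ℝ := ((K : ℝ) + k) ^ k with hc
  have hc0 : 0 ≤ c := by positivity
  have hpt : ∀ X ∈ {X : Fin n → ℕ | ∀ i, X i ≤ K},
      ∑ j, ENNReal.ofReal ((plugIn k πhat X j - bayes k π (X j)) ^ 2)
      ≤ ENNReal.ofReal (34 * (c * M + M ^ 2) * (R + 1)) *
        (∑ x ∈ Finset.range (K + 1), n * (ENNReal.ofReal ((empirical X x - mixture π x) ^ 2)
          / ENNReal.ofReal (mixture π x)) + 1) := by
    intro X hX
    rw [← ENNReal.ofReal_sum_of_nonneg fun j _ => sq_nonneg _]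
    refine (sum_sq_plugIn_le hn hX (hbd X hX) fun x => (bayes_le hπ x).trans hM).trans ?_
    have h1 := hmin X (lumped π K) (isMassFunction_lumped π K) fun i => lumped_of_le (hX i)
    have h2 := hellingerSq_mixture_le (π := π) hX
    have h3 : (n : ℝ≥0∞) * chiSq (empirical X) (lumped π K)
        ≤ ∑ x ∈ Finset.range (K + 1), n * (ENNReal.ofReal ((empirical X x - mixture π x) ^ 2)
          / ENNReal.ofReal (mixture π x)) + 1 := by
      rw [chiSq_lumped_eq hX, mul_add, Finset.mul_sum]
      gcongr
      rwa [ofReal_one_sub_sum_mixture, ← tsum_tail_eq]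
    calc _ ≤ ENNReal.ofReal (34 * (c * M + M ^ 2)) * (n * (ENNReal.ofReal R *
          chiSq (empirical X) (lumped π K) + chiSq (empirical X) (lumped π K))) := by gcongr
      _ = ENNReal.ofReal (34 * (c * M + M ^ 2)) * ENNReal.ofReal (R + 1) *
          (n * chiSq (empirical X) (lumped π K)) := by
          rw [ENNReal.ofReal_add hR zero_le_one, ENNReal.ofReal_one]; ring
      _ ≤ _ := by
          rw [← ENNReal.ofReal_mul (by positivity)]
          gcongr
  calc excess k (plugIn k πhat) π {X | ∀ i, X i ≤ K}
      ≤ ∫⁻ X in {X : Fin n → ℕ | ∀ i, X i ≤ K},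
          ENNReal.ofReal (34 * (c * M + M ^ 2) * (R + 1)) *
          (∑ x ∈ Finset.range (K + 1), n * (ENNReal.ofReal ((empirical X x - mixture π x) ^ 2)
          / ENNReal.ofReal (mixture π x)) + 1) ∂(dataLaw π n) :=
        setLIntegral_mono' MeasurableSet.of_discrete hpt
    _ ≤ ∫⁻ X : Fin n → ℕ, ENNReal.ofReal (34 * (c * M + M ^ 2) * (R + 1)) *
          (∑ x ∈ Finset.range (K + 1), n * (ENNReal.ofReal ((empirical X x - mixture π x) ^ 2)
          / ENNReal.ofReal (mixture π x)) + 1) ∂(dataLaw π n) := setLIntegral_le_lintegral _ _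
    _ ≤ ENNReal.ofReal (34 * (c * M + M ^ 2) * (R + 1)) *
          (∑ x ∈ Finset.range (K + 1), 1 + 1) := by
        rw [lintegral_const_mul _ Measurable.of_discrete,
          lintegral_add_left Measurable.of_discrete,
          lintegral_finsetSum _ fun x _ => Measurable.of_discrete]
        gcongr with x _
        · exact lintegral_sq_div_le π hn x
        · simp
    _ ≤ _ := by
        have : (∑ x ∈ Finset.range (K + 1), 1 + 1 : ℝ≥0∞) = ENNReal.ofReal ((K : ℝ) + 2) := by
          rw [Finset.sum_const, Finset.card_range, nsmul_eq_mul, mul_one]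
          rw [ENNReal.ofReal_add (by positivity) (by norm_num), ENNReal.ofReal_natCast]
          push_cast
          rw [add_assoc]; norm_num
        rw [this, ← ENNReal.ofReal_mul (by positivity)]
        refine ENNReal.ofReal_le_ofReal ?_
        rw [regretSize, ← hc]
        have h1 : (K : ℝ) + 2 ≤ 2 * ((K : ℝ) + 1) := by
          have : (0 : ℝ) ≤ K := by positivity
          linarith
        calc _ ≤ 34 * (c * M + M ^ 2) * (R + 1) * (2 * ((K : ℝ) + 1)) := by gcongr
          _ = _ := by ring

/-! ### Moving mass to the left -/

/-- The prior `π` with its mass above `R` moved to `R`. -/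
def capPrior (π : Prior) (R : ℝ≥0) : Prior :=
  π.map (f := fun θ => min θ R) (by fun_prop)

lemma mixture_capPrior (π : Prior) (R : ℝ≥0) (x : ℕ) :
    mixture (capPrior π R) x = ∫ θ, pw (min θ R) x ∂(π : Measure ℝ≥0) := by
  rw [mixture_eq, capPrior, ProbabilityMeasure.toMeasure_map,
    integral_map (by fun_prop) (measurable_pw x).aestronglyMeasurable]

lemma capPrior_mem (π : Prior) (R : ℝ≥0) : capPrior π R ∈ boundedPriors R := by
  change (capPrior π R : Measure ℝ≥0) _ = 1
  rw [capPrior, ProbabilityMeasure.toMeasure_map, Measure.map_apply (by fun_prop)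
    (measurableSet_le_param _)]
  have : (fun θ : ℝ≥0 => min θ R) ⁻¹' {θ | (θ : ℝ) ≤ R} = Set.univ := by
    ext θ; simp
  rw [this]; simp

/-- The map θ ↦ e^{-θ} θ^x decreases strictly on [x, ∞): with θ = R(1 + y), one has (1 + y)^x <
e^{xy} ≤ e^{Ry} for x ≥ 1. -/
lemma pw_lt_pw {R θ : ℝ≥0} {x : ℕ} (hx : (x : ℝ) ≤ R) (hθ : R < θ) : pw θ x < pw R x := by
  unfold pw
  have hθ' : (R : ℝ) < θ := by exact_mod_cast hθ
  refine div_lt_div_of_pos_right ?_ (by positivity)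
  have hR : (0 : ℝ) ≤ R := R.2
  rcases Nat.eq_zero_or_pos x with rfl | hx0
  · simpa using hθ'
  have hR0 : (0 : ℝ) < R := lt_of_lt_of_le (by exact_mod_cast hx0) hx
  set y := ((θ : ℝ) - R) / R with hy
  have hy0 : 0 < y := div_pos (by linarith) hR0
  have e1 : (θ : ℝ) = R * (1 + y) := by rw [hy]; field_simp; ring
  have h1 : 1 + y < Real.exp y := by rw [add_comm]; exact Real.add_one_lt_exp hy0.ne'
  have h2 : (1 + y) ^ x < Real.exp y ^ x := pow_lt_pow_left₀ h1 (by linarith) hx0.ne'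
  have h3 : Real.exp y ^ x ≤ Real.exp (R * y) := by
    rw [← Real.exp_nat_mul]; exact Real.exp_le_exp.2 (by gcongr)
  have h4 : Real.exp (-(θ : ℝ)) = Real.exp (-(R : ℝ)) / Real.exp (R * y) := by
    rw [← Real.exp_sub]; congr 1; rw [e1]; ring
  rw [h4, e1, mul_pow]
  have h5 := h2.trans_le h3
  rw [div_mul_eq_mul_div, div_lt_iff₀ (Real.exp_pos _)]
  have : 0 < Real.exp (-(R : ℝ)) * (R : ℝ) ^ x := by positivity
  calc _ = Real.exp (-(R : ℝ)) * (R : ℝ) ^ x * (1 + y) ^ x := by ring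
    _ < Real.exp (-(R : ℝ)) * (R : ℝ) ^ x * Real.exp (R * y) := by gcongr
    _ = _ := by ring

lemma pw_le_pw_min {R : ℝ≥0} (θ : ℝ≥0) {x : ℕ} (hx : (x : ℝ) ≤ R) :
    pw θ x ≤ pw (min θ R) x := by
  rcases le_or_gt θ R with h | h
  · rw [min_eq_left h]
  · rw [min_eq_right h.le]; exact (pw_lt_pw hx h).le

lemma integrable_pw_min (π : Prior) (R : ℝ≥0) (x : ℕ) :
    Integrable (fun θ => pw (min θ R) x) (π : Measure ℝ≥0) :=
  Integrable.of_bound ((measurable_pw x).comp (by fun_prop :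
    Measurable fun θ : ℝ≥0 => min θ R)).aestronglyMeasurable 1
    (Filter.Eventually.of_forall fun θ => by
      rw [Real.norm_of_nonneg (pw_nonneg _ x)]; exact pw_le_one _ x)

lemma mixture_le_capPrior (π : Prior) {R : ℝ≥0} {x : ℕ} (hx : (x : ℝ) ≤ R) :
    mixture π x ≤ mixture (capPrior π R) x := by
  rw [mixture_capPrior, mixture_eq]
  exact integral_mono (integrable_pw π x) (integrable_pw_min π R x) fun θ => pw_le_pw_min θ hx

/-- Equality would force the pointwise inequality to be an equality π-almost everywhere, which
excludes mass above R. -/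
lemma mixture_lt_capPrior {π : Prior} {R : ℝ≥0} (hπ : π ∉ boundedPriors R) {x : ℕ}
    (hx : (x : ℝ) ≤ R) : mixture π x < mixture (capPrior π R) x := by
  refine lt_of_le_of_ne (mixture_le_capPrior π hx) fun heq => hπ ?_
  have h0 : ∫ θ, (pw (min θ R) x - pw θ x) ∂(π : Measure ℝ≥0) = 0 := by
    rw [integral_sub (integrable_pw_min π R x) (integrable_pw π x), ← mixture_capPrior,
      ← mixture_eq, heq, sub_self]
  have h1 := (integral_eq_zero_iff_of_nonneg (fun θ => sub_nonneg.2 (pw_le_pw_min θ hx))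
    ((integrable_pw_min π R x).sub (integrable_pw π x))).1 h0
  refine (prob_compl_eq_zero_iff (measurableSet_le_param _)).1 ?_
  have h2 : ∀ᵐ θ : ℝ≥0 ∂(π : Measure ℝ≥0), (θ : ℝ) ≤ R := by
    filter_upwards [h1] with θ hθ
    by_contra hc
    have hc' : R < θ := by exact_mod_cast not_le.1 hc
    have := pw_lt_pw hx hc'
    simp only [Pi.zero_apply, min_eq_right hc'.le] at hθ
    linarith
  exact h2

/-! ### Minimum distance estimators -/

lemma exists_coe_of_sum_ne {ι : Type*} [DecidableEq ι] {s : Finset ι} {f : ι → EReal}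
    (hb : ∑ i ∈ s, f i ≠ ⊥) :
    (∀ i ∈ s, f i ≠ ⊥) ∧ (∑ i ∈ s, f i ≠ ⊤ → ∀ i ∈ s, f i ≠ ⊤) := by
  induction s using Finset.induction_on with
  | empty => simp
  | insert a s ha ih =>
    rw [Finset.sum_insert ha] at hb ⊢
    have h1 : f a ≠ ⊥ ∧ ∑ i ∈ s, f i ≠ ⊥ := by
      constructor <;> intro h <;> exact hb (by simp [h])
    obtain ⟨h2, h3⟩ := ih h1.2
    refine ⟨fun i hi => ?_, fun ht i hi => ?_⟩
    · rcases Finset.mem_insert.1 hi with rfl | hi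
      · exact h1.1
      · exact h2 i hi
    · have h4 : f a ≠ ⊤ ∧ ∑ i ∈ s, f i ≠ ⊤ := by
        constructor
        · intro h; exact ht (by rw [h]; exact EReal.top_add_of_ne_bot h1.2)
        · intro h; exact ht (by rw [h]; exact EReal.add_top_of_ne_bot h1.1)
      rcases Finset.mem_insert.1 hi with rfl | hi
      · exact h4.1
      · exact h3 h4.2 i hi

lemma ereal_coe_sum {ι : Type*} (s : Finset ι) (f : ι → ℝ) :
    ((∑ i ∈ s, f i : ℝ) : EReal) = ∑ i ∈ s, (f i : EReal) := by
  classical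
  induction s using Finset.induction_on with
  | empty => simp
  | insert a s ha ih => rw [Finset.sum_insert ha, Finset.sum_insert ha, EReal.coe_add, ih]

/-- In `EReal`, ⊥ is absorbing for addition and infinite values destroy strictness, so all summands
are first shown to be real. -/
lemma ereal_sum_lt_sum {ι : Type*} [DecidableEq ι] {s : Finset ι} (hs : s.Nonempty)
    {f g : ι → EReal} (hfb : ∑ i ∈ s, f i ≠ ⊥) (hgt : ∑ i ∈ s, g i ≠ ⊤)
    (hfg : ∀ i ∈ s, f i < g i) : ∃ a b : ℝ, ∑ i ∈ s, f i = a ∧ ∑ i ∈ s, g i = b ∧ a < b := by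
  have hf := (exists_coe_of_sum_ne hfb).1
  have hgb : ∑ i ∈ s, g i ≠ ⊥ := by
    intro h
    have : ∑ i ∈ s, f i ≤ ∑ i ∈ s, g i := Finset.sum_le_sum fun i hi => (hfg i hi).le
    rw [h] at this
    exact hfb (le_bot_iff.1 this)
  obtain ⟨hg1, hg2⟩ := exists_coe_of_sum_ne hgb
  have hg3 := hg2 hgt
  have ef : ∀ i ∈ s, f i = ((f i).toReal : EReal) := fun i hi =>
    (EReal.coe_toReal (ne_top_of_lt (hfg i hi)) (hf i hi)).symm
  have eg : ∀ i ∈ s, g i = ((g i).toReal : EReal) := fun i hi =>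
    (EReal.coe_toReal (hg3 i hi) (hg1 i hi)).symm
  refine ⟨∑ i ∈ s, (f i).toReal, ∑ i ∈ s, (g i).toReal, ?_, ?_, ?_⟩
  · rw [Finset.sum_congr rfl ef, ereal_coe_sum]
  · rw [Finset.sum_congr rfl eg, ereal_coe_sum]
  · refine Finset.sum_lt_sum_of_nonempty hs fun i hi => ?_
    have := hfg i hi
    rw [ef i hi, eg i hi] at this
    exact_mod_cast this

lemma IsMassFunction.mem_Icc {p : ℕ → ℝ} (hp : IsMassFunction p) (x : ℕ) :
    p x ∈ Set.Icc (0 : ℝ) 1 :=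
  ⟨hp.1 x, le_hasSum hp.2 x fun y _ => hp.1 y⟩

section MinDistance

variable {a₁ a₂ : ℝ} {d : (ℕ → ℝ) → (ℕ → ℝ) → ℝ≥0∞}

lemma exists_forall_le_nat {n : ℕ} (X : Fin n → ℕ) : ∃ K, ∀ i, X i ≤ K :=
  ⟨∑ i, X i, fun i => Finset.single_le_sum (f := X) (fun _ _ => Nat.zero_le _) (Finset.mem_univ i)⟩

lemma isMassFunction_empirical' {n : ℕ} (hn : n ≠ 0) (X : Fin n → ℕ) :
    IsMassFunction (empirical X) := by
  obtain ⟨K, hK⟩ := exists_forall_le_nat X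
  exact isMassFunction_empirical hn hK

/-- As L(0, ·) = 0, the divergence sees its second argument only on the support of the first. -/
lemma IsAdmissibleDivergence.congr (hd : IsAdmissibleDivergence a₁ a₂ d) {p q q' : ℕ → ℝ}
    (hp : IsMassFunction p) (hps : p.support.Finite) (hq : IsMassFunction q)
    (hq' : IsMassFunction q') (h : ∀ x, p x ≠ 0 → q x = q' x) : d p q = d p q' := by
  obtain ⟨φ, L, hL0, -, -, hdL⟩ := hd.separable
  rw [← EReal.coe_ennreal_eq_coe_ennreal_iff, hdL p q hp hq hps, hdL p q' hp hq' hps]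
  congr 2
  funext x
  by_cases hx : p x = 0
  · rw [hx, hL0 _ (hq.mem_Icc x), hL0 _ (hq'.mem_Icc x)]
  · rw [h x hx]

/-- The chain a₁ H²(p, f_π̂) ≤ d(p ‖ f_π̂) ≤ d(p ‖ f_π) = d(p ‖ q) ≤ a₂ χ²(p ‖ q), with p the
empirical law. -/
lemma IsMinDistance.isHellingerMin (h₁ : 0 < a₁) (hd : IsAdmissibleDivergence a₁ a₂ d)
    {G : Set Prior} {n : ℕ} (hn : n ≠ 0) {πhat : (Fin n → ℕ) → Prior}
    (hmin : IsMinDistance d G πhat) {π : Prior} (hπ : π ∈ G) :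
    IsHellingerMin (a₂ / a₁) π πhat := by
  intro X q hq hqX
  have hp := isMassFunction_empirical' hn X
  have hps := empirical_support_finite X
  have h1 := (hd.comparable _ _ hp (isMassFunction_mixture (πhat X)) hps).1
  have h2 := isMinOn_iff.1 (hmin X).2 π hπ
  have h3 : d (empirical X) (mixture π) = d (empirical X) q := by
    refine hd.congr hp hps (isMassFunction_mixture π) hq fun x hx => ?_
    obtain ⟨i, rfl⟩ := exists_eq_of_empirical_ne_zero hx
    exact (hqX i).symm
  have h4 := (hd.comparable _ _ hp hq hps).2
  have h5 := (h1.trans h2).trans (h3.le.trans h4)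
  have h6 : ENNReal.ofReal a₁ ≠ 0 := by simpa using h₁
  rw [mul_comm, ← ENNReal.le_div_iff_mul_le (Or.inl h6) (Or.inl ENNReal.ofReal_ne_top)] at h5
  rw [ENNReal.ofReal_div_of_pos h₁]
  refine h5.trans (le_of_eq ?_)
  rw [div_eq_mul_inv, div_eq_mul_inv]; ring

/-- The value of the `χ²`-divergence, when it is finite. -/
lemma chiSq_eq {n K : ℕ} (hn : n ≠ 0) {X : Fin n → ℕ} (hX : ∀ i, X i ≤ K) {q : ℕ → ℝ}
    (hq : IsMassFunction q) (hqX : ∀ i, 0 < q (X i)) :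
    chiSq (empirical X) q
      = ENNReal.ofReal (∑ x ∈ Finset.range (K + 1), empirical X x ^ 2 / q x - 1) := by
  have hp := isMassFunction_empirical hn hX
  have h1 : ∀ x, ENNReal.ofReal ((empirical X x - q x) ^ 2) / ENNReal.ofReal (q x)
      = ENNReal.ofReal (empirical X x ^ 2 / q x - 2 * empirical X x + q x)
      ∧ 0 ≤ empirical X x ^ 2 / q x - 2 * empirical X x + q x := by
    intro x
    rcases (hq.1 x).eq_or_lt with h | h
    · have : empirical X x = 0 := by
        by_contra hne
        obtain ⟨i, rfl⟩ := exists_eq_of_empirical_ne_zero hne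
        exact (hqX i).ne h
      rw [← h, this]; simp
    · have e : empirical X x ^ 2 / q x - 2 * empirical X x + q x
          = (empirical X x - q x) ^ 2 / q x := by field_simp; ring
      rw [e, ← ENNReal.ofReal_div_of_pos h]
      exact ⟨rfl, by positivity⟩
  have h2 : HasSum (fun x => empirical X x ^ 2 / q x)
      (∑ x ∈ Finset.range (K + 1), empirical X x ^ 2 / q x) := by
    refine hasSum_sum_of_ne_finset_zero fun x hx => ?_
    rw [empirical_eq_zero hX (by simpa using hx)]; simp
  have h3 := (h2.sub (hp.2.mul_left 2)).add hq.2
  unfold chiSq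
  simp_rw [fun x => (h1 x).1]
  rw [← ENNReal.ofReal_tsum_of_nonneg (fun x => (h1 x).2) h3.summable, h3.tsum_eq]
  congr 1; ring

/-- The point mass at `θ`, as a prior. -/
def pointPrior (θ : ℝ≥0) : Prior := ⟨Measure.dirac θ, inferInstance⟩

lemma mixture_pointPrior (θ : ℝ≥0) (x : ℕ) : mixture (pointPrior θ) x = pw θ x := by
  rw [mixture_eq]
  exact integral_dirac _ _

lemma pw_pos {θ : ℝ≥0} (hθ : 0 < θ) (x : ℕ) : 0 < pw θ x := by
  have : (0 : ℝ) < θ := hθ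
  unfold pw; positivity

/-- Otherwise capping at K would raise the mixture at every observed value and, L(a, ·) being
strictly decreasing, strictly lower a finite distance. -/
lemma IsMinDistance.mem_boundedPriors (hd : IsAdmissibleDivergence a₁ a₂ d)
    {n : ℕ} (hn : n ≠ 0) {πhat : (Fin n → ℕ) → Prior}
    (hmin : IsMinDistance d Set.univ πhat) {X : Fin n → ℕ} {K : ℕ} (hX : ∀ i, X i ≤ K) :
    πhat X ∈ boundedPriors K := by
  classical
  by_contra hc
  have hc' : πhat X ∉ boundedPriors ((K : ℝ≥0) : ℝ) := by simpa using hc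
  set π' := capPrior (πhat X) K
  have hp := isMassFunction_empirical' hn X
  have hps := empirical_support_finite X
  have hlt : ∀ x, empirical X x ≠ 0 → mixture (πhat X) x < mixture π' x := by
    intro x hx
    obtain ⟨i, rfl⟩ := exists_eq_of_empirical_ne_zero hx
    exact mixture_lt_capPrior hc' (by have := hX i; simpa using this)
  -- Poi(1) charges every point, so the prior at 1 has finite χ²-divergence and the minimum is
  -- finite.
  have hfin : d (empirical X) (mixture (πhat X)) ≠ ⊤ := by
    have h1 := isMinOn_iff.1 (hmin X).2 (pointPrior 1) trivial
    have h2 := (hd.comparable _ _ hp (isMassFunction_mixture (pointPrior 1)) hps).2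
    refine ne_top_of_le_ne_top (ENNReal.mul_ne_top ENNReal.ofReal_ne_top ?_) (h1.trans h2)
    rw [chiSq_eq hn hX (isMassFunction_mixture _) fun i => by
      rw [mixture_pointPrior]; exact pw_pos one_pos _]
    exact ENNReal.ofReal_ne_top
  obtain ⟨φ, L, hL0, hanti, -, hdL⟩ := hd.separable
  have hsum : ∀ q, IsMassFunction q → (d (empirical X) q : EReal)
      = (φ (empirical X) : EReal) + ∑ x ∈ hps.toFinset, L (empirical X x) (q x) := by
    intro q hq
    rw [hdL _ _ hp hq hps]
    congr 1
    refine finsum_eq_sum_of_support_subset _ fun x hx => ?_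
    rw [Set.Finite.coe_toFinset]
    intro h0
    exact hx (by simp only [h0]; exact hL0 _ (hq.mem_Icc x))
  have e1 := hsum _ (isMassFunction_mixture (πhat X))
  have e2 := hsum _ (isMassFunction_mixture π')
  have hne : hps.toFinset.Nonempty := by
    have i : Fin n := ⟨0, Nat.pos_of_ne_zero hn⟩
    exact ⟨X i, by simpa using (empirical_pos X i).ne'⟩
  obtain ⟨a, b, ha, hb, hab⟩ := ereal_sum_lt_sum (s := hps.toFinset) hne
    (f := fun x => L (empirical X x) (mixture π' x))
    (g := fun x => L (empirical X x) (mixture (πhat X) x)) (by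
      intro h
      rw [h] at e2
      simp at e2) (by
      intro h
      rw [h] at e1
      simp at e1
      exact hfin e1) (fun x hx => by
      have hx' : empirical X x ≠ 0 := by simpa using hx
      have hpx := hp.mem_Icc x
      exact hanti _ ⟨lt_of_le_of_ne hpx.1 (Ne.symm hx'), hpx.2⟩
        ((isMassFunction_mixture _).mem_Icc x) ((isMassFunction_mixture _).mem_Icc x) (hlt x hx'))
  rw [hb, ← EReal.coe_add] at e1
  rw [ha, ← EReal.coe_add] at e2
  have h1 := isMinOn_iff.1 (hmin X).2 π' trivial
  rw [← EReal.coe_ennreal_le_coe_ennreal_iff, e1, e2, EReal.coe_le_coe_iff] at h1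
  linarith

end MinDistance

/-! ### Nonparametric maximum likelihood -/

lemma IsNPMLE.prod_pos {G : Set Prior} {n : ℕ} {πhat : (Fin n → ℕ) → Prior}
    (hmax : IsNPMLE G πhat) {θ : ℝ≥0} (hθ : 0 < θ) (hG : pointPrior θ ∈ G) (X : Fin n → ℕ) :
    0 < ∏ i, mixture (πhat X) (X i) := by
  refine lt_of_lt_of_le ?_ (isMaxOn_iff.1 (hmax X).2 _ hG)
  exact Finset.prod_pos fun i _ => by rw [mixture_pointPrior]; exact pw_pos hθ _

lemma pos_of_prod_pos {n : ℕ} {f : Fin n → ℝ} (hf : ∀ i, 0 ≤ f i) (h : 0 < ∏ i, f i)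
    (i : Fin n) : 0 < f i :=
  lt_of_le_of_ne (hf i) fun h0 => h.ne' (Finset.prod_eq_zero (Finset.mem_univ i) h0.symm)

lemma IsNPMLE.mem_boundedPriors {n : ℕ} (hn : n ≠ 0) {πhat : (Fin n → ℕ) → Prior}
    (hmax : IsNPMLE Set.univ πhat) {X : Fin n → ℕ} {K : ℕ} (hX : ∀ i, X i ≤ K) :
    πhat X ∈ boundedPriors K := by
  by_contra hc
  have hc' : πhat X ∉ boundedPriors ((K : ℝ≥0) : ℝ) := by simpa using hc
  have h1 := isMaxOn_iff.1 (hmax X).2 (capPrior (πhat X) K) trivial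
  have h2 := pos_of_prod_pos (fun i => mixture_nonneg _ _)
    (hmax.prod_pos one_pos trivial X)
  have : Nonempty (Fin n) := ⟨⟨0, Nat.pos_of_ne_zero hn⟩⟩
  refine absurd (Finset.prod_lt_prod_of_nonempty (s := Finset.univ) (fun i _ => h2 i) (fun i _ =>
    mixture_lt_capPrior hc' (x := X i) ?_) Finset.univ_nonempty) (not_lt.2 h1)
  have := hX i; simpa using this

lemma hellingerSq_eq {n K : ℕ} (hn : n ≠ 0) {X : Fin n → ℕ} (hX : ∀ i, X i ≤ K) {q : ℕ → ℝ}
    (hq : IsMassFunction q) :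
    hellingerSq (empirical X) q
      = ENNReal.ofReal (2 - 2 * ∑ x ∈ Finset.range (K + 1), √(empirical X x) * √(q x)) := by
  have hp := isMassFunction_empirical hn hX
  have h1 : ∀ x, (√(empirical X x) - √(q x)) ^ 2
      = empirical X x + q x - 2 * (√(empirical X x) * √(q x)) := by
    intro x
    nlinarith [Real.sq_sqrt (hp.1 x), Real.sq_sqrt (hq.1 x)]
  have h2 : HasSum (fun x => √(empirical X x) * √(q x))
      (∑ x ∈ Finset.range (K + 1), √(empirical X x) * √(q x)) := by
    refine hasSum_sum_of_ne_finset_zero fun x hx => ?_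
    rw [empirical_eq_zero hX (by simpa using hx)]; simp
  have h3 := (hp.2.add hq.2).sub (h2.mul_left 2)
  unfold hellingerSq
  rw [← ENNReal.ofReal_tsum_of_nonneg (fun x => sq_nonneg _) (by simp_rw [h1]; exact h3.summable)]
  simp_rw [h1]
  rw [h3.tsum_eq]; norm_num

/-- With p the empirical law, H²(p, f_π̂) ≤ KL(p ‖ f_π̂) ≤ KL(p ‖ q) ≤ χ²(p ‖ q): the middle step is
maximality of the likelihood and the outer ones are log u ≤ u - 1. The positive point prior in the
class keeps the maximal likelihood positive. If q vanishes at an observation, the right side is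
infinite. -/
lemma IsNPMLE.isHellingerMin {G : Set Prior} {n : ℕ} (hn : n ≠ 0) {πhat : (Fin n → ℕ) → Prior}
    (hmax : IsNPMLE G πhat) {θ : ℝ≥0} (hθ : 0 < θ) (hG : pointPrior θ ∈ G) {π : Prior}
    (hπ : π ∈ G) : IsHellingerMin 1 π πhat := by
  intro X q hq hqX
  rw [ENNReal.ofReal_one, one_mul]
  obtain ⟨K, hX⟩ := exists_forall_le_nat X
  have hp := isMassFunction_empirical hn hX
  have hn0 : (0 : ℝ) < n := by exact_mod_cast Nat.pos_of_ne_zero hn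
  by_cases hpos : ∀ i, 0 < q (X i)
  · rw [hellingerSq_eq hn hX (isMassFunction_mixture _), chiSq_eq hn hX hq hpos]
    refine ENNReal.ofReal_le_ofReal ?_
    set p := empirical X with hpdef
    set b := mixture (πhat X) with hb
    have hb0 : ∀ i, 0 < b (X i) :=
      pos_of_prod_pos (fun i => mixture_nonneg _ _) (hmax.prod_pos hθ hG X)
    have hp0 : ∀ i, 0 < p (X i) := fun i => empirical_pos X i
    have e1 : ∑ x ∈ Finset.range (K + 1), √(p x) * √(b x)
        = 1 / n * ∑ i, √(b (X i) / p (X i)) := by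
      rw [← sum_empirical_mul hX fun x => √(b x / p x)]
      refine Finset.sum_congr rfl fun x _ => ?_
      rcases (hp.1 x).eq_or_lt with h | h
      · rw [← hpdef] at *; rw [← h]; simp
      · rw [Real.sqrt_div' _ h.le, ← hpdef]
        have hs : 0 < √(p x) := Real.sqrt_pos.2 h
        have := Real.mul_self_sqrt h.le
        field_simp
        rw [Real.sq_sqrt h.le]
        try ring
    have e2 : ∑ x ∈ Finset.range (K + 1), p x ^ 2 / q x = 1 / n * ∑ i, p (X i) / q (X i) := by
      rw [← sum_empirical_mul hX fun x => p x / q x]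
      refine Finset.sum_congr rfl fun x _ => ?_
      ring
    have hprod : ∏ i, q (X i) ≤ ∏ i, b (X i) := by
      have := isMaxOn_iff.1 (hmax X).2 π hπ
      simp_rw [hqX]; exact this
    have hlog : ∑ i, Real.log (q (X i)) ≤ ∑ i, Real.log (b (X i)) := by
      rw [← Real.log_prod fun i _ => (hpos i).ne', ← Real.log_prod fun i _ => (hb0 i).ne']
      exact Real.log_le_log (Finset.prod_pos fun i _ => hpos i) hprod
    have h1 : ∀ i, 2 - 2 * √(b (X i) / p (X i))
        ≤ Real.log (p (X i)) - Real.log (b (X i)) := by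
      intro i
      have hy : 0 < b (X i) / p (X i) := div_pos (hb0 i) (hp0 i)
      have h2 := Real.log_le_sub_one_of_pos (Real.sqrt_pos.2 hy)
      rw [Real.log_sqrt hy.le, Real.log_div (hb0 i).ne' (hp0 i).ne'] at h2
      linarith
    have h3 : ∀ i, Real.log (p (X i)) - Real.log (q (X i)) ≤ p (X i) / q (X i) - 1 := by
      intro i
      rw [← Real.log_div (hp0 i).ne' (hpos i).ne']
      exact Real.log_le_sub_one_of_pos (div_pos (hp0 i) (hpos i))
    have h4 : ∑ i, (2 - 2 * √(b (X i) / p (X i))) ≤ ∑ i, (p (X i) / q (X i) - 1) := by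
      have h5 := Finset.sum_le_sum fun i (_ : i ∈ Finset.univ) => h1 i
      have h6 := Finset.sum_le_sum fun i (_ : i ∈ Finset.univ) => h3 i
      rw [Finset.sum_sub_distrib] at h5 h6
      simp only [Finset.sum_sub_distrib] at h5 h6 ⊢
      linarith
    rw [e1, e2]
    simp only [Finset.sum_sub_distrib, ← Finset.mul_sum, Finset.sum_const, Finset.card_univ,
      Fintype.card_fin, nsmul_eq_mul, mul_one] at h4
    have h7 := mul_le_mul_of_nonneg_left h4 (show (0 : ℝ) ≤ 1 / n by positivity)
    have e3 : 1 / (n : ℝ) * (n * 2 - 2 * ∑ i, √(b (X i) / p (X i)))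
        = 2 - 2 * (1 / n * ∑ i, √(b (X i) / p (X i))) := by field_simp
    have e4 : 1 / (n : ℝ) * (∑ i, p (X i) / q (X i) - n)
        = 1 / n * ∑ i, p (X i) / q (X i) - 1 := by field_simp
    rw [e3, e4] at h7
    exact h7
  · push Not at hpos
    obtain ⟨i, hi⟩ := hpos
    have hi0 : q (X i) = 0 := le_antisymm hi (hq.1 _)
    have : chiSq (empirical X) q = ⊤ := by
      refine ENNReal.tsum_eq_top_of_eq_top ⟨X i, ?_⟩
      rw [hi0, ENNReal.ofReal_zero]
      refine ENNReal.div_zero ?_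
      have := empirical_pos X i
      simp; positivity
    rw [this]; exact le_top

/-- Probability measures on the compact interval [0, R] form a weakly compact space on which the
likelihood is continuous. The maps `r` and `Subtype.val` carry priors there and back. -/
lemma exists_isMaxOn_boundedPriors (R : ℝ≥0) {n : ℕ} (X : Fin n → ℕ) :
    ∃ π ∈ boundedPriors R, IsMaxOn (fun π => ∏ i, mixture π (X i)) (boundedPriors R) π := by
  let E : Set ℝ≥0 := Set.Iic R
  let r : ℝ≥0 → E := fun θ => ⟨min θ R, Set.mem_Iic.2 (min_le_right _ _)⟩
  have hr : Measurable r := by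
    refine Measurable.subtype_mk ?_
    fun_prop
  have hE : CompactSpace E := by
    have : E = Set.Icc 0 R := by ext θ; simp [E]
    rw [this]; exact isCompact_iff_compactSpace.1 isCompact_Icc
  have hcont : Continuous fun ν : ProbabilityMeasure E =>
      ∏ i, ∫ θ, pw (θ : ℝ≥0) (X i) ∂(ν : Measure E) := by
    refine continuous_finsetProd _ fun i _ => ?_
    let f : BoundedContinuousFunction E ℝ := BoundedContinuousFunction.mkOfCompact
      ⟨fun θ => pw (θ : ℝ≥0) (X i), (continuous_pw (X i)).comp continuous_subtype_val⟩
    have := (ProbabilityMeasure.continuous_iff_forall_continuous_integral (X := ProbabilityMeasure E)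
      (μs := id)).1 continuous_id f
    exact this
  have hne : (Set.univ : Set (ProbabilityMeasure E)).Nonempty :=
    ⟨(pointPrior 0).map (f := r) hr.aemeasurable, trivial⟩
  obtain ⟨ν, -, hν⟩ := isCompact_univ.exists_isMaxOn hne hcont.continuousOn
  have hval : Measurable (Subtype.val : E → ℝ≥0) := measurable_subtype_coe
  refine ⟨ν.map (f := Subtype.val) hval.aemeasurable, ?_, isMaxOn_iff.2 fun π hπ => ?_⟩
  · change ((ν.map (f := Subtype.val) hval.aemeasurable : Prior) : Measure ℝ≥0) _ = 1
    rw [ProbabilityMeasure.toMeasure_map, Measure.map_apply hval (measurableSet_le_param _)]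
    have : (Subtype.val : E → ℝ≥0) ⁻¹' {θ | (θ : ℝ) ≤ R} = Set.univ := by
      ext θ; simpa using Set.mem_Iic.1 θ.2
    rw [this]; simp
  · have h1 := isMaxOn_iff.1 hν (π.map (f := r) hr.aemeasurable) trivial
    have e1 : ∀ x, mixture (ν.map (f := Subtype.val) hval.aemeasurable) x
        = ∫ θ, pw (θ : ℝ≥0) x ∂(ν : Measure E) := by
      intro x
      rw [mixture_eq, ProbabilityMeasure.toMeasure_map,
        integral_map hval.aemeasurable (measurable_pw x).aestronglyMeasurable]
    have e2 : ∀ x, mixture π x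
        = ∫ θ, pw (θ : ℝ≥0) x ∂(π.map (f := r) hr.aemeasurable : Measure E) := by
      intro x
      rw [mixture_eq, ProbabilityMeasure.toMeasure_map,
        integral_map (f := fun θ : E => pw (θ : ℝ≥0) x) hr.aemeasurable
          ((measurable_pw x).comp hval).aestronglyMeasurable]
      refine integral_congr_ae ?_
      filter_upwards [ae_le_of_mem_boundedPriors hπ] with θ hθ
      have : min θ R = θ := min_eq_left (by exact_mod_cast hθ)
      simp [r, this]
    simp_rw [e1, e2]
    exact h1

lemma exists_isNPMLE_boundedPriors {h : ℝ} (hh : 0 ≤ h) (n : ℕ) :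
    ∃ πhat : (Fin n → ℕ) → Prior, IsNPMLE (boundedPriors h) πhat := by
  choose πhat h1 h2 using fun X : Fin n → ℕ => exists_isMaxOn_boundedPriors ⟨h, hh⟩ X
  exact ⟨πhat, fun X => ⟨h1 X, h2 X⟩⟩

/-- Capping at a bound for the observations never lowers the likelihood, so a maximizer on that
compact range is a global one. -/
lemma exists_isNPMLE_univ (n : ℕ) :
    ∃ πhat : (Fin n → ℕ) → Prior, IsNPMLE Set.univ πhat := by
  choose K hK using fun X : Fin n → ℕ => exists_forall_le_nat X
  choose πhat h1 h2 using fun X : Fin n → ℕ => exists_isMaxOn_boundedPriors (K X) X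
  refine ⟨πhat, fun X => ⟨trivial, isMaxOn_iff.2 fun π _ => ?_⟩⟩
  refine le_trans ?_ (isMaxOn_iff.1 (h2 X) _ (capPrior_mem π (K X)))
  refine Finset.prod_le_prod (fun i _ => mixture_nonneg _ _) fun i _ => ?_
  exact mixture_le_capPrior π (by have := hK X i; simpa using this)

/-! ### Upper bounds for the regret -/

/-- The total regret of a tame estimator, once both the prior and the data may be truncated. -/
theorem totalRegret_le_of_excess_le {k n : ℕ} {B : ℝ} (hB : 1 ≤ B) (hn : 2 ≤ n) {T : Estimator n}
    (hT : IsTame k B T) {π : Prior} {h : ℝ} {K : ℕ} {z : ℝ} (hz : 1 ≤ z)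
    (hπ : (n : ℝ≥0∞) ^ 10 * (π : Measure ℝ≥0) {θ | (θ : ℝ) ≤ h}ᶜ ≤ 2)
    (hzK : (n : ℝ) ^ 11 * Real.exp (h * (z - 1)) ≤ z ^ K) {C : ℝ} (hC : 0 ≤ C)
    (hmom : ∫⁻ y, ENNReal.ofReal (pairSize k y ^ 2) ∂(jointLaw π) ≤ ENNReal.ofReal C)
    {A : ℝ} (hA : 0 ≤ A)
    (hex : ∀ π' ∈ boundedPriors h,
      (n : ℝ≥0∞) * ∑' x, (if K < x then 1 else 0) * ENNReal.ofReal (mixture π' x) ≤ 1 →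
      excess k T π' {X | ∀ i, X i ≤ K} ≤ ENNReal.ofReal A) :
    totalRegret (fun θ => (θ : ℝ) ^ k) T π ≤ ENNReal.ofReal (A + (6 * B + 2 * B * C)) := by
  have hn0 : n ≠ 0 := by omega
  have hn1 : (1 : ℝ) ≤ n := by exact_mod_cast (by omega : 1 ≤ n)
  -- Conditioning is possible: if θ > h held almost surely, `hπ` would read n^10 ≤ 2.
  have hw : (π : Measure ℝ≥0) {θ | (θ : ℝ) ≤ h} ≠ 0 := by
    intro h0
    rw [prob_compl_eq_one_sub (measurableSet_le_param h), h0, tsub_zero, mul_one] at hπ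
    have : n ^ 10 ≤ 2 := by exact_mod_cast hπ
    have h2 : 2 ^ 10 ≤ n ^ 10 := Nat.pow_le_pow_left hn 10
    norm_num at h2
    omega
  have hzK0 : 0 < z ^ K := by positivity
  have hq : Real.exp (h * (z - 1)) / z ^ K ≤ 1 / (n : ℝ) ^ 11 := by
    rw [div_le_div_iff₀ hzK0 (by positivity)]; linarith
  have htail : ∀ m : ℕ, m ≤ 11 → (n : ℝ≥0∞) ^ m
      * ENNReal.ofReal (Real.exp (h * (z - 1)) / z ^ K) ≤ 1 := by
    intro m hm
    rw [← ENNReal.ofReal_natCast, ← ENNReal.ofReal_pow (by positivity),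
      ← ENNReal.ofReal_mul (by positivity), ENNReal.ofReal_le_one]
    calc (n : ℝ) ^ m * (Real.exp (h * (z - 1)) / z ^ K)
        ≤ (n : ℝ) ^ 11 * (1 / (n : ℝ) ^ 11) := by gcongr
      _ = 1 := by field_simp
  have hc := condPrior_mem hw
  have h1 := hex _ hc (by
    refine le_trans ?_ (htail 1 (by norm_num))
    rw [pow_one]
    refine mul_le_mul' le_rfl ?_
    exact tsum_tail_mixture_le hc hz K)
  refine (totalRegret_le_excess_add hw k hn0 K T).trans ?_
  rw [ENNReal.ofReal_add hA (by positivity), ENNReal.ofReal_add (by positivity) (by positivity)]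
  refine add_le_add h1 ((setLIntegral_compl_goodEvent_le hB hn0 hT π h K).trans
    (add_le_add ?_ ?_))
  · have e : ENNReal.ofReal (2 * B * (n : ℝ) ^ 10) = ENNReal.ofReal (2 * B) * (n : ℝ≥0∞) ^ 10 := by
      rw [ENNReal.ofReal_mul (by positivity), ENNReal.ofReal_pow (by positivity),
        ENNReal.ofReal_natCast]
    rw [e, mul_assoc, show 6 * B = 2 * B * 3 by ring, ENNReal.ofReal_mul (p := 2 * B) (by positivity)]
    refine mul_le_mul' le_rfl ?_
    calc (n : ℝ≥0∞) ^ 10 * jointLaw π (badSet h K)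
        ≤ (n : ℝ≥0∞) ^ 10 * ((π : Measure ℝ≥0) {θ | (θ : ℝ) ≤ h}ᶜ
          + ENNReal.ofReal (Real.exp (h * (z - 1)) / z ^ K)) := by
          gcongr; exact jointLaw_badSet_le π h hz K
      _ ≤ 2 + 1 := by rw [mul_add]; exact add_le_add hπ (htail 10 (by norm_num))
      _ = ENNReal.ofReal 3 := by norm_num
  · rw [ENNReal.ofReal_mul (p := 2 * B) (by positivity)]
    exact mul_le_mul' le_rfl hmom

lemma one_lt_log_of_sixteen_le {n : ℕ} (hn : 16 ≤ n) : 1 < Real.log n := by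
  rw [Real.lt_log_iff_exp_lt (by exact_mod_cast (by omega : 0 < n))]
  have : (16 : ℝ) ≤ n := by exact_mod_cast hn
  linarith [Real.exp_one_lt_d9]

lemma one_le_log_div_log_log {n : ℕ} (hn : 16 ≤ n) :
    1 ≤ Real.log n / Real.log (Real.log n) := by
  have h1 := one_lt_log_of_sixteen_le hn
  rw [le_div_iff₀ (Real.log_pos h1)]
  linarith [Real.log_le_sub_one_of_pos (by linarith : 0 < Real.log n)]

/-- Priors on `[0, h]`: it suffices to bound the excess on samples that are bounded by `K`. -/
theorem exists_worstRegret_boundedPriors_le (k : ℕ) {h : ℝ} (hh : 0 < h) {B : ℝ} (hB : 1 ≤ B)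
    {c : ℝ} (hc : 0 ≤ c) :
    ∃ C : ℝ, 0 < C ∧ ∀ n : ℕ, 16 ≤ n → ∀ T : Estimator n, IsTame k B T →
      (∀ K : ℕ, ∀ π ∈ boundedPriors h,
        (n : ℝ≥0∞) * ∑' x, (if K < x then 1 else 0) * ENNReal.ofReal (mixture π x) ≤ 1 →
        excess k T π {X | ∀ i, X i ≤ K} ≤ ENNReal.ofReal (c * regretSize k K (h ^ k))) →
      worstRegret k (boundedPriors h) T ≤ ENNReal.ofReal (C * boundedRate k n) := by
  obtain ⟨C₁, hC₁, hmom⟩ := exists_tsum_pairSize_le k one_pos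
  set C₂ := C₁ * Real.exp h
  have hC₂ : 0 ≤ C₂ := by positivity
  set D := (h + 13) * ((h + 12 + k) ^ k * h ^ k + (h ^ k) ^ 2)
  refine ⟨c * D + (6 * B + 2 * B * C₂), by positivity, fun n hn T hT hex => ?_⟩
  refine iSup₂_le fun π hπ => ?_
  set z := Real.log n with hzdef
  have hz : 1 < z := one_lt_log_of_sixteen_le hn
  set L := z / Real.log z with hL
  have hL1 : 1 ≤ L := one_le_log_div_log_log hn
  have hlz : 0 < Real.log z := Real.log_pos hz
  -- With z = log n and L = log n / log log n one gets z^K ≥ n^(h + 11), which beats n^11 e^{h(z -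
  -- 1)}.
  set K := ⌈(h + 11) * L⌉₊
  have hK1 : (h + 11) * L ≤ K := Nat.le_ceil _
  have hK2 : (K : ℝ) ≤ (h + 11) * L + 1 := (Nat.ceil_lt_add_one (by positivity)).le
  have hn0 : (0 : ℝ) < n := by exact_mod_cast (by omega : 0 < n)
  have hcompl : (π : Measure ℝ≥0) {θ | (θ : ℝ) ≤ h}ᶜ = 0 :=
    (prob_compl_eq_zero_iff (measurableSet_le_param h)).2 hπ
  have hzK : (n : ℝ) ^ 11 * Real.exp (h * (z - 1)) ≤ z ^ K := by
    rw [← Real.exp_log hn0, ← hzdef, ← Real.exp_nat_mul, ← Real.exp_add,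
      ← Real.exp_log (by positivity : 0 < z ^ K), Real.log_pow]
    refine Real.exp_le_exp.2 ?_
    have : (h + 11) * L * Real.log z ≤ K * Real.log z := by gcongr
    have e : (h + 11) * L * Real.log z = (h + 11) * z := by rw [hL]; field_simp
    push_cast
    nlinarith
  have hmom' : ∫⁻ y, ENNReal.ofReal (pairSize k y ^ 2) ∂(jointLaw π) ≤ ENNReal.ofReal C₂ := by
    refine (lintegral_pairSize_le hC₁ hmom π).trans ?_
    rw [ENNReal.ofReal_mul hC₁]
    gcongr
    calc ∫⁻ θ : ℝ≥0, ENNReal.ofReal (Real.exp (1 * θ)) ∂(π : Measure ℝ≥0)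
        ≤ ∫⁻ _ : ℝ≥0, ENNReal.ofReal (Real.exp h) ∂(π : Measure ℝ≥0) := by
          refine lintegral_mono_ae ?_
          filter_upwards [ae_le_of_mem_boundedPriors hπ] with θ hθ
          gcongr; linarith
      _ = ENNReal.ofReal (Real.exp h) := by simp
  have hreg0 : 0 ≤ regretSize k K (h ^ k) := by unfold regretSize; positivity
  refine (totalRegret_le_of_excess_le hB (by omega) hT hz.le (by rw [hcompl]; simp) hzK hC₂ hmom'
    (mul_nonneg hc hreg0) fun π' hπ' ht => hex K π' hπ' ht).trans (ENNReal.ofReal_le_ofReal ?_)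
  have hLk : 1 ≤ L ^ k := one_le_pow₀ hL1
  have hLk1 : 1 ≤ L ^ (k + 1) := one_le_pow₀ hL1
  have hreg : regretSize k K (h ^ k) ≤ D * L ^ (k + 1) := by
    unfold regretSize
    calc ((K : ℝ) + 1) * (((K : ℝ) + k) ^ k * h ^ k + (h ^ k) ^ 2)
        ≤ ((h + 13) * L) * (((h + 12 + k) * L) ^ k * h ^ k + (h ^ k) ^ 2 * L ^ k) := by
          gcongr
          · nlinarith
          · nlinarith [Nat.cast_nonneg (α := ℝ) k]
          · exact le_mul_of_one_le_right (by positivity) hLk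
      _ = D * L ^ (k + 1) := by rw [mul_pow]; ring
  have hconst : 6 * B + 2 * B * C₂ ≤ (6 * B + 2 * B * C₂) * L ^ (k + 1) :=
    le_mul_of_one_le_right (by positivity) hLk1
  change _ ≤ _ * L ^ (k + 1)
  nlinarith [mul_le_mul_of_nonneg_left hreg hc]

/-- Subexponential priors: it suffices to bound the excess on samples that are bounded by `K`. -/
theorem exists_worstRegret_subexpPriors_le (k : ℕ) {s : ℝ} (hs : 0 < s) {c : ℝ} (hc : 0 ≤ c) :
    ∃ C : ℝ, 0 < C ∧ ∀ n : ℕ, 16 ≤ n → ∀ T : Estimator n, IsTame k 1 T →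
      (∀ (K : ℕ) (h : ℝ), h ≤ K → ∀ π ∈ boundedPriors h,
        (n : ℝ≥0∞) * ∑' x, (if K < x then 1 else 0) * ENNReal.ofReal (mixture π x) ≤ 1 →
        excess k T π {X | ∀ i, X i ≤ K} ≤ ENNReal.ofReal (c * regretSize k K ((K : ℝ) ^ k))) →
      worstRegret k (subexpPriors s) T ≤ ENNReal.ofReal (C * subexpRate k n) := by
  obtain ⟨C₁, hC₁, hmom⟩ := exists_tsum_pairSize_le k (by positivity : 0 < 1 / (2 * s))
  obtain ⟨C₃, hC₃, hexp⟩ := exists_lintegral_exp_le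
  set C₂ := C₁ * C₃
  have hC₂ : 0 ≤ C₂ := by positivity
  set D := (22 * s + 13) * ((22 * s + 12 + k) ^ k * (22 * s + 12) ^ k + ((22 * s + 12) ^ k) ^ 2)
  refine ⟨c * D + (6 * 1 + 2 * 1 * C₂), by positivity, fun n hn T hT hex => ?_⟩
  refine iSup₂_le fun π hπ => ?_
  set z := Real.log n with hzdef
  have hz : 1 < z := one_lt_log_of_sixteen_le hn
  -- Makes the tail of the prior at most 2 n^(-11). Then K ≥ (22s + 11) log n = 2h + 11 log n
  -- suffices for Chernoff's bound with base e, as e - 1 ≤ 2.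
  set h := 11 * s * z with hh
  set K := ⌈(22 * s + 11) * z⌉₊
  have hK1 : (22 * s + 11) * z ≤ K := Nat.le_ceil _
  have hK2 : (K : ℝ) ≤ (22 * s + 11) * z + 1 := (Nat.ceil_lt_add_one (by positivity)).le
  have hK3 : (K : ℝ) ≤ (22 * s + 12) * z := by linarith
  have hhK : h ≤ K := by nlinarith [mul_pos hs (by linarith : 0 < z)]
  have hn0 : (0 : ℝ) < n := by exact_mod_cast (by omega : 0 < n)
  have hn1 : (1 : ℝ) ≤ n := by exact_mod_cast (by omega : 1 ≤ n)
  have hcompl : (n : ℝ≥0∞) ^ 10 * (π : Measure ℝ≥0) {θ | (θ : ℝ) ≤ h}ᶜ ≤ 2 := by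
    have h1 : (π : Measure ℝ≥0) {θ | (θ : ℝ) ≤ h}ᶜ
        ≤ ENNReal.ofReal (2 * Real.exp (-h / s)) := by
      refine (measure_mono fun θ hθ => ?_).trans (hπ h (by positivity))
      have : h < (θ : ℝ) := by simpa using hθ
      exact this.le
    have h2 : Real.exp (-h / s) = 1 / (n : ℝ) ^ 11 := by
      have e : -h / s = -(((11 : ℕ) : ℝ) * z) := by rw [hh]; push_cast; field_simp
      rw [e, Real.exp_neg, Real.exp_nat_mul, hzdef, Real.exp_log hn0, one_div]
    calc (n : ℝ≥0∞) ^ 10 * (π : Measure ℝ≥0) {θ | (θ : ℝ) ≤ h}ᶜ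
        ≤ (n : ℝ≥0∞) ^ 10 * ENNReal.ofReal (2 * (1 / (n : ℝ) ^ 11)) := by
          gcongr; rw [← h2]; exact h1
      _ = ENNReal.ofReal ((n : ℝ) ^ 10 * (2 * (1 / (n : ℝ) ^ 11))) := by
          rw [ENNReal.ofReal_mul (p := (n : ℝ) ^ 10) (by positivity), ENNReal.ofReal_pow hn0.le,
            ENNReal.ofReal_natCast]
      _ ≤ ENNReal.ofReal 2 := by
          refine ENNReal.ofReal_le_ofReal ?_
          have : (n : ℝ) ^ 10 * (2 * (1 / (n : ℝ) ^ 11)) = 2 / n := by field_simp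
          rw [this, div_le_iff₀ hn0]; linarith
      _ = 2 := by norm_num
  have hzK : (n : ℝ) ^ 11 * Real.exp (h * (Real.exp 1 - 1)) ≤ Real.exp 1 ^ K := by
    have e : (n : ℝ) ^ 11 = Real.exp (11 * z) := by
      rw [show (11 : ℝ) * z = ((11 : ℕ) : ℝ) * z by norm_num, Real.exp_nat_mul, hzdef,
        Real.exp_log hn0]
    rw [e, ← Real.exp_add, ← Real.exp_nat_mul, mul_one]
    refine Real.exp_le_exp.2 ?_
    have h1 : h * (Real.exp 1 - 1) ≤ h * 2 := by
      gcongr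
      linarith [Real.exp_one_lt_d9]
    nlinarith
  have hmom' : ∫⁻ y, ENNReal.ofReal (pairSize k y ^ 2) ∂(jointLaw π) ≤ ENNReal.ofReal C₂ := by
    refine (lintegral_pairSize_le hC₁ hmom π).trans ?_
    rw [ENNReal.ofReal_mul hC₁]
    gcongr
    exact hexp s hs π hπ
  have hreg0 : 0 ≤ regretSize k K ((K : ℝ) ^ k) := by unfold regretSize; positivity
  refine (totalRegret_le_of_excess_le le_rfl (by omega) hT (Real.one_le_exp zero_le_one) hcompl hzK
    hC₂ hmom' (mul_nonneg hc hreg0) fun π' hπ' ht => hex K h hhK π' hπ' ht).trans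
    (ENNReal.ofReal_le_ofReal ?_)
  have hz1 : 1 ≤ z ^ (2 * k + 1) := one_le_pow₀ hz.le
  have hreg : regretSize k K ((K : ℝ) ^ k) ≤ D * z ^ (2 * k + 1) := by
    unfold regretSize
    calc ((K : ℝ) + 1) * (((K : ℝ) + k) ^ k * (K : ℝ) ^ k + ((K : ℝ) ^ k) ^ 2)
        ≤ ((22 * s + 13) * z) * (((22 * s + 12 + k) * z) ^ k * ((22 * s + 12) * z) ^ k
          + (((22 * s + 12) * z) ^ k) ^ 2) := by
          gcongr
          · nlinarith
          · nlinarith [Nat.cast_nonneg (α := ℝ) k]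
      _ = D * z ^ (2 * k + 1) := by rw [mul_pow, mul_pow]; ring
  have hconst : 6 * 1 + 2 * 1 * C₂ ≤ (6 * 1 + 2 * 1 * C₂) * z ^ (2 * k + 1) :=
    le_mul_of_one_le_right (by positivity) hz1
  change _ ≤ _ * z ^ (2 * k + 1)
  nlinarith [mul_le_mul_of_nonneg_left hreg hc]

/-! #### Priors on `[0, h]` -/

theorem exists_worstRegret_robbins_boundedPriors_le {k : ℕ} (hk : 1 ≤ k) {h : ℝ} (hh : 0 < h) :
    ∃ C : ℝ, 0 < C ∧ ∀ n : ℕ, 16 ≤ n →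
      worstRegret k (boundedPriors h) (robbins k n) ≤ ENNReal.ofReal (C * boundedRate k n) := by
  obtain ⟨C, hC, H⟩ := exists_worstRegret_boundedPriors_le k hh le_rfl (by norm_num : (0 : ℝ) ≤ 20)
  exact ⟨C, hC, fun n hn => H n hn _ (isTame_robbins k n) fun K π hπ _ =>
    excess_robbins_le hk hπ (by omega) le_rfl K⟩

lemma isTame_plugIn_boundedPriors {k n : ℕ} (hk : 1 ≤ k) (hn : n ≠ 0) {h : ℝ}
    {πhat : (Fin n → ℕ) → Prior} (hG : ∀ X, πhat X ∈ boundedPriors h) :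
    IsTame k (max 1 ((h ^ k) ^ 2)) (plugIn k πhat) :=
  isTame_of_le hk hn (le_max_left _ _) (le_max_right _ _) fun X _ =>
    ⟨bayes_nonneg k _ _, bayes_le (hG X) _⟩

theorem exists_worstRegret_plugIn_boundedPriors_le {k : ℕ} (hk : 1 ≤ k) {h : ℝ} (hh : 0 < h)
    {R : ℝ} (hR : 0 ≤ R) :
    ∃ C : ℝ, 0 < C ∧ ∀ n : ℕ, 16 ≤ n → ∀ πhat : (Fin n → ℕ) → Prior,
      (∀ X, πhat X ∈ boundedPriors h) → (∀ π ∈ boundedPriors h, IsHellingerMin R π πhat) →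
      worstRegret k (boundedPriors h) (plugIn k πhat) ≤ ENNReal.ofReal (C * boundedRate k n) := by
  obtain ⟨C, hC, H⟩ := exists_worstRegret_boundedPriors_le k hh (le_max_left 1 ((h ^ k) ^ 2))
    (by positivity : 0 ≤ 68 * (R + 1))
  refine ⟨C, hC, fun n hn πhat hG hmin => ?_⟩
  have hn0 : n ≠ 0 := by omega
  exact H n hn _ (isTame_plugIn_boundedPriors hk hn0 hG) fun K π hπ ht =>
    excess_plugIn_le hR hπ hn0 le_rfl (hmin π hπ) (fun X _ x => bayes_le (hG X) x) ht

theorem exists_worstRegret_erm_boundedPriors_le {k : ℕ} (hk : 1 ≤ k) {h : ℝ} (hh : 0 < h) :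
    ∃ C : ℝ, 0 < C ∧ ∀ n : ℕ, 16 ≤ n → ∀ T : Estimator n,
      IsERM k (clippedMonotoneClass (h ^ k)) T →
      worstRegret k (boundedPriors h) T ≤ ENNReal.ofReal (C * boundedRate k n) := by
  obtain ⟨C, hC, H⟩ := exists_worstRegret_boundedPriors_le k hh (le_max_left 1 ((h ^ k) ^ 2))
    (by norm_num : (0 : ℝ) ≤ 20)
  refine ⟨C, hC, fun n hn T hT => ?_⟩
  have hn0 : n ≠ 0 := by omega
  refine H n hn _ (isTame_of_le hk hn0 (le_max_left _ _) (le_max_right _ _) fun X j => ?_)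
    fun K π hπ _ => excess_erm_le hk hπ (by omega) le_rfl K fun X _ => ?_
  · obtain ⟨t, ht, -, hTX⟩ := hT X
    rw [hTX]; exact ht.2 _
  · obtain ⟨t, ht, hmin, hTX⟩ := hT X
    exact ⟨t, ht.1, fun i => (ht.2 _).2, isMinOn_iff.1 hmin _
      ⟨bayes_monotone hk π, fun x => ⟨bayes_nonneg k π x, bayes_le hπ x⟩⟩, hTX⟩

/-! #### Subexponential priors -/

theorem exists_worstRegret_robbins_subexpPriors_le {k : ℕ} (hk : 1 ≤ k) {s : ℝ} (hs : 0 < s) :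
    ∃ C : ℝ, 0 < C ∧ ∀ n : ℕ, 16 ≤ n →
      worstRegret k (subexpPriors s) (robbins k n) ≤ ENNReal.ofReal (C * subexpRate k n) := by
  obtain ⟨C, hC, H⟩ := exists_worstRegret_subexpPriors_le k hs (by norm_num : (0 : ℝ) ≤ 20)
  exact ⟨C, hC, fun n hn => H n hn _ (isTame_robbins k n) fun K h hK π hπ _ =>
    excess_robbins_le hk hπ (by omega)
      (pow_le_pow_left₀ (nonneg_of_mem_boundedPriors hπ) hK k) K⟩

theorem exists_worstRegret_plugIn_subexpPriors_le (k : ℕ) {s : ℝ} (hs : 0 < s)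
    {R : ℝ} (hR : 0 ≤ R) :
    ∃ C : ℝ, 0 < C ∧ ∀ n : ℕ, 16 ≤ n → ∀ πhat : (Fin n → ℕ) → Prior,
      (∀ (X : Fin n → ℕ) (K : ℕ), (∀ i, X i ≤ K) → πhat X ∈ boundedPriors K) →
      (∀ π, IsHellingerMin R π πhat) →
      worstRegret k (subexpPriors s) (plugIn k πhat) ≤ ENNReal.ofReal (C * subexpRate k n) := by
  obtain ⟨C, hC, H⟩ := exists_worstRegret_subexpPriors_le k hs (by positivity : 0 ≤ 68 * (R + 1))
  refine ⟨C, hC, fun n hn πhat hG hmin => ?_⟩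
  have hn0 : n ≠ 0 := by omega
  refine H n hn _ (isTame_of_le_pow hn0 le_rfl fun X j => ?_) fun K h hK π hπ ht =>
    excess_plugIn_le hR hπ hn0 (pow_le_pow_left₀ (nonneg_of_mem_boundedPriors hπ) hK k)
      (hmin π) (fun X hX x => bayes_le (hG X K hX) x) ht
  obtain ⟨i, hi⟩ := exists_forall_le hn0 X
  exact ⟨bayes_nonneg k _ _, i, bayes_le (hG X _ hi) _⟩

theorem exists_worstRegret_erm_subexpPriors_le {k : ℕ} (hk : 1 ≤ k) {s : ℝ} (hs : 0 < s) :
    -- Although the class is unbounded, a minimizer is at most the largest response, hence at most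
    -- K^k, at the data.
    ∃ C : ℝ, 0 < C ∧ ∀ n : ℕ, 16 ≤ n → ∀ T : Estimator n, IsERM k monotoneClass T →
      worstRegret k (subexpPriors s) T ≤ ENNReal.ofReal (C * subexpRate k n) := by
  obtain ⟨C, hC, H⟩ := exists_worstRegret_subexpPriors_le k hs (by norm_num : (0 : ℝ) ≤ 20)
  refine ⟨C, hC, fun n hn T hT => ?_⟩
  have hn0 : n ≠ 0 := by omega
  refine H n hn _ (isTame_of_le_pow hn0 le_rfl fun X j => ?_) fun K h hK π hπ _ =>
    excess_erm_le hk hπ (by omega) (pow_le_pow_left₀ (nonneg_of_mem_boundedPriors hπ) hK k) K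
      fun X hX => ?_
  · obtain ⟨t, ht, hmin, hTX⟩ := hT X
    obtain ⟨i, hi⟩ := exists_forall_le hn0 X
    rw [hTX]
    exact ⟨ht.2 _, i, le_of_isMinOn_monotoneClass (fun i' => descFactorial_le_pow_cast (hi i'))
      (by positivity) ht hmin j⟩
  · obtain ⟨t, ht, hmin, hTX⟩ := hT X
    exact ⟨t, ht.1, fun i => le_of_isMinOn_monotoneClass
      (fun i' => descFactorial_le_pow_cast (hX i')) (by positivity) ht hmin i,
      isMinOn_iff.1 hmin _ ⟨bayes_monotone hk π, bayes_nonneg k π⟩, hTX⟩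

/-! ### Lower bounds from a hypercube of priors -/

/-- The part of the excess risk that comes from the observations with value `x`. -/
def localExcess (k : ℕ) {n : ℕ} (T : Estimator n) (π : Prior) (x : ℕ) : ℝ≥0∞ :=
  ∫⁻ X, ∑ j, (if X j = x then ENNReal.ofReal ((T X j - bayes k π x) ^ 2) else 0) ∂(dataLaw π n)

lemma sum_localExcess_le (k : ℕ) {n : ℕ} (T : Estimator n) (π : Prior) (S : Finset ℕ) :
    ∑ x ∈ S, localExcess k T π x ≤ excess k T π Set.univ := by
  unfold localExcess excess
  rw [setLIntegral_univ, ← lintegral_finsetSum _ fun x _ => Measurable.of_discrete]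
  refine lintegral_mono fun X => ?_
  rw [Finset.sum_comm]
  refine Finset.sum_le_sum fun j _ => ?_
  rw [Finset.sum_ite_eq]
  split_ifs <;> simp

/-- Assouad's argument: the worst regret dominates the average over the cube of subsets of S, and in
the sum for x the vertices are paired as U and U ∪ {x}. Localizing the excess at the values x makes
the contributions additive. -/
theorem card_mul_le_minimaxRegret {k n : ℕ} {G : Set Prior} {S : Finset ℕ}
    {pri : Finset ℕ → Prior} {h : ℝ} (hG : ∀ U ⊆ S, pri U ∈ G)
    (hpri : ∀ U ⊆ S, pri U ∈ boundedPriors h) {b : ℝ≥0∞}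
    (hb : ∀ (T : Estimator n), ∀ x ∈ S, ∀ U ⊆ S.erase x,
      2 * b ≤ localExcess k T (pri U) x + localExcess k T (pri (insert x U)) x) :
    S.card * b ≤ minimaxRegret k n G := by
  refine le_iInf fun T => ?_
  have h1 : ∀ U ∈ S.powerset, ∑ x ∈ S, localExcess k T (pri U) x ≤ worstRegret k G T := by
    intro U hU
    have hU' := Finset.mem_powerset.1 hU
    refine (sum_localExcess_le k T _ S).trans ?_
    rw [← totalRegret_eq_excess k T (hpri U hU')]
    exact le_iSup₂ (f := fun π (_ : π ∈ G) => totalRegret (fun θ => (θ : ℝ) ^ k) T π) _ (hG U hU')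
  have h2 : ∀ x ∈ S, (2 ^ S.card : ℝ≥0∞) * b ≤ ∑ U ∈ S.powerset, localExcess k T (pri U) x := by
    intro x hx
    rw [← Finset.insert_erase hx, Finset.sum_powerset_insert (Finset.notMem_erase x S),
      ← Finset.sum_add_distrib, Finset.insert_erase hx]
    have := Finset.card_nsmul_le_sum (S.erase x).powerset
      (fun U => localExcess k T (pri U) x + localExcess k T (pri (insert x U)) x) (2 * b)
      fun U hU => hb T x hx U (Finset.mem_powerset.1 hU)
    refine le_trans (le_of_eq ?_) this
    rw [Finset.card_powerset, nsmul_eq_mul, ← mul_assoc, ← Finset.card_erase_add_one hx, pow_succ]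
    push_cast
    rfl
  have h3 := Finset.sum_le_card_nsmul _ _ _ h1
  rw [Finset.sum_comm, Finset.card_powerset, nsmul_eq_mul] at h3
  have h4 := (Finset.card_nsmul_le_sum _ _ _ h2).trans h3
  rw [nsmul_eq_mul, mul_left_comm] at h4
  push_cast at h4
  exact (ENNReal.mul_le_mul_iff_right (by simp) (by simp)).1 h4

/-! ### Two priors that are hard to distinguish -/

lemma pi_setOf_eval_eq (μ : Measure ℕ) [IsFiniteMeasure μ] {n : ℕ} (j : Fin n) (x : ℕ) :
    Measure.pi (fun _ : Fin n => μ) {X | X j = x} = μ {x} * μ Set.univ ^ (n - 1) := by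
  have : {X : Fin n → ℕ | X j = x}
      = Set.univ.pi fun i => if i = j then {x} else Set.univ := by
    ext X
    simp only [Set.mem_ofPred_eq, Set.mem_pi, Set.mem_univ, true_implies]
    refine ⟨fun h i => ?_, fun h => ?_⟩
    · split_ifs with hi
      · subst hi; exact h
      · trivial
    · simpa using h j
  rw [this, Measure.pi_pi, ← Finset.mul_prod_erase _ _ (Finset.mem_univ j), if_pos rfl]
  congr 1
  rw [Finset.prod_congr rfl (g := fun _ => μ Set.univ) fun i hi => by
    rw [if_neg (Finset.ne_of_mem_erase hi)]]
  simp

lemma tsum_ite_measure_singleton {α : Type*} [MeasurableSpace α] [Countable α]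
    [MeasurableSingletonClass α] (μ : Measure α) (s : Set α) [DecidablePred (· ∈ s)] :
    ∑' a, (if a ∈ s then μ {a} else 0) = μ s := by
  rw [← lintegral_indicator_one (Set.to_countable s).measurableSet, lintegral_countable']
  refine tsum_congr fun a => ?_
  by_cases h : a ∈ s <;> simp [h]

/-- A linearized bound on √(min · max). It passes from the affinity to the overlap term by term, and
the small coefficient 1/8 leaves room in the final subtraction. -/
lemma sqrt_mul_le_two_mul_min_add {a b : ℝ} (ha : 0 ≤ a) (hb : 0 ≤ b) :
    √(a * b) ≤ 2 * min a b + (a + b) / 8 := by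
  refine Real.sqrt_le_iff.2 ⟨by positivity, ?_⟩
  rcases le_total a b with h | h
  · rw [min_eq_left h]; nlinarith [sq_nonneg (2 * a - b / 8)]
  · rw [min_eq_right h]; nlinarith [sq_nonneg (2 * b - a / 8)]

/-- The affinity measure of two mixtures. -/
def affinityMeasure (π π' : Prior) : Measure ℕ :=
  Measure.count.withDensity fun x => ENNReal.ofReal (√(mixture π x * mixture π' x))

lemma affinityMeasure_singleton (π π' : Prior) (x : ℕ) :
    affinityMeasure π π' {x} = ENNReal.ofReal (√(mixture π x * mixture π' x)) := by
  rw [affinityMeasure, withDensity_apply _ (measurableSet_singleton x), Measure.restrict_singleton]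
  simp

lemma sqrt_mul_mixture_le (π π' : Prior) (x : ℕ) :
    √(mixture π x * mixture π' x) ≤ (mixture π x + mixture π' x) / 2 := by
  have h1 := mixture_nonneg π x
  have h2 := mixture_nonneg π' x
  refine Real.sqrt_le_iff.2 ⟨by positivity, ?_⟩
  nlinarith [sq_nonneg (mixture π x - mixture π' x)]

lemma summable_sqrt_mul_mixture (π π' : Prior) :
    Summable fun x => √(mixture π x * mixture π' x) :=
  Summable.of_nonneg_of_le (fun _ => Real.sqrt_nonneg _) (sqrt_mul_mixture_le π π')
    (((hasSum_mixture π).summable.add (hasSum_mixture π').summable).div_const 2)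

lemma affinityMeasure_univ (π π' : Prior) :
    affinityMeasure π π' Set.univ = ENNReal.ofReal (∑' x, √(mixture π x * mixture π' x)) := by
  rw [affinityMeasure, withDensity_apply _ MeasurableSet.univ, setLIntegral_univ, lintegral_count,
    ENNReal.ofReal_tsum_of_nonneg (fun x => Real.sqrt_nonneg _) (summable_sqrt_mul_mixture π π')]

instance (π π' : Prior) : IsFiniteMeasure (affinityMeasure π π') :=
  ⟨by rw [affinityMeasure_univ]; exact ENNReal.ofReal_lt_top⟩

lemma pi_affinityMeasure_singleton_le (π π' : Prior) {n : ℕ} (X : Fin n → ℕ) :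
    Measure.pi (fun _ : Fin n => affinityMeasure π π') {X}
      ≤ 2 * min (dataLaw π n {X}) (dataLaw π' n {X})
        + ENNReal.ofReal (1 / 8) * (dataLaw π n {X} + dataLaw π' n {X}) := by
  have h1 : ∀ i, 0 ≤ mixture π (X i) := fun i => mixture_nonneg _ _
  have h2 : ∀ i, 0 ≤ mixture π' (X i) := fun i => mixture_nonneg _ _
  have hp : 0 ≤ ∏ i, mixture π (X i) := Finset.prod_nonneg fun i _ => h1 i
  have hq : 0 ≤ ∏ i, mixture π' (X i) := Finset.prod_nonneg fun i _ => h2 i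
  have e : ∏ i, √(mixture π (X i) * mixture π' (X i))
      = √((∏ i, mixture π (X i)) * ∏ i, mixture π' (X i)) := by
    rw [← Finset.prod_mul_distrib, Real.sqrt_prod _ fun i _ => mul_nonneg (h1 i) (h2 i)]
  rw [Measure.pi_singleton]
  simp_rw [affinityMeasure_singleton]
  rw [← ENNReal.ofReal_prod_of_nonneg fun i _ => Real.sqrt_nonneg _, e, dataLaw_singleton,
    dataLaw_singleton, ← ENNReal.ofReal_prod_of_nonneg fun i _ => h1 i,
    ← ENNReal.ofReal_prod_of_nonneg fun i _ => h2 i, ← ENNReal.ofReal_min,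
    ← ENNReal.ofReal_add hp hq, ← ENNReal.ofReal_mul (by norm_num),
    show (2 : ℝ≥0∞) = ENNReal.ofReal 2 by norm_num, ← ENNReal.ofReal_mul (by norm_num),
    ← ENNReal.ofReal_add (by positivity) (by positivity)]
  refine ENNReal.ofReal_le_ofReal ((sqrt_mul_le_two_mul_min_add hp hq).trans (le_of_eq ?_))
  ring

lemma obsLaw_univ (π : Prior) : obsLaw π Set.univ = 1 := measure_univ

/-- Write a = f(x) and M for the overlap on {X_j = x}. The product affinity of this event is a times
the (n - 1)-st power of the affinity, because both mixtures equal a at x. Hence 3a/4 ≤ 2M + a/4. -/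
lemma ofReal_le_tsum_min {π π' : Prior} {x : ℕ} (hx : mixture π' x = mixture π x) {n : ℕ}
    (haff : 3 / 4 ≤ (∑' i, √(mixture π i * mixture π' i)) ^ (n - 1)) (j : Fin n) :
    ENNReal.ofReal (mixture π x / 4)
      ≤ ∑' X : Fin n → ℕ, if X j = x then min (dataLaw π n {X}) (dataLaw π' n {X}) else 0 := by
  set M := ∑' X : Fin n → ℕ, if X j = x then min (dataLaw π n {X}) (dataLaw π' n {X}) else 0
  set a := mixture π x with ha
  have ha0 : 0 ≤ a := mixture_nonneg _ _
  have hP : ∀ ρ : Prior, ∑' X : Fin n → ℕ, (if X j = x then dataLaw ρ n {X} else 0)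
      = ENNReal.ofReal (mixture ρ x) := by
    intro ρ
    have := tsum_ite_measure_singleton (dataLaw ρ n) {X | X j = x}
    simp only [Set.mem_ofPred_eq] at this
    rw [this, dataLaw, pi_setOf_eval_eq, obsLaw_univ, one_pow, mul_one, obsLaw_singleton]
  have hA : ∑' X : Fin n → ℕ,
      (if X j = x then Measure.pi (fun _ : Fin n => affinityMeasure π π') {X} else 0)
      = ENNReal.ofReal a * ENNReal.ofReal (∑' i, √(mixture π i * mixture π' i)) ^ (n - 1) := by
    have := tsum_ite_measure_singleton (Measure.pi (fun _ : Fin n => affinityMeasure π π'))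
      {X | X j = x}
    simp only [Set.mem_ofPred_eq] at this
    rw [this, pi_setOf_eval_eq, affinityMeasure_univ, affinityMeasure_singleton, hx,
      Real.sqrt_mul_self ha0]
  have h1 : ENNReal.ofReal (a * (3 / 4)) ≤ 2 * M + ENNReal.ofReal (a / 4) := by
    calc ENNReal.ofReal (a * (3 / 4))
        ≤ ENNReal.ofReal a * ENNReal.ofReal (∑' i, √(mixture π i * mixture π' i)) ^ (n - 1) := by
          rw [← ENNReal.ofReal_pow (tsum_nonneg fun _ => Real.sqrt_nonneg _),
            ← ENNReal.ofReal_mul ha0]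
          exact ENNReal.ofReal_le_ofReal (mul_le_mul_of_nonneg_left haff ha0)
      _ ≤ ∑' X : Fin n → ℕ,
          (2 * (if X j = x then min (dataLaw π n {X}) (dataLaw π' n {X}) else 0)
            + ENNReal.ofReal (1 / 8) * ((if X j = x then dataLaw π n {X} else 0)
              + if X j = x then dataLaw π' n {X} else 0)) := by
          rw [← hA]
          refine ENNReal.tsum_le_tsum fun X => ?_
          split_ifs
          · exact pi_affinityMeasure_singleton_le π π' X
          · simp
      _ = 2 * M + ENNReal.ofReal (a / 4) := by
          rw [ENNReal.tsum_add, ENNReal.tsum_mul_left, ENNReal.tsum_mul_left, ENNReal.tsum_add,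
            hP, hP, hx, ← ENNReal.ofReal_add ha0 ha0, ← ENNReal.ofReal_mul (by norm_num)]
          congr 2
          ring
  rcases eq_or_ne M ⊤ with h | h
  · rw [h]; exact le_top
  · rw [← ENNReal.ofReal_toReal h, show (2 : ℝ≥0∞) = ENNReal.ofReal 2 by norm_num,
      ← ENNReal.ofReal_mul (by norm_num), ← ENNReal.ofReal_add (by positivity) (by positivity),
      ENNReal.ofReal_le_ofReal_iff (by positivity)] at h1
    rw [← ENNReal.ofReal_toReal h]
    exact ENNReal.ofReal_le_ofReal (by linarith)

/-- Le Cam's two point bound for the excess risk at `x`. -/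
theorem ofReal_le_localExcess_add {k n : ℕ} (T : Estimator n) {π π' : Prior} {x : ℕ}
    (hx : mixture π' x = mixture π x)
    (haff : 3 / 4 ≤ (∑' i, √(mixture π i * mixture π' i)) ^ (n - 1)) :
    ENNReal.ofReal (n * (mixture π x / 4 * ((bayes k π x - bayes k π' x) ^ 2 / 2)))
      ≤ localExcess k T π x + localExcess k T π' x := by
  set Δ := (bayes k π x - bayes k π' x) ^ 2 / 2 with hΔ
  have hΔ0 : 0 ≤ Δ := by positivity
  have ha0 : 0 ≤ mixture π x := mixture_nonneg _ _
  unfold localExcess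
  rw [lintegral_countable', lintegral_countable', ← ENNReal.tsum_add]
  calc ENNReal.ofReal (n * (mixture π x / 4 * Δ))
      = ∑ _j : Fin n, ENNReal.ofReal (mixture π x / 4) * ENNReal.ofReal Δ := by
        rw [Finset.sum_const, Finset.card_univ, Fintype.card_fin, nsmul_eq_mul,
          ← ENNReal.ofReal_mul (by positivity), ENNReal.ofReal_mul (by positivity),
          ENNReal.ofReal_natCast]
    _ ≤ ∑ j : Fin n, (∑' X : Fin n → ℕ,
          if X j = x then min (dataLaw π n {X}) (dataLaw π' n {X}) else 0) * ENNReal.ofReal Δ :=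
        Finset.sum_le_sum fun j _ => mul_le_mul' (ofReal_le_tsum_min hx haff j) le_rfl
    _ = ∑' X : Fin n → ℕ, ∑ j : Fin n, (if X j = x then min (dataLaw π n {X}) (dataLaw π' n {X})
          else 0) * ENNReal.ofReal Δ := by
        rw [Summable.tsum_finsetSum fun _ _ => ENNReal.summable]
        exact Finset.sum_congr rfl fun j _ => ENNReal.tsum_mul_right.symm
    _ ≤ _ := by
        refine ENNReal.tsum_le_tsum fun X => ?_
        rw [Finset.sum_mul, Finset.sum_mul, ← Finset.sum_add_distrib]
        refine Finset.sum_le_sum fun j _ => ?_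
        split_ifs
        · calc min (dataLaw π n {X}) (dataLaw π' n {X}) * ENNReal.ofReal Δ
              ≤ min (dataLaw π n {X}) (dataLaw π' n {X})
                * (ENNReal.ofReal ((T X j - bayes k π x) ^ 2)
                  + ENNReal.ofReal ((T X j - bayes k π' x) ^ 2)) := by
                rw [← ENNReal.ofReal_add (sq_nonneg _) (sq_nonneg _)]
                refine mul_le_mul' le_rfl (ENNReal.ofReal_le_ofReal ?_)
                rw [hΔ]
                nlinarith [sq_nonneg (T X j - bayes k π x + (T X j - bayes k π' x))]
            _ ≤ _ := by
                rw [mul_add, mul_comm (min _ _), mul_comm (min _ _)]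
                exact add_le_add (mul_le_mul' le_rfl (min_le_left _ _))
                  (mul_le_mul' le_rfl (min_le_right _ _))
        · simp

/-! ### Bounds for the inverse of a Vandermonde matrix -/

-- The absolute coefficients are dominated by those of ∏ |c_j| (X + |v_j|), whose value at r is the
-- right side.
open Polynomial in
lemma abs_coeff_prod_mul_pow_le {ι : Type*} (s : Finset ι) (c v : ι → ℝ) {r : ℝ}
    (hr : 0 ≤ r) (y : ℕ) :
    |(∏ j ∈ s, (C (c j) * (X - C (v j)))).coeff y| * r ^ y ≤ ∏ j ∈ s, |c j| * (r + |v j|) := by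
  classical
  induction s using Finset.induction_on generalizing y with
  | empty =>
    rw [Finset.prod_empty, Finset.prod_empty, coeff_one]
    split_ifs with h
    · simp [h]
    · simp
  | insert a s ha ih =>
    rw [Finset.prod_insert ha, Finset.prod_insert ha]
    set p := ∏ j ∈ s, (C (c j) * (X - C (v j)))
    set B := ∏ j ∈ s, |c j| * (r + |v j|)
    have h0 : |(C (c a) * (X - C (v a)) * p).coeff y| * r ^ y
        = |c a| * (|(X * p).coeff y - v a * p.coeff y| * r ^ y) := by
      rw [mul_assoc, coeff_C_mul, abs_mul, sub_mul, coeff_sub, coeff_C_mul, mul_assoc]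
    rw [h0, mul_assoc]
    refine mul_le_mul_of_nonneg_left ?_ (abs_nonneg _)
    have h1 : |(X * p).coeff y| * r ^ y ≤ r * B := by
      cases y with
      | zero =>
        have hB : 0 ≤ B := Finset.prod_nonneg fun j _ => by positivity
        simp only [coeff_X_mul_zero, abs_zero, zero_mul]; positivity
      | succ y =>
        rw [coeff_X_mul]
        calc |p.coeff y| * r ^ (y + 1) = r * (|p.coeff y| * r ^ y) := by ring
          _ ≤ r * B := mul_le_mul_of_nonneg_left (ih y) hr
    have h2 : |v a * p.coeff y| * r ^ y ≤ |v a| * B := by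
      rw [abs_mul, mul_assoc]
      exact mul_le_mul_of_nonneg_left (ih y) (abs_nonneg _)
    calc |(X * p).coeff y - v a * p.coeff y| * r ^ y
        ≤ (|(X * p).coeff y| + |v a * p.coeff y|) * r ^ y :=
          mul_le_mul_of_nonneg_right (abs_sub _ _) (by positivity)
      _ ≤ (r + |v a|) * B := by linarith

lemma prod_erase_abs_sub {D l : ℕ} (hl : l ≤ D) :
    ∏ j ∈ (Finset.range (D + 1)).erase l, |(l : ℝ) - j| = l.factorial * (D - l).factorial := by
  obtain ⟨m, rfl⟩ := Nat.exists_eq_add_of_le hl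
  have h1 : ∏ j ∈ (Finset.range (l + m + 1)).erase l, |(l : ℝ) - j|
      = ∏ j ∈ Finset.range (l + m + 1), if j = l then (1 : ℝ) else |(l : ℝ) - j| := by
    rw [← Finset.mul_prod_erase (Finset.range (l + m + 1)) _ (by simp : l ∈ _), if_pos rfl, one_mul]
    exact Finset.prod_congr rfl fun j hj => (if_neg (Finset.ne_of_mem_erase hj)).symm
  rw [h1, add_assoc, Finset.prod_range_add, Finset.prod_range_succ']
  have h2 : ∏ j ∈ Finset.range l, (if j = l then (1 : ℝ) else |(l : ℝ) - j|) = l.factorial := by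
    rw [← Nat.descFactorial_self, Nat.descFactorial_eq_prod_range, Nat.cast_prod]
    refine Finset.prod_congr rfl fun j hj => ?_
    have hj' := Finset.mem_range.1 hj
    have : (j : ℝ) ≤ l := by exact_mod_cast hj'.le
    rw [if_neg hj'.ne, abs_of_nonneg (by linarith), Nat.cast_sub hj'.le]
  have h3 : ∏ i ∈ Finset.range m, (if l + (i + 1) = l then (1 : ℝ)
      else |(l : ℝ) - (l + (i + 1) : ℕ)|) = m.factorial := by
    rw [← Finset.prod_range_add_one_eq_factorial, Nat.cast_prod]
    refine Finset.prod_congr rfl fun j _ => ?_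
    rw [if_neg (by omega)]
    push_cast
    rw [show (l : ℝ) - (l + (j + 1)) = -(j + 1) by ring, abs_neg, abs_of_nonneg (by positivity)]
  rw [h2, h3]
  simp

/-- The product over j = 0, …, D is D · D! · C(2D, D), and the omitted factor D + l is at least D.
-/
lemma prod_erase_add_le {D l : ℕ} (h1 : 1 ≤ l) (hl : l ≤ D) :
    ∏ j ∈ (Finset.range (D + 1)).erase l, ((D : ℝ) + j) ≤ D.factorial * (2 * D).choose D := by
  have h2 := Finset.mul_prod_erase (Finset.range (D + 1)) (fun j : ℕ => (D : ℝ) + j)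
    (by simp; omega : l ∈ _)
  have h3 : ∏ j ∈ Finset.range (D + 1), ((D : ℝ) + j) = D * (D.factorial * (2 * D).choose D) := by
    rw [two_mul, ← Nat.cast_mul, ← Nat.ascFactorial_eq_factorial_mul_choose,
      Nat.ascFactorial_eq_prod_range, Finset.prod_range_succ', Nat.cast_prod]
    simp only [Nat.cast_zero, add_zero]
    rw [mul_comm]
    congr 1
    refine Finset.prod_congr rfl fun j _ => ?_
    push_cast; ring
  rw [h3] at h2
  have hD : (0 : ℝ) < D := by exact_mod_cast (by omega : 0 < D)
  have hP : 0 ≤ ∏ j ∈ (Finset.range (D + 1)).erase l, ((D : ℝ) + j) :=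
    Finset.prod_nonneg fun j _ => by positivity
  have h4 : (D : ℝ) * ∏ j ∈ (Finset.range (D + 1)).erase l, ((D : ℝ) + j)
      ≤ D * (D.factorial * (2 * D).choose D) := by
    rw [← h2]
    gcongr
    linarith [Nat.cast_nonneg (α := ℝ) l]
  exact le_of_mul_le_mul_left h4 hD

open Polynomial in
/-- A left inverse of the Vandermonde matrix of the nodes `1, …, D`, with a bound on its entries. -/
theorem exists_vandermonde_inverse (D : ℕ) :
    ∃ a : ℕ → ℕ → ℝ,
      (∀ x ∈ Finset.Icc 1 D, ∀ y, ∑ l ∈ Finset.Icc 1 D, a l y * (l : ℝ) ^ x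
        = if x = y then 1 else 0) ∧
      ∀ l ∈ Finset.Icc 1 D, ∀ y, |a l y| * (D : ℝ) ^ y ≤ 8 ^ D := by
  set v : ℕ → ℝ := fun j => (j : ℝ)
  have hv : Set.InjOn v (Finset.range (D + 1)) := Nat.cast_injective.injOn
  refine ⟨fun l y => (Lagrange.basis (Finset.range (D + 1)) v l).coeff y, fun x hx y => ?_,
    fun l hl y => ?_⟩
  · have hx' := Finset.mem_Icc.1 hx
    -- Interpolation at 0, …, D reproduces X^x; as x ≥ 1 the node 0 drops out, and comparing
    -- coefficients of X^y gives the inverse.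
    have h1 := Lagrange.eq_interpolate (f := (X : ℝ[X]) ^ x) hv (by
      rw [degree_X_pow, Finset.card_range]; exact_mod_cast (by omega : x < D + 1))
    have h2 := congrArg (fun p => p.coeff y) h1
    simp only [coeff_X_pow, Lagrange.interpolate_apply, finsetSum_coeff, coeff_C_mul, eval_pow,
      eval_X] at h2
    rw [Finset.range_eq_Ico, Finset.sum_eq_sum_Ico_succ_bot (by omega)] at h2
    have h3 : v 0 ^ x = 0 := by simp [v]; omega
    rw [h3, zero_mul, zero_add, ← Finset.range_eq_Ico] at h2
    simp_rw [eq_comm (a := x)]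
    rw [h2]
    refine Finset.sum_congr (by ext; simp) fun l _ => mul_comm _ _
  · have hl' := Finset.mem_Icc.1 hl
    have h1 := abs_coeff_prod_mul_pow_le ((Finset.range (D + 1)).erase l)
      (fun j => ((l : ℝ) - j)⁻¹) v (Nat.cast_nonneg (α := ℝ) D) y
    have h2 : Lagrange.basis (Finset.range (D + 1)) v l
        = ∏ j ∈ (Finset.range (D + 1)).erase l, (C (((l : ℝ) - j)⁻¹) * (X - C (v j))) := rfl
    change |(Lagrange.basis (Finset.range (D + 1)) v l).coeff y| * _ ≤ _
    rw [h2]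
    refine h1.trans ?_
    rw [Finset.prod_mul_distrib]
    simp only [abs_inv, v, Nat.abs_cast]
    rw [Finset.prod_inv_distrib, prod_erase_abs_sub hl'.2]
    have h3 := prod_erase_add_le hl'.1 hl'.2
    have h4 : ((D.choose l : ℕ) : ℝ) * (l.factorial * (D - l).factorial) = D.factorial := by
      rw [← mul_assoc]; exact_mod_cast Nat.choose_mul_factorial_mul_factorial hl'.2
    have h5 : (D.choose l : ℝ) ≤ 2 ^ D := by exact_mod_cast Nat.choose_le_two_pow D l
    have h6 : ((2 * D).choose D : ℝ) ≤ 2 ^ (2 * D) := by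
      exact_mod_cast Nat.choose_le_two_pow (2 * D) D
    have hpos : (0 : ℝ) < l.factorial * (D - l).factorial := by positivity
    calc _ ≤ ((l.factorial : ℝ) * (D - l).factorial)⁻¹ * (D.factorial * (2 * D).choose D) :=
          mul_le_mul_of_nonneg_left h3 (by positivity)
      _ = D.choose l * (2 * D).choose D := by rw [← h4]; field_simp
      _ ≤ 2 ^ D * 2 ^ (2 * D) := by gcongr
      _ = 8 ^ D := by rw [pow_mul, ← mul_pow]; norm_num

/-! ### Finitely supported priors -/

theorem exists_discretePrior {ι : Type*} (s : Finset ι) {m : ι → ℝ} (θ : ι → ℝ≥0)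
    (hm : ∀ l ∈ s, 0 ≤ m l) (hs : ∑ l ∈ s, m l = 1) :
    ∃ π : Prior, (∀ x, mixture π x = ∑ l ∈ s, m l * pw (θ l) x) ∧
      ∀ A : Set ℝ≥0, MeasurableSet A →
        (π : Measure ℝ≥0) A = ∑ l ∈ s, ENNReal.ofReal (m l) * A.indicator 1 (θ l) := by
  set μ : Measure ℝ≥0 := ∑ l ∈ s, ENNReal.ofReal (m l) • Measure.dirac (θ l) with hμ
  have hA : ∀ A : Set ℝ≥0, MeasurableSet A →
      μ A = ∑ l ∈ s, ENNReal.ofReal (m l) * A.indicator 1 (θ l) := by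
    intro A hA
    rw [hμ, Measure.finsetSum_apply]
    refine Finset.sum_congr rfl fun l _ => ?_
    rw [Measure.smul_apply, Measure.dirac_apply' _ hA, smul_eq_mul]
  have hp : IsProbabilityMeasure μ := by
    refine ⟨?_⟩
    rw [hA _ MeasurableSet.univ]
    simp only [Set.indicator_univ, Pi.one_apply, mul_one]
    rw [← ENNReal.ofReal_sum_of_nonneg hm, hs, ENNReal.ofReal_one]
  let π : Prior := ⟨μ, hp⟩
  refine ⟨π, fun x => ?_, hA⟩
  rw [mixture_eq]
  change ∫ θ, pw θ x ∂μ = _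
  rw [hμ, integral_finsetSum_measure]
  · refine Finset.sum_congr rfl fun l hl => ?_
    rw [integral_smul_measure, integral_dirac, ENNReal.toReal_ofReal (hm l hl), smul_eq_mul]
  · intro l _
    exact (integrable_dirac (by simp)).smul_measure ENNReal.ofReal_ne_top

/-! ### The affinity of two priors whose mixtures are close -/

/-- The geometric mean is at least the harmonic mean, which is (a + b)/2 - (a - b)² / (2(a + b)). -/
lemma half_add_sub_le_sqrt_mul {a b κ : ℝ} (ha : 0 ≤ a) (hb : 0 ≤ b) (hκ : 0 ≤ κ)
    (h : (a - b) ^ 2 ≤ κ * (a + b)) : (a + b) / 2 - κ / 2 ≤ √(a * b) := by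
  rcases (add_nonneg ha hb).eq_or_lt with h0 | h0
  · rw [← h0]
    linarith [Real.sqrt_nonneg (a * b)]
  · have h1 : 2 * (a * b) / (a + b) ≤ √(a * b) := by
      refine Real.le_sqrt_of_sq_le ?_
      rw [div_pow, div_le_iff₀ (by positivity)]
      nlinarith [mul_nonneg (mul_nonneg ha hb) (sq_nonneg (a - b))]
    refine le_trans ?_ h1
    rw [le_div_iff₀ h0]
    nlinarith

lemma sum_range_mixture_le_one (π : Prior) (D : ℕ) : ∑ x ∈ Finset.range D, mixture π x ≤ 1 :=
  sum_le_hasSum _ (fun _ _ => mixture_nonneg _ _) (hasSum_mixture π)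

lemma one_sub_le_sum_range_mixture {h : ℝ} {π : Prior} (hπ : π ∈ boundedPriors h) {z : ℝ}
    (hz : 1 ≤ z) (D : ℕ) :
    1 - Real.exp (h * (z - 1)) / z ^ D ≤ ∑ x ∈ Finset.range (D + 1), mixture π x := by
  have h1 := tsum_tail_mixture_le hπ hz D
  have h2 := (hasSum_mixture π).summable.sum_add_tsum_nat_add (D + 1)
  rw [(hasSum_mixture π).tsum_eq] at h2
  have hs : Summable fun x => mixture π (x + (D + 1)) :=
    (summable_nat_add_iff (D + 1)).2 (hasSum_mixture π).summable
  have h3 : ENNReal.ofReal (∑' x, mixture π (x + (D + 1)))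
      ≤ ENNReal.ofReal (Real.exp (h * (z - 1)) / z ^ D) := by
    refine le_trans ?_ h1
    rw [ENNReal.ofReal_tsum_of_nonneg (fun _ => mixture_nonneg _ _) hs]
    have h4 := ENNReal.tsum_comp_le_tsum_of_injective (add_left_injective (D + 1))
      fun x => (if D < x then 1 else 0) * ENNReal.ofReal (mixture π x)
    refine le_trans (ENNReal.tsum_le_tsum fun x => ?_) h4
    rw [if_pos (by omega), one_mul]
  rw [ENNReal.ofReal_le_ofReal_iff (by positivity)] at h3
  linarith

/-- On {0, …, D} the mixtures differ only at y and 0. Total mass one determines the change at 0 from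
the one at y up to the tails, and it is harmless because both masses at 0 are at least 1/2. The
affinity is then at least 1 - 1/(4n), and Bernoulli's inequality finishes. -/
theorem three_quarters_le_affinity_pow {π π' : Prior} {n D y : ℕ} {t κ : ℝ} (hn : 1 ≤ n)
    (hy : y ∈ Finset.Icc 1 D)
    (heq : ∀ x ∈ Finset.Icc 1 D, x ≠ y → mixture π x = mixture π' x)
    (h0 : 1 / 2 ≤ mixture π 0) (h0' : 1 / 2 ≤ mixture π' 0)
    (ht : 1 - t ≤ ∑ x ∈ Finset.range (D + 1), mixture π x)
    (ht' : 1 - t ≤ ∑ x ∈ Finset.range (D + 1), mixture π' x)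
    (htn : n * t ≤ 1 / 40) (hκn : n * κ ≤ 1 / 16) (hκ0 : 0 ≤ κ)
    (hκ : (mixture π y - mixture π' y) ^ 2 ≤ κ * (mixture π y + mixture π' y)) :
    3 / 4 ≤ (∑' i, √(mixture π i * mixture π' i)) ^ (n - 1) := by
  have hn1 : (1 : ℝ) ≤ n := by exact_mod_cast hn
  have hy' := Finset.mem_Icc.1 hy
  set f := mixture π with hf
  set f' := mixture π' with hf'
  have hf0 : ∀ x, 0 ≤ f x := fun x => mixture_nonneg _ _
  have hf0' : ∀ x, 0 ≤ f' x := fun x => mixture_nonneg _ _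
  have hle := sum_range_mixture_le_one π (D + 1)
  have hle' := sum_range_mixture_le_one π' (D + 1)
  have ht0 : 0 ≤ t := by linarith
  have hsplit : ∀ F : ℕ → ℝ, ∑ x ∈ Finset.range (D + 1), F x
      = F 0 + (F y + ∑ x ∈ (Finset.Icc 1 D).erase y, F x) := by
    intro F
    rw [Finset.add_sum_erase _ _ hy, Finset.range_eq_Ico, Finset.sum_eq_sum_Ico_succ_bot (by omega)]
    rfl
  have hrest : ∑ x ∈ (Finset.Icc 1 D).erase y, f x = ∑ x ∈ (Finset.Icc 1 D).erase y, f' x :=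
    Finset.sum_congr rfl fun x hx => heq x (Finset.mem_of_mem_erase hx) (Finset.ne_of_mem_erase hx)
  have hs := hsplit f
  have hs' := hsplit f'
  have hr0 : 0 ≤ ∑ x ∈ (Finset.Icc 1 D).erase y, f' x := Finset.sum_nonneg fun x _ => hf0' x
  have hΔ : (f y - f' y) ^ 2 ≤ κ := by
    refine hκ.trans (mul_le_of_le_one_right hκ0 ?_)
    linarith
  have hΔ0 : (f 0 - f' 0) ^ 2 ≤ 2 * κ + 2 * t ^ 2 := by
    have e : (f 0 - f' 0) = -(f y - f' y) + (∑ x ∈ Finset.range (D + 1), f x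
        - ∑ x ∈ Finset.range (D + 1), f' x) := by rw [hs, hs', hrest]; ring
    have hd : (∑ x ∈ Finset.range (D + 1), f x - ∑ x ∈ Finset.range (D + 1), f' x) ^ 2
        ≤ t ^ 2 := sq_le_sq' (by linarith) (by linarith)
    rw [e]
    nlinarith [sq_nonneg (f y - f' y + (∑ x ∈ Finset.range (D + 1), f x
        - ∑ x ∈ Finset.range (D + 1), f' x))]
  have hκ' : 0 ≤ 2 * κ + 2 * t ^ 2 := by positivity
  have h1 := half_add_sub_le_sqrt_mul (hf0 y) (hf0' y) hκ0 hκ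
  have h2 := half_add_sub_le_sqrt_mul (hf0 0) (hf0' 0) hκ'
    (hΔ0.trans (le_mul_of_one_le_right hκ' (by linarith)))
  have h3 : ∑ x ∈ (Finset.Icc 1 D).erase y, √(f x * f' x)
      = ∑ x ∈ (Finset.Icc 1 D).erase y, f' x :=
    Finset.sum_congr rfl fun x hx => by
      rw [heq x (Finset.mem_of_mem_erase hx) (Finset.ne_of_mem_erase hx),
        Real.sqrt_mul_self (hf0' x)]
  have h4 : ∑ x ∈ Finset.range (D + 1), √(f x * f' x) ≤ ∑' i, √(f i * f' i) :=
    (summable_sqrt_mul_mixture π π').sum_le_tsum _ fun _ _ => Real.sqrt_nonneg _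
  rw [hsplit fun x => √(f x * f' x)] at h4
  simp only [h3] at h4
  have hρ : 1 - 1 / (4 * n) ≤ ∑' i, √(f i * f' i) := by
    have h5 : 1 - t - (κ / 2 + (2 * κ + 2 * t ^ 2) / 2) ≤ ∑' i, √(f i * f' i) := by linarith
    refine le_trans ?_ h5
    have : (n : ℝ) * (t + (κ / 2 + (2 * κ + 2 * t ^ 2) / 2)) ≤ 1 / 4 := by
      have : t ≤ 1 / 40 := by nlinarith
      nlinarith [mul_le_mul_of_nonneg_left this ht0]
    have h6 : t + (κ / 2 + (2 * κ + 2 * t ^ 2) / 2) ≤ 1 / (4 * n) := by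
      rw [le_div_iff₀ (by positivity)]; linarith
    linarith
  have hq : (1 : ℝ) / (4 * n) ≤ 1 / 4 := by
    rw [div_le_div_iff₀ (by positivity) (by norm_num)]; linarith
  have hq0 : (0 : ℝ) ≤ 1 / (4 * n) := by positivity
  have hB := one_add_mul_le_pow (a := -(1 / (4 * (n : ℝ)))) (by linarith) (n - 1)
  have hn2 : ((n - 1 : ℕ) : ℝ) ≤ n := by exact_mod_cast Nat.sub_le n 1
  calc (3 / 4 : ℝ) = 1 + n * -(1 / (4 * n)) := by field_simp; norm_num
    _ ≤ 1 + ((n - 1 : ℕ) : ℝ) * -(1 / (4 * n)) := by nlinarith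
    _ ≤ (1 + -(1 / (4 * n))) ^ (n - 1) := hB
    _ ≤ _ := pow_le_pow_left₀ (by linarith) (by linarith) _

/-! ### Priors with prescribed perturbations of the mixture -/

/-- The missing mass is put at θ = 0, which affects only f(0); so the weights at the other nodes
need not sum to one. -/
lemma exists_prior_of_weights {D : ℕ} {h : ℝ≥0} {θ : ℕ → ℝ≥0} (hθ : ∀ l ∈ Finset.Icc 1 D, θ l ≤ h)
    {q : ℕ → ℝ} (hq : ∀ l ∈ Finset.Icc 1 D, 0 ≤ q l) (hq1 : ∑ l ∈ Finset.Icc 1 D, q l ≤ 1) :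
    ∃ π ∈ boundedPriors h,
      (∀ t : ℝ, 0 < t → (π : Measure ℝ≥0) {θ | t ≤ (θ : ℝ)}
        ≤ ENNReal.ofReal (∑ l ∈ Finset.Icc 1 D, q l)) ∧
      1 - ∑ l ∈ Finset.Icc 1 D, q l ≤ mixture π 0 ∧
      ∀ x, 1 ≤ x → mixture π x = ∑ l ∈ Finset.Icc 1 D, q l * pw (θ l) x := by
  have h0 : 0 ∉ Finset.Icc 1 D := by simp
  set Q := ∑ l ∈ Finset.Icc 1 D, q l with hQ
  set r : ℕ → ℝ := fun l => if l = 0 then 1 - Q else q l with hr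
  set τ : ℕ → ℝ≥0 := fun l => if l = 0 then 0 else θ l with hτ
  have hrl : ∀ l ∈ Finset.Icc 1 D, r l = q l := fun l hl =>
    if_neg (by have := (Finset.mem_Icc.1 hl).1; omega)
  have hτl : ∀ l ∈ Finset.Icc 1 D, τ l = θ l := fun l hl =>
    if_neg (by have := (Finset.mem_Icc.1 hl).1; omega)
  have hr0 : r 0 = 1 - Q := if_pos rfl
  have hτ0 : τ 0 = 0 := if_pos rfl
  obtain ⟨π, hmix, hA⟩ := exists_discretePrior (insert 0 (Finset.Icc 1 D)) (m := r) τ (by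
    intro l hl
    rcases Finset.mem_insert.1 hl with rfl | hl
    · rw [hr0]; linarith
    · rw [hrl l hl]; exact hq l hl) (by
    rw [Finset.sum_insert h0, hr0, Finset.sum_congr rfl hrl]; linarith)
  have hsum : ENNReal.ofReal (1 - Q) + ∑ l ∈ Finset.Icc 1 D, ENNReal.ofReal (q l) = 1 := by
    rw [← ENNReal.ofReal_sum_of_nonneg hq, ← ENNReal.ofReal_add (by linarith)
      (Finset.sum_nonneg hq), ← hQ, sub_add_cancel, ENNReal.ofReal_one]
  refine ⟨π, ?_, fun t ht => ?_, ?_, fun x hx => ?_⟩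
  · change (π : Measure ℝ≥0) {θ | (θ : ℝ) ≤ h} = 1
    rw [hA _ (measurableSet_le_param _), Finset.sum_insert h0, hr0, hτ0, ← hsum]
    congr 1
    · simp
    · refine Finset.sum_congr rfl fun l hl => ?_
      rw [hrl l hl, hτl l hl, Set.indicator_of_mem (by exact_mod_cast hθ l hl)]
      simp
  · rw [hA _ (measurableSet_le measurable_const (by fun_prop)), Finset.sum_insert h0, hτ0,
      Set.indicator_of_notMem (by simpa using ht), mul_zero, zero_add,
      ENNReal.ofReal_sum_of_nonneg hq]
    refine Finset.sum_le_sum fun l hl => ?_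
    rw [hrl l hl]
    refine mul_le_of_le_one_right zero_le ?_
    exact Set.indicator_le_self' (fun _ _ => zero_le) _
  · rw [hmix, Finset.sum_insert h0, hr0, hτ0]
    have : 0 ≤ ∑ l ∈ Finset.Icc 1 D, r l * pw (τ l) 0 := Finset.sum_nonneg fun l hl => by
      rw [hrl l hl]; exact mul_nonneg (hq l hl) (pw_nonneg _ _)
    simp only [pw, NNReal.coe_zero, neg_zero, Real.exp_zero, pow_zero, Nat.factorial_zero,
      Nat.cast_one] at this ⊢
    linarith
  · rw [hmix, Finset.sum_insert h0, hτ0]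
    have : pw 0 x = 0 := by
      have : x ≠ 0 := by omega
      simp [pw, this]
    rw [this, mul_zero, zero_add]
    exact Finset.sum_congr rfl fun l hl => by rw [hrl l hl, hτl l hl]

lemma coe_node (h : ℝ≥0) (D l : ℕ) : (((l / D : ℝ≥0) * h : ℝ≥0) : ℝ) = l / D * h := by
  push_cast; rfl

lemma node_le (h : ℝ≥0) {D l : ℕ} (hl : l ≤ D) : (l / D : ℝ≥0) * h ≤ h := by
  refine mul_le_of_le_one_left zero_le ?_
  exact div_le_one_of_le₀ (by exact_mod_cast hl) zero_le

lemma node_self (h : ℝ≥0) {D : ℕ} (hD : 1 ≤ D) : (D / D : ℝ≥0) * h = h := by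
  rw [div_self (by exact_mod_cast (by omega : D ≠ 0)), one_mul]

lemma sum_node_weights_le {D : ℕ} (hD : 1 ≤ D) {w v g : ℝ} {F : ℕ → ℝ}
    (h1 : F D = w) (h2 : ∀ l ∈ Finset.Icc 1 D, l ≠ D → F l ≤ v) (hv : D * v ≤ g) (hv0 : 0 ≤ v) :
    ∑ l ∈ Finset.Icc 1 D, F l ≤ w + g := by
  have hDm : D ∈ Finset.Icc 1 D := Finset.mem_Icc.2 ⟨hD, le_rfl⟩
  rw [← Finset.add_sum_erase _ _ hDm, h1]
  have h3 := Finset.sum_le_card_nsmul ((Finset.Icc 1 D).erase D) F v fun l hl =>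
    h2 l (Finset.mem_of_mem_erase hl) (Finset.ne_of_mem_erase hl)
  rw [nsmul_eq_mul] at h3
  have h4 : (((Finset.Icc 1 D).erase D).card : ℝ) ≤ D := by
    have := Finset.card_erase_le (s := Finset.Icc 1 D) (a := D)
    rw [Nat.card_Icc] at this
    exact_mod_cast (by omega : ((Finset.Icc 1 D).erase D).card ≤ D)
  nlinarith

/-- On `{1, …, D}`, the mixture can be perturbed independently at the points of `S`. -/
theorem exists_perturbed_priors {h : ℝ≥0} (hh : 0 < h) {w : ℝ} (hw : 0 < w) (hw' : w ≤ 1 / 6)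
    {D : ℕ} (hD : 1 ≤ D) {S : Finset ℕ} (hS : S ⊆ Finset.Icc 1 D) {β : ℕ → ℝ}
    (hβ0 : ∀ y ∈ S, 0 ≤ β y)
    (hβ : ∀ y ∈ S, β y * (y.factorial * (Real.exp h * (8 ^ D / (h : ℝ) ^ y)))
      ≤ w * Real.exp (-h) / (2 * (D : ℝ) ^ 2)) :
    ∃ F : ℕ → ℝ, (∀ x, 1 ≤ x → w * pw h x ≤ F x) ∧
      ∀ σ : ℕ → ℝ, (∀ y, |σ y| ≤ 1) → ∃ π ∈ boundedPriors h,
        (∀ t : ℝ, 0 < t → (π : Measure ℝ≥0) {θ | t ≤ (θ : ℝ)} ≤ ENNReal.ofReal (3 * w)) ∧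
        1 / 2 ≤ mixture π 0 ∧
        (∀ x, 1 ≤ x → w * pw h x / 2 ≤ mixture π x ∧ mixture π x ≤ 3 * (w * pw h x)) ∧
        ∀ x ∈ Finset.Icc 1 D, mixture π x = F x + if x ∈ S then σ x * β x else 0 := by
  obtain ⟨a, ha1, ha2⟩ := exists_vandermonde_inverse D
  have hD0 : (0 : ℝ) < D := by exact_mod_cast hD
  have hh0 : (0 : ℝ) < h := hh
  have hDm : D ∈ Finset.Icc 1 D := Finset.mem_Icc.2 ⟨hD, le_rfl⟩
  set θ : ℕ → ℝ≥0 := fun l => (l / D : ℝ≥0) * h with hθdef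
  have hθ : ∀ l ∈ Finset.Icc 1 D, θ l ≤ h := fun l hl => node_le h (Finset.mem_Icc.1 hl).2
  have hθD : θ D = h := node_self h hD
  have hexp1 : Real.exp (-h) ≤ 1 := Real.exp_le_one_iff.2 (by linarith)
  -- The top node h has weight w and the other nodes v. The factor e^{-h} / D keeps the total
  -- contribution of these to F(x) below w · `pw h x`, so F is that function up to a factor 2.
  set v := w * Real.exp (-h) / D with hv
  have hv0 : 0 < v := by positivity
  have hvw : v ≤ w := by
    rw [hv, div_le_iff₀ hD0]
    have : (1 : ℝ) ≤ D := by exact_mod_cast hD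
    exact mul_le_mul_of_nonneg_left (hexp1.trans this) hw.le
  set p : ℕ → ℝ := fun l => if l = D then w else v with hp
  have hpD : p D = w := if_pos rfl
  have hpl : ∀ l, l ≠ D → p l = v := fun l hl => if_neg hl
  have hpv : ∀ l, v ≤ p l := by
    intro l
    by_cases hl : l = D
    · rw [hl, hpD]; exact hvw
    · rw [hpl l hl]
  have hp0 : ∀ l, 0 ≤ p l := fun l => hv0.le.trans (hpv l)
  have hpsum : ∑ l ∈ Finset.Icc 1 D, p l ≤ 2 * w := by
    have := sum_node_weights_le (g := w) (v := v) hD hpD (fun l _ hl => (hpl l hl).le)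
      (by rw [hv, mul_div_cancel₀ _ hD0.ne']; exact mul_le_of_le_one_right hw.le hexp1) hv0.le
    linarith
  set F : ℕ → ℝ := fun x => ∑ l ∈ Finset.Icc 1 D, p l * pw (θ l) x with hF
  have hFlow : ∀ x, w * pw h x ≤ F x := by
    intro x
    have := Finset.single_le_sum (f := fun l => p l * pw (θ l) x)
      (fun l _ => mul_nonneg (hp0 l) (pw_nonneg _ _)) hDm
    simpa only [hpD, hθD] using this
  have hFup : ∀ x, F x ≤ 2 * (w * pw h x) := by
    intro x
    have hg0 : 0 ≤ w * pw h x := mul_nonneg hw.le (pw_nonneg _ _)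
    have := sum_node_weights_le (F := fun l => p l * pw (θ l) x) (v := w * pw h x / D) hD
      (by rw [hpD, hθD]) (fun l hl hlD => ?_) (by rw [mul_div_cancel₀ _ hD0.ne'])
      (by positivity)
    · simp only [hF]; linarith
    · have h1 : pw (θ l) x ≤ (h : ℝ) ^ x / x.factorial := by
        unfold pw
        gcongr
        calc Real.exp (-(θ l : ℝ)) * (θ l : ℝ) ^ x ≤ 1 * (h : ℝ) ^ x := by
              gcongr
              · exact Real.exp_le_one_iff.2 (by simp)
              · exact_mod_cast hθ l hl
          _ = _ := one_mul _
      simp only [hpl l hlD]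
      calc v * pw (θ l) x ≤ v * ((h : ℝ) ^ x / x.factorial) := by gcongr
        _ = w * pw h x / D := by rw [hv]; unfold pw; ring
  refine ⟨F, fun x _ => hFlow x, fun σ hσ => ?_⟩
  -- The inverse Vandermonde coefficients, rescaled by y!, e^{θ_l} and (D / h)^y, so that this
  -- change of the weights adds exactly σ_y β_y to the mixture at each y in S and nothing elsewhere
  -- on {1, …, D}.
  set e : ℕ → ℝ := fun l => ∑ y ∈ S,
    σ y * β y * (y.factorial * Real.exp (θ l) * ((D / h : ℝ) ^ y * a l y)) with he
  have hel : ∀ l ∈ Finset.Icc 1 D, |e l| ≤ v / 2 := by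
    intro l hl
    have hterm : ∀ y ∈ S,
        |σ y * β y * (y.factorial * Real.exp (θ l) * ((D / h : ℝ) ^ y * a l y))|
          ≤ w * Real.exp (-h) / (2 * (D : ℝ) ^ 2) := by
      intro y hy
      refine le_trans ?_ (hβ y hy)
      rw [abs_mul, abs_mul, abs_of_nonneg (hβ0 y hy)]
      calc |σ y| * β y * |y.factorial * Real.exp (θ l) * ((D / h : ℝ) ^ y * a l y)|
          ≤ 1 * β y * |y.factorial * Real.exp (θ l) * ((D / h : ℝ) ^ y * a l y)| := by
            have := hβ0 y hy
            gcongr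
            exact hσ y
        _ = β y * (y.factorial * (Real.exp (θ l) * ((|a l y| * (D : ℝ) ^ y) / (h : ℝ) ^ y))) := by
            rw [abs_mul, abs_mul, abs_mul, abs_of_nonneg (by positivity : (0 : ℝ) ≤ y.factorial),
              abs_of_nonneg (Real.exp_pos _).le,
              abs_of_nonneg (by positivity : (0 : ℝ) ≤ (D / h : ℝ) ^ y), div_pow]
            ring
        _ ≤ β y * (y.factorial * (Real.exp h * (8 ^ D / (h : ℝ) ^ y))) := by
            have h1 := hβ0 y hy
            have h2 := ha2 l hl y
            have h3 : (θ l : ℝ) ≤ h := by exact_mod_cast hθ l hl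
            gcongr
    have hcard : (S.card : ℝ) ≤ D := by
      have := Finset.card_le_card hS
      rw [Nat.card_Icc] at this
      exact_mod_cast (by omega : S.card ≤ D)
    refine (Finset.abs_sum_le_sum_abs _ _).trans ((Finset.sum_le_card_nsmul _ _ _ hterm).trans ?_)
    rw [nsmul_eq_mul]
    calc (S.card : ℝ) * (w * Real.exp (-h) / (2 * (D : ℝ) ^ 2))
        ≤ D * (w * Real.exp (-h) / (2 * (D : ℝ) ^ 2)) := by gcongr
      _ = v / 2 := by rw [hv]; field_simp
  have hq1 : ∀ l ∈ Finset.Icc 1 D, p l / 2 ≤ p l + e l := fun l hl => by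
    have := (abs_le.1 (hel l hl)).1
    linarith [hpv l]
  have hq2 : ∀ l ∈ Finset.Icc 1 D, p l + e l ≤ 3 / 2 * p l := fun l hl => by
    have := (abs_le.1 (hel l hl)).2
    linarith [hpv l]
  have hqsum : ∑ l ∈ Finset.Icc 1 D, (p l + e l) ≤ 3 * w := by
    refine (Finset.sum_le_sum hq2).trans ?_
    rw [← Finset.mul_sum]; linarith
  obtain ⟨π, hπ, htail, h0, hmix⟩ := exists_prior_of_weights hθ (q := fun l => p l + e l)
    (fun l hl => (by have := hp0 l; positivity : 0 ≤ p l / 2).trans (hq1 l hl)) (by linarith)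
  refine ⟨π, hπ, fun t ht => (htail t ht).trans (ENNReal.ofReal_le_ofReal hqsum), by linarith,
    fun x hx => ⟨?_, ?_⟩, fun x hx => ?_⟩
  · rw [hmix x hx]
    calc w * pw h x / 2 ≤ F x / 2 := by gcongr; exact hFlow x
      _ = ∑ l ∈ Finset.Icc 1 D, p l / 2 * pw (θ l) x := by
        rw [hF, Finset.sum_div]; exact Finset.sum_congr rfl fun l _ => by ring
      _ ≤ _ := Finset.sum_le_sum fun l hl =>
        mul_le_mul_of_nonneg_right (hq1 l hl) (pw_nonneg _ _)
  · rw [hmix x hx]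
    calc ∑ l ∈ Finset.Icc 1 D, (p l + e l) * pw (θ l) x
        ≤ ∑ l ∈ Finset.Icc 1 D, 3 / 2 * p l * pw (θ l) x := Finset.sum_le_sum fun l hl =>
          mul_le_mul_of_nonneg_right (hq2 l hl) (pw_nonneg _ _)
      _ = 3 / 2 * F x := by
        rw [hF, Finset.mul_sum]; exact Finset.sum_congr rfl fun l _ => by ring
      _ ≤ 3 * (w * pw h x) := by linarith [hFup x]
  · rw [hmix x (Finset.mem_Icc.1 hx).1]
    simp only [add_mul, Finset.sum_add_distrib]
    congr 1
    simp only [he, Finset.sum_mul]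
    rw [Finset.sum_comm]
    have hin : ∀ y ∈ S, ∑ l ∈ Finset.Icc 1 D,
        σ y * β y * (y.factorial * Real.exp (θ l) * ((D / h : ℝ) ^ y * a l y)) * pw (θ l) x
          = if x = y then σ y * β y else 0 := by
      intro y _
      have h1 : ∀ l ∈ Finset.Icc 1 D,
          σ y * β y * (y.factorial * Real.exp (θ l) * ((D / h : ℝ) ^ y * a l y)) * pw (θ l) x
          = σ y * β y * (y.factorial / x.factorial * ((D / h : ℝ) ^ y * (h / D : ℝ) ^ x))
            * (a l y * (l : ℝ) ^ x) := by
        intro l _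
        have h2 : Real.exp (-(θ l : ℝ)) * Real.exp (θ l) = 1 := by
          rw [← Real.exp_add]; simp
        have h3 : (θ l : ℝ) ^ x = (h / D : ℝ) ^ x * (l : ℝ) ^ x := by
          rw [hθdef, coe_node, ← mul_pow]; congr 1; ring
        unfold pw
        rw [h3]
        linear_combination (σ y * β y * (y.factorial * ((D / h : ℝ) ^ y * a l y))
          * ((h / D : ℝ) ^ x * (l : ℝ) ^ x) / x.factorial) * h2
      rw [Finset.sum_congr rfl h1, ← Finset.mul_sum, ha1 x hx y]
      split_ifs with hxy
      · subst hxy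
        rw [← mul_pow, div_mul_div_cancel₀ hh0.ne', div_self hD0.ne', one_pow,
          div_self (by positivity)]
        ring
      · rw [mul_zero]
    rw [Finset.sum_congr rfl hin, Finset.sum_ite_eq]

lemma ascFactorial_mul_pw_add (θ : ℝ≥0) (x k : ℕ) :
    ((x + 1).ascFactorial k : ℝ) * pw θ (x + k) = (θ : ℝ) ^ k * pw θ x := by
  have h : ((x + k).factorial : ℝ) = x.factorial * (x + 1).ascFactorial k := by
    exact_mod_cast (Nat.factorial_mul_ascFactorial x k).symm
  have h1 : (0 : ℝ) < (x + 1).ascFactorial k := by exact_mod_cast Nat.ascFactorial_pos x k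
  have h2 : (0 : ℝ) < x.factorial := by positivity
  unfold pw
  rw [h, pow_add]
  field_simp

/-- The size condition of `exists_perturbed_priors` for β_y = √(w `pw h y` / (32n)), squared to
remove the root; 64 is the square of the entry bound 8. -/
lemma perturbation_size_le {D n y : ℕ} {h : ℝ≥0} (hh : 0 < h) {w : ℝ} (hw : 0 < w) (hn : 1 ≤ n)
    (hD : 1 ≤ D) (hP : y.factorial * (D : ℝ) ^ 4 * 64 ^ D * Real.exp (3 * h) ≤ w * n * (h : ℝ) ^ y) :
    √(w * pw h y / (32 * n)) * (y.factorial * (Real.exp h * (8 ^ D / (h : ℝ) ^ y)))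
      ≤ w * Real.exp (-h) / (2 * (D : ℝ) ^ 2) := by
  have hh0 : (0 : ℝ) < h := hh
  have hn0 : (0 : ℝ) < n := by exact_mod_cast hn
  have hD0 : (0 : ℝ) < D := by exact_mod_cast hD
  have hpw : 0 ≤ w * pw h y / (32 * n) := by have := pw_nonneg h y; positivity
  refine (pow_le_pow_iff_left₀ (by positivity) (by positivity) two_ne_zero).1 ?_
  rw [mul_pow, Real.sq_sqrt hpw, div_pow, mul_pow (w) _ 2, mul_pow 2 _ 2, ← pow_mul (D : ℝ) 2 2,
    ← Real.exp_nat_mul]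
  have e1 : (8 ^ D : ℝ) ^ 2 = 64 ^ D := by rw [← pow_mul, mul_comm, pow_mul]; norm_num
  have e2 : Real.exp h = 1 / Real.exp (-h) := by rw [Real.exp_neg]; simp
  have e3 : Real.exp (3 * h) = 1 / Real.exp (-h) ^ 3 := by
    rw [← Real.exp_nat_mul, one_div, ← Real.exp_neg]; congr 1; push_cast; ring
  have e4 : Real.exp ((2 : ℕ) * -(h : ℝ)) = Real.exp (-h) ^ 2 := by rw [Real.exp_nat_mul]
  rw [e3] at hP
  rw [e4, e2]
  unfold pw
  set E := Real.exp (-(h : ℝ))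
  have hE : 0 < E := Real.exp_pos _
  have hf : (0 : ℝ) < y.factorial := by positivity
  have key : y.factorial * (D : ℝ) ^ 4 * 64 ^ D ≤ w * n * (h : ℝ) ^ y * E ^ 3 := by
    rw [mul_one_div, div_le_iff₀ (by positivity)] at hP; exact hP
  have e5 : w * (E * (h : ℝ) ^ y / y.factorial) / (32 * n)
      * (y.factorial * (1 / E * (8 ^ D / (h : ℝ) ^ y))) ^ 2
      = (y.factorial * (D : ℝ) ^ 4 * 64 ^ D) * (w / (32 * n * (E * (h : ℝ) ^ y) * (D : ℝ) ^ 4)) := by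
    rw [← e1]; field_simp
  rw [e5]
  calc _ ≤ (w * n * (h : ℝ) ^ y * E ^ 3) * (w / (32 * n * (E * (h : ℝ) ^ y) * (D : ℝ) ^ 4)) := by
        gcongr
    _ = w ^ 2 * E ^ 2 / (32 * (D : ℝ) ^ 4) := by field_simp
    _ ≤ w ^ 2 * E ^ 2 / (2 ^ 2 * (D : ℝ) ^ (2 * 2)) := by
        gcongr
        norm_num

theorem ofReal_le_minimaxRegret {k n m D : ℕ} (hk : 1 ≤ k) (hn : 1 ≤ n) (hm : 1 ≤ m)
    (hD : 2 * m + k ≤ D) {h : ℝ≥0} (hh : 0 < h) {w : ℝ} (hw : 0 < w) (hw' : w ≤ 1 / 6)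
    (hP : ∀ y ≤ 2 * m + k,
      y.factorial * (D : ℝ) ^ 4 * 64 ^ D * Real.exp (3 * h) ≤ w * n * (h : ℝ) ^ y)
    {z : ℝ} (hz : 1 ≤ z) (hT : n * (Real.exp (h * (z - 1)) / z ^ D) ≤ 1 / 40) {G : Set Prior}
    (hG : ∀ π ∈ boundedPriors h, (∀ t : ℝ, 0 < t →
      (π : Measure ℝ≥0) {θ | t ≤ (θ : ℝ)} ≤ ENNReal.ofReal (3 * w)) → π ∈ G) :
    ENNReal.ofReal ((m : ℝ) ^ (k + 1) * (h : ℝ) ^ k / 384) ≤ minimaxRegret k n G := by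
  have hn0 : (0 : ℝ) < n := by exact_mod_cast hn
  set S := Finset.Ioc (m + k) (2 * m + k) with hS
  set β : ℕ → ℝ := fun y => √(w * pw h y / (32 * n)) with hβ
  have hβsq : ∀ y, β y ^ 2 = w * pw h y / (32 * n) := fun y =>
    Real.sq_sqrt (by have := pw_nonneg h y; positivity)
  obtain ⟨F, hF, hpri⟩ := exists_perturbed_priors hh hw hw' (by omega : 1 ≤ D)
    (S := S) (β := β) (fun y hy => by
      have := Finset.mem_Ioc.1 hy
      exact Finset.mem_Icc.2 ⟨by omega, by omega⟩) (fun y _ => Real.sqrt_nonneg _)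
    fun y hy => perturbation_size_le hh hw hn (by omega) (hP y (Finset.mem_Ioc.1 hy).2)
  -- The sign at y = x + k encodes whether x ∈ U. Flipping x changes f(x + k) by 2β but not f(x),
  -- although x itself may also be a perturbed point.
  set σ : Finset ℕ → ℕ → ℝ := fun U y => if y - k ∈ U then 1 else -1 with hσ
  have hσ1 : ∀ U y, |σ U y| ≤ 1 := fun U y => by simp only [hσ]; split_ifs <;> simp
  choose pri hb htail h0 hbd hmix using fun U => hpri (σ U) (hσ1 U)
  have hcard : (Finset.Ioc m (2 * m)).card = m := by rw [Nat.card_Ioc]; omega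
  have hmain := card_mul_le_minimaxRegret (k := k) (n := n) (G := G) (S := Finset.Ioc m (2 * m))
    (pri := pri) (h := h) (fun U _ => hG _ (hb U) (htail U)) (fun U _ => hb U)
    (b := ENNReal.ofReal ((m : ℝ) ^ k * (h : ℝ) ^ k / 384)) ?_
  · rw [hcard, ← ENNReal.ofReal_natCast, ← ENNReal.ofReal_mul (by positivity)] at hmain
    refine le_trans (ENNReal.ofReal_le_ofReal (le_of_eq ?_)) hmain
    ring
  intro T x hx U hU
  have hx' := Finset.mem_Ioc.1 hx
  have hxU : x ∉ U := fun h => Finset.notMem_erase x _ (hU h)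
  have hyS : x + k ∈ S := Finset.mem_Ioc.2 ⟨by omega, by omega⟩
  have hyD : x + k ∈ Finset.Icc 1 D := Finset.mem_Icc.2 ⟨by omega, by omega⟩
  have hy1 : mixture (pri U) (x + k) = F (x + k) - β (x + k) := by
    rw [hmix U _ hyD, if_pos hyS]
    simp only [hσ, Nat.add_sub_cancel, if_neg hxU]; ring
  have hy2 : mixture (pri (insert x U)) (x + k) = F (x + k) + β (x + k) := by
    rw [hmix _ _ hyD, if_pos hyS]
    simp only [hσ, Nat.add_sub_cancel, if_pos (Finset.mem_insert_self x U)]; ring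
  have heq : ∀ i ∈ Finset.Icc 1 D, i ≠ x + k →
      mixture (pri U) i = mixture (pri (insert x U)) i := by
    intro i hi hne
    rw [hmix _ _ hi, hmix _ _ hi]
    congr 1
    split_ifs with hiS
    · have : i - k ≠ x := by have := Finset.mem_Ioc.1 hiS; omega
      simp only [hσ, Finset.mem_insert, this, false_or]
    · rfl
  have hFy := hF (x + k) (by omega)
  have hpwy := pw_nonneg h (x + k)
  have hpwx := pw_pos hh x
  have hβy := hβsq (x + k)
  have hxeq := heq x (Finset.mem_Icc.2 ⟨by omega, by omega⟩) (by omega)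
  have htl : ∀ π ∈ boundedPriors h, 1 - Real.exp (h * (z - 1)) / z ^ D
      ≤ ∑ x ∈ Finset.range (D + 1), mixture π x := fun π hπ =>
    one_sub_le_sum_range_mixture hπ hz D
  -- Here (2β)² is w `pw h (x + k)` / (8n), while the two masses at x + k sum to 2F(x + k) ≥ 2w `pw
  -- h (x + k)`; this gives κ = 1 / (16n).
  have haff := three_quarters_le_affinity_pow (κ := 1 / (16 * n)) hn hyD heq (h0 _) (h0 _)
    (htl _ (hb _)) (htl _ (hb _)) hT (le_of_eq (by field_simp)) (by positivity) (by
      rw [hy1, hy2]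
      calc (F (x + k) - β (x + k) - (F (x + k) + β (x + k))) ^ 2 = 4 * β (x + k) ^ 2 := by ring
        _ = 1 / (16 * n) * (2 * (w * pw h (x + k))) := by rw [hβy]; field_simp; ring
        _ ≤ 1 / (16 * n) * (F (x + k) - β (x + k) + (F (x + k) + β (x + k))) := by
          gcongr
          linarith)
  refine le_trans ?_ (ofReal_le_localExcess_add T hxeq.symm haff)
  rw [show (2 : ℝ≥0∞) = ENNReal.ofReal 2 by norm_num, ← ENNReal.ofReal_mul (by norm_num)]
  refine ENNReal.ofReal_le_ofReal ?_
  have ha := hbd U x (by omega)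
  set a := mixture (pri U) x with hadef
  have ha0 : 0 < a := lt_of_lt_of_le (by positivity) ha.1
  set c : ℝ := ((x + 1).ascFactorial k : ℝ) with hc
  have hcm : (m : ℝ) ^ k ≤ c := by
    have h1 : m ^ k ≤ (x + 1).ascFactorial k :=
      (Nat.pow_le_pow_left (by omega) k).trans (Nat.pow_succ_le_ascFactorial (x + 1) k)
    rw [hc]; exact_mod_cast h1
  have hc0 : 0 ≤ c := by positivity
  have hcg := ascFactorial_mul_pw_add h x k
  rw [← hc] at hcg
  have e1 : bayes k (pri U) x - bayes k (pri (insert x U)) x = -(2 * c * β (x + k) / a) := by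
    unfold bayes
    rw [hy1, hy2, ← hxeq, ← hadef, ← hc]; ring
  -- The factor n cancels against β². With a ≤ 3w `pw h x` and (x + 1)_k ≥ m^k this is at least m^k
  -- h^k / 192, twice the value b of the cube bound.
  have e2 : n * (a / 4 * ((bayes k (pri U) x - bayes k (pri (insert x U)) x) ^ 2 / 2))
      = c * (w * ((h : ℝ) ^ k * pw h x)) / (64 * a) := by
    rw [e1, ← hcg]
    have : n * (a / 4 * ((-(2 * c * β (x + k) / a)) ^ 2 / 2))
        = n * c ^ 2 * β (x + k) ^ 2 / (2 * a) := by field_simp; ring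
    rw [this, hβy]; field_simp; ring
  rw [e2, le_div_iff₀ (by positivity)]
  have h1 : (m : ℝ) ^ k * (h : ℝ) ^ k * a ≤ c * (h : ℝ) ^ k * (3 * (w * pw h x)) := by
    gcongr
    exact ha.2
  linarith

/-! ### Positivity of the minimax regret -/

lemma bayes_pointPrior {θ : ℝ≥0} (hθ : 0 < θ) (k x : ℕ) :
    bayes k (pointPrior θ) x = (θ : ℝ) ^ k := by
  unfold bayes
  rw [mixture_pointPrior, mixture_pointPrior, ascFactorial_mul_pw_add,
    mul_div_cancel_right₀ _ (pw_pos hθ x).ne']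

lemma pointPrior_mem_boundedPriors {θ : ℝ≥0} {h : ℝ} (hθ : (θ : ℝ) ≤ h) :
    pointPrior θ ∈ boundedPriors h := by
  change Measure.dirac θ {θ : ℝ≥0 | (θ : ℝ) ≤ h} = 1
  rw [Measure.dirac_apply' _ (measurableSet_le_param h), Set.indicator_of_mem (by exact hθ)]
  rfl

lemma pointPrior_mem_subexpPriors {θ : ℝ≥0} {s : ℝ} (hs : 0 < s) (hθ : (θ : ℝ) ≤ s / 2) :
    pointPrior θ ∈ subexpPriors s := by
  intro t _
  change Measure.dirac θ {θ : ℝ≥0 | t ≤ (θ : ℝ)} ≤ _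
  by_cases h : t ≤ (θ : ℝ)
  · refine prob_le_one.trans (ENNReal.one_le_ofReal.2 ?_)
    have h1 : -(1 / 2) ≤ -t / s := by
      rw [le_div_iff₀ hs]; linarith
    have h2 := Real.add_one_le_exp (-t / s)
    linarith
  · rw [Measure.dirac_apply' _ (measurableSet_le measurable_const (by fun_prop)),
      Set.indicator_of_notMem (by exact h)]
    exact zero_le

/-- Two point priors have different constant Bayes rules, and the all-zero sample has positive
probability under both. The cube lemma is used with the single coordinate 0. -/
theorem minimaxRegret_pos {k n : ℕ} (hk : 1 ≤ k) (hn : 1 ≤ n) {G : Set Prior} {θ θ' : ℝ≥0}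
    (h0 : 0 < θ) (h1 : θ < θ') (hG : pointPrior θ ∈ G) (hG' : pointPrior θ' ∈ G) :
    0 < minimaxRegret k n G := by
  set π := pointPrior θ
  set π' := pointPrior θ'
  set Δ := ((θ : ℝ) ^ k - (θ' : ℝ) ^ k) ^ 2 / 2 with hΔ
  have hΔ0 : 0 < Δ := by
    have : (θ : ℝ) ^ k < (θ' : ℝ) ^ k :=
      pow_lt_pow_left₀ (by exact_mod_cast h1) θ.2 (by omega)
    have : (θ : ℝ) ^ k - (θ' : ℝ) ^ k ≠ 0 := by linarith
    positivity
  have hmass : ∀ τ : ℝ≥0, 0 < τ → 0 < dataLaw (pointPrior τ) n {fun _ => 0} := by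
    intro τ hτ
    rw [dataLaw_singleton, pos_iff_ne_zero, Finset.prod_ne_zero_iff]
    intro i _
    rw [mixture_pointPrior]
    exact (ENNReal.ofReal_pos.2 (pw_pos hτ 0)).ne'
  set b := min (dataLaw π n {fun _ => 0}) (dataLaw π' n {fun _ => 0}) * ENNReal.ofReal Δ with hb
  have hb0 : 0 < b := by
    refine ENNReal.mul_pos (lt_min (hmass θ h0) (hmass θ' (h0.trans h1))).ne' ?_
    exact (ENNReal.ofReal_pos.2 hΔ0).ne'
  have hpt : ∀ (T : Estimator n) (τ : ℝ≥0), 0 < τ →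
      ENNReal.ofReal ((T (fun _ => 0) ⟨0, hn⟩ - (τ : ℝ) ^ k) ^ 2)
        * dataLaw (pointPrior τ) n {fun _ => 0} ≤ localExcess k T (pointPrior τ) 0 := by
    intro T τ hτ
    unfold localExcess
    rw [lintegral_countable']
    refine le_trans ?_ (ENNReal.le_tsum (fun _ => 0))
    refine mul_le_mul' ?_ le_rfl
    refine le_trans ?_ (Finset.single_le_sum (fun _ _ => zero_le) (Finset.mem_univ ⟨0, hn⟩))
    rw [if_pos rfl, bayes_pointPrior hτ]
  have hmain := card_mul_le_minimaxRegret (k := k) (n := n) (G := G) (S := {0})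
    (pri := fun U => if 0 ∈ U then π else π') (h := θ') (b := b / 2)
    (fun U _ => by split_ifs <;> assumption)
    (fun U _ => by
      split_ifs
      · exact pointPrior_mem_boundedPriors (by exact_mod_cast h1.le)
      · exact pointPrior_mem_boundedPriors le_rfl) ?_
  · refine lt_of_lt_of_le ?_ hmain
    simpa using hb0.ne'
  · intro T x hx U hU
    rw [Finset.mem_singleton.1 hx] at hU ⊢
    have hU0 : 0 ∉ U := fun h => Finset.notMem_erase 0 _ (hU h)
    simp only [hU0, if_false, Finset.mem_insert_self, if_true]
    rw [ENNReal.mul_div_cancel (by norm_num) (by norm_num)]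
    refine le_trans ?_ (add_le_add (hpt T θ' (h0.trans h1)) (hpt T θ h0))
    set τ := T (fun _ => 0) ⟨0, hn⟩
    calc b ≤ min (dataLaw π n {fun _ => 0}) (dataLaw π' n {fun _ => 0})
          * (ENNReal.ofReal ((τ - (θ' : ℝ) ^ k) ^ 2) + ENNReal.ofReal ((τ - (θ : ℝ) ^ k) ^ 2)) := by
          rw [hb, ← ENNReal.ofReal_add (sq_nonneg _) (sq_nonneg _)]
          refine mul_le_mul' le_rfl (ENNReal.ofReal_le_ofReal ?_)
          rw [hΔ]
          nlinarith [sq_nonneg (τ - (θ : ℝ) ^ k + (τ - (θ' : ℝ) ^ k))]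
      _ ≤ _ := by
          rw [mul_add, mul_comm (min _ _), mul_comm (min _ _)]
          exact add_le_add (mul_le_mul' le_rfl (min_le_right _ _))
            (mul_le_mul' le_rfl (min_le_left _ _))

/-- The constant is lowered once for each of the finitely many exceptional n, so n₀ does not depend
on the other parameters. -/
lemma exists_ofReal_mul_le_of_eventually {f : ℕ → ℝ≥0∞} {r : ℕ → ℝ} {n₀ : ℕ}
    (hf : ∀ n, n₀ ≤ n → 0 < f n) (hr : ∀ n, n₀ ≤ n → 0 ≤ r n) {c : ℝ} (hc : 0 < c)
    (h : ∀ᶠ n in Filter.atTop, ENNReal.ofReal (c * r n) ≤ f n) :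
    ∃ c : ℝ, 0 < c ∧ ∀ n, n₀ ≤ n → ENNReal.ofReal (c * r n) ≤ f n := by
  obtain ⟨N, hN⟩ := Filter.eventually_atTop.1 h
  clear h
  induction N generalizing c with
  | zero => exact ⟨c, hc, fun n _ => hN n (Nat.zero_le n)⟩
  | succ N ih =>
    rcases lt_or_ge N n₀ with hlt | hge
    · exact ⟨c, hc, fun n hn => hN n (by omega)⟩
    obtain ⟨ε, hε, hεf⟩ : ∃ ε : ℝ, 0 < ε ∧ ENNReal.ofReal ε ≤ f N := by
      obtain ⟨q, hq0, hq⟩ := ENNReal.lt_iff_exists_nnreal_btwn.1 (hf N hge)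
      exact ⟨q, by exact_mod_cast hq0, by simpa using hq.le⟩
    have hrN := hr N hge
    set c' := min c (ε / (r N + 1))
    have hc' : 0 < c' := lt_min hc (by positivity)
    refine ih (c := c') hc' fun n hn => ?_
    rcases hn.eq_or_lt with rfl | hn
    · refine (ENNReal.ofReal_le_ofReal ?_).trans hεf
      calc c' * r N ≤ ε / (r N + 1) * r N := by gcongr; exact min_le_right _ _
        _ ≤ ε := by
          rw [div_mul_eq_mul_div, div_le_iff₀ (by positivity)]
          nlinarith
    · refine (ENNReal.ofReal_le_ofReal ?_).trans (hN n hn)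
      have := hr n (by omega)
      gcongr
      exact min_le_left _ _

open Filter

/-! ### The lower bounds -/

lemma tendsto_log_natCast : Tendsto (fun n : ℕ => Real.log n) atTop atTop :=
  Real.tendsto_log_atTop.comp tendsto_natCast_atTop_atTop

lemma sqrt_le_two_mul_div_log {x : ℝ} (hx : 1 < x) : √x ≤ 2 * (x / Real.log x) := by
  have hx0 : 0 < x := by linarith
  have hs : 0 < √x := Real.sqrt_pos.2 hx0
  have h1 : Real.log x ≤ 2 * √x := by
    have h2 := Real.log_le_sub_one_of_pos hs
    rw [Real.log_sqrt hx0.le] at h2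
    linarith
  rw [← mul_div_assoc, le_div_iff₀ (Real.log_pos hx)]
  calc √x * Real.log x ≤ √x * (2 * √x) := by gcongr
    _ = 2 * x := by rw [mul_left_comm, Real.mul_self_sqrt hx0.le]

lemma pow_four_mul_pow_le_exp (D : ℕ) : (D : ℝ) ^ 4 * 64 ^ D ≤ Real.exp (9 * D) := by
  have h1 : (D : ℝ) ≤ Real.exp D := by linarith [Real.add_one_le_exp (D : ℝ)]
  have h2 : (64 : ℝ) ≤ Real.exp 5 := by
    have : Real.exp 5 = Real.exp 1 ^ 5 := by rw [← Real.exp_nat_mul]; norm_num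
    rw [this]
    calc (64 : ℝ) ≤ (2.7) ^ 5 := by norm_num
      _ ≤ Real.exp 1 ^ 5 := by gcongr; linarith [Real.exp_one_gt_d9]
  calc (D : ℝ) ^ 4 * 64 ^ D ≤ Real.exp D ^ 4 * Real.exp 5 ^ D := by gcongr
    _ = Real.exp (9 * D) := by
      rw [← Real.exp_nat_mul, ← Real.exp_nat_mul, ← Real.exp_add]; congr 1; push_cast; ring

lemma natCast_mul_exp_div_le {n D : ℕ} (hn : 1 ≤ n) {a lam : ℝ}
    (h : Real.log n + a + 4 ≤ D * lam) :
    n * (Real.exp a / Real.exp lam ^ D) ≤ 1 / 40 := by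
  have hn0 : (0 : ℝ) < n := by exact_mod_cast hn
  have h1 : (40 : ℝ) ≤ Real.exp 4 := by
    have : Real.exp 4 = Real.exp 1 ^ 4 := by rw [← Real.exp_nat_mul]; norm_num
    rw [this]
    calc (40 : ℝ) ≤ (2.7) ^ 4 := by norm_num
      _ ≤ Real.exp 1 ^ 4 := by gcongr; linarith [Real.exp_one_gt_d9]
  have h2 : n * (Real.exp a / Real.exp lam ^ D) = Real.exp (Real.log n + a - D * lam) := by
    rw [Real.exp_sub, Real.exp_add, Real.exp_log hn0, ← Real.exp_nat_mul]; ring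
  rw [h2]
  calc Real.exp (Real.log n + a - D * lam) ≤ Real.exp (-4) := by gcongr; linarith
    _ = 1 / Real.exp 4 := by rw [Real.exp_neg, one_div]
    _ ≤ 1 / 40 := by gcongr

lemma factorial_mul_le_of_exp_le {n D y : ℕ} (hn : 1 ≤ n) {h w a b : ℝ} (hh : 0 < h)
    (hy : (y.factorial : ℝ) ≤ Real.exp a * h ^ y) (hw : Real.exp (-b) ≤ w)
    (hle : a + 9 * D + 3 * h + b ≤ Real.log n) :
    y.factorial * (D : ℝ) ^ 4 * 64 ^ D * Real.exp (3 * h) ≤ w * n * h ^ y := by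
  have hn0 : (0 : ℝ) < n := by exact_mod_cast hn
  have h1 := pow_four_mul_pow_le_exp D
  calc y.factorial * (D : ℝ) ^ 4 * 64 ^ D * Real.exp (3 * h)
      = y.factorial * ((D : ℝ) ^ 4 * 64 ^ D) * Real.exp (3 * h) := by ring
    _ ≤ (Real.exp a * h ^ y) * Real.exp (9 * D) * Real.exp (3 * h) := by gcongr
    _ = Real.exp (a + 9 * D + 3 * h) * h ^ y := by rw [Real.exp_add, Real.exp_add]; ring
    _ ≤ Real.exp (-b + Real.log n) * h ^ y :=
      mul_le_mul_of_nonneg_right (Real.exp_le_exp.2 (by linarith)) (by positivity)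
    _ = Real.exp (-b) * n * h ^ y := by rw [Real.exp_add, Real.exp_log hn0]
    _ ≤ w * n * h ^ y := by gcongr

lemma factorial_le_pow_cast {y : ℕ} {t : ℝ} (h : (y : ℝ) ≤ t) : (y.factorial : ℝ) ≤ t ^ y :=
  calc (y.factorial : ℝ) ≤ (y : ℝ) ^ y := by exact_mod_cast Nat.factorial_le_pow y
    _ ≤ t ^ y := by gcongr

lemma exp_neg_two_le : Real.exp (-2) ≤ 1 / 6 := by
  rw [Real.exp_neg, ← one_div]
  have : Real.exp 2 = Real.exp 1 ^ 2 := by rw [← Real.exp_nat_mul]; norm_num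
  have h : (6 : ℝ) ≤ Real.exp 2 := by
    rw [this]
    calc (6 : ℝ) ≤ (2.7) ^ 2 := by norm_num
      _ ≤ Real.exp 1 ^ 2 := by gcongr; linarith [Real.exp_one_gt_d9]
  gcongr

/-- Write l = log n and L = l / log l. With 2m + k ≤ L/2, the factorial costs about e^{l/2}, and
with D about 3L the Vandermonde factor costs e^{O(L)}; both fit into n. Chernoff's bound with base
√l gains at least e^{3l/2}, enough for a tail below 1 / (40n). The constant H, with Hh ≥ 1, handles
small h. -/
lemma eventually_boundedRate_le {k : ℕ} (hk : 1 ≤ k) {h : ℝ} (hh : 0 < h) :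
    ∀ᶠ n : ℕ in atTop, ENNReal.ofReal (h ^ k / 384 / 16 ^ (k + 1) * boundedRate k n)
      ≤ minimaxRegret k n (boundedPriors h) := by
  set H := max 1 h⁻¹ with hH
  have hH1 : 1 ≤ H := le_max_left _ _
  have hHh : 1 ≤ H * h := by
    calc 1 = h⁻¹ * h := by field_simp
      _ ≤ H * h := by gcongr; exact le_max_right _ _
  have hlogH : 0 ≤ Real.log H := Real.log_nonneg hH1
  have hev := tendsto_log_natCast.eventually_ge_atTop
    (max (16 + (4 * h) ^ 2 + (8 * k + 32) ^ 2 + 4 * (3 * h + 11))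
      (Real.exp (4 * (Real.log H / 2 + 27))))
  filter_upwards [hev, eventually_ge_atTop 1] with n hn hn1
  set l := Real.log n with hl
  set lam := Real.log l with hlam
  set L := l / lam with hL
  have hl1 := (le_max_left _ _).trans hn
  have hl2 := (le_max_right _ _).trans hn
  have hk0 : (0 : ℝ) ≤ k := Nat.cast_nonneg k
  have hl16 : 16 ≤ l := by nlinarith [sq_nonneg (4 * h), sq_nonneg (8 * (k : ℝ) + 32)]
  have hl4 : 4 * (3 * h + 11) ≤ l := by
    nlinarith [sq_nonneg (4 * h), sq_nonneg (8 * (k : ℝ) + 32)]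
  have hl0 : 0 < l := by linarith
  have hlam1 : 4 * (Real.log H / 2 + 27) ≤ lam := by
    rw [hlam, Real.le_log_iff_exp_le hl0]; exact hl2
  have hlam0 : 0 < lam := by linarith
  have hLl : L * lam = l := by rw [hL]; field_simp
  have hsq1 : 4 * h ≤ √l := Real.le_sqrt_of_sq_le (by
    nlinarith [sq_nonneg (8 * (k : ℝ) + 32)])
  have hsq2 : 8 * (k : ℝ) + 32 ≤ √l := Real.le_sqrt_of_sq_le (by nlinarith [sq_nonneg (4 * h)])
  have hL2 : 4 * (k : ℝ) + 16 ≤ L := by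
    have := sqrt_le_two_mul_div_log (by linarith : 1 < l)
    linarith
  have hL0 : 0 < L := by linarith
  set m := ⌊L / 8⌋₊ with hm
  have hm1 : (m : ℝ) ≤ L / 8 := Nat.floor_le (by positivity)
  have hm2 : L / 8 - 1 ≤ m := (Nat.sub_one_lt_floor _).le
  have hmL : L / 16 ≤ m := by linarith
  set D := ⌈3 * L⌉₊ with hD
  have hD1 : 3 * L ≤ D := Nat.le_ceil _
  have hD2 : (D : ℝ) ≤ 3 * L + 1 := (Nat.ceil_lt_add_one (by positivity)).le
  have hm0 : 1 ≤ m := by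
    have : (0 : ℝ) < m := by linarith
    exact_mod_cast this
  have hmkL : (2 * m + k : ℝ) ≤ L / 2 := by linarith
  have hmain := ofReal_le_minimaxRegret (k := k) (n := n) (m := m) (D := D) hk hn1 hm0
    (by
      have : ((2 * m + k : ℕ) : ℝ) ≤ D := by push_cast; linarith
      exact_mod_cast this)
    (h := ⟨h, hh.le⟩) hh (w := 1 / 6) (by norm_num) le_rfl (fun y hy => ?_) (z := √l)
    (Real.one_le_sqrt.2 (by linarith)) ?_ (G := boundedPriors h) (fun π hπ _ => hπ)
  · refine le_trans (ENNReal.ofReal_le_ofReal ?_) hmain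
    unfold boundedRate
    change h ^ k / 384 / 16 ^ (k + 1) * L ^ (k + 1) ≤ (m : ℝ) ^ (k + 1) * h ^ k / 384
    have e : ∀ t : ℝ, h ^ k / 384 / 16 ^ (k + 1) * t ^ (k + 1)
        = (t / 16) ^ (k + 1) * h ^ k / 384 := fun t => by rw [div_pow]; ring
    calc h ^ k / 384 / 16 ^ (k + 1) * L ^ (k + 1) = (L / 16) ^ (k + 1) * h ^ k / 384 := e L
      _ ≤ _ := by gcongr
  · have hyL : (y : ℝ) ≤ L / 2 := by
      have : (y : ℝ) ≤ 2 * m + k := by exact_mod_cast hy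
      linarith
    refine factorial_mul_le_of_exp_le (a := L / 2 * (lam + Real.log H)) (b := 2) hn1 hh ?_
      exp_neg_two_le ?_
    · have hLlel : L ≤ l := by rw [← hLl]; exact le_mul_of_one_le_right hL0.le (by linarith)
      have h1 : (y.factorial : ℝ) ≤ (l * H * h) ^ y := factorial_le_pow_cast (by
        calc (y : ℝ) ≤ l * 1 := by linarith
          _ ≤ l * (H * h) := by gcongr
          _ = l * H * h := by ring)
      refine h1.trans ?_
      rw [mul_pow]
      refine mul_le_mul_of_nonneg_right ?_ (by positivity)
      have h2 : l * H = Real.exp (lam + Real.log H) := by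
        rw [Real.exp_add, hlam, Real.exp_log hl0, Real.exp_log (by linarith)]
      rw [h2, ← Real.exp_nat_mul]
      refine Real.exp_le_exp.2 ?_
      gcongr
    · change L / 2 * (lam + Real.log H) + 9 * D + 3 * h + 2 ≤ l
      have : L * (4 * (Real.log H / 2 + 27)) ≤ L * lam := by gcongr
      nlinarith
  · have h1 : √l = Real.exp (lam / 2) := by
      rw [Real.sqrt_eq_rpow, Real.rpow_def_of_pos hl0]; congr 1; rw [hlam]; ring
    have h2 : h * √l ≤ l / 4 := by
      nlinarith [Real.mul_self_sqrt hl0.le, Real.sqrt_nonneg l]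
    change n * (Real.exp (h * (√l - 1)) / √l ^ D) ≤ 1 / 40
    have h3 := natCast_mul_exp_div_le (D := D) hn1 (a := h * (√l - 1)) (lam := lam / 2) (by
      have : 3 * L * (lam / 2) ≤ D * (lam / 2) := by gcongr
      rw [← hl]
      nlinarith)
    rwa [← h1] at h3

/-- Write l = log n. Take h = ηl, D about l/20, and total weight at most 3w = e^{-h/s}/2 off the
origin, which the tail condition tolerates up to t = h. The base A = e^{lam} has lam > 41, so the
gain A^D exceeds n with room to spare. Then η = 1 / (20A) makes hA = l/20, so the exponential factor
in Chernoff's bound and the costs e^{3h} and e^{h/s} are small powers of n. -/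
lemma eventually_subexpRate_le {k : ℕ} (hk : 1 ≤ k) {s : ℝ} (hs : 0 < s) :
    ∃ c : ℝ, 0 < c ∧ ∀ᶠ n : ℕ in atTop, ENNReal.ofReal (c * subexpRate k n)
      ≤ minimaxRegret k n (subexpPriors s) := by
  set q := 3 + 1 / s with hq
  have hq0 : 0 < q := by positivity
  set lam := 41 + q with hlam
  set A := Real.exp lam with hA
  have hA0 : 0 < A := Real.exp_pos _
  have hqA : q ≤ A := by linarith [Real.add_one_le_exp lam]
  set η := 1 / (20 * A) with hη
  have hη0 : 0 < η := by positivity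
  have hηA : η * A = 1 / 20 := by rw [hη]; field_simp
  refine ⟨η ^ (2 * k + 1) / 8 ^ (k + 1) / 384, by positivity, ?_⟩
  have hev := tendsto_log_natCast.eventually_ge_atTop (max 40 ((8 + 2 * k) / η))
  filter_upwards [hev, eventually_ge_atTop 1] with n hn hn1
  set l := Real.log n with hl
  have hl1 : 40 ≤ l := (le_max_left _ _).trans hn
  have hl2 : 8 + 2 * (k : ℝ) ≤ l * η := (div_le_iff₀ hη0).1 ((le_max_right _ _).trans hn)
  have hl0 : 0 < l := by linarith
  have hk0 : (0 : ℝ) ≤ k := Nat.cast_nonneg k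
  set h := η * l with hh
  have hh8 : 8 + 2 * (k : ℝ) ≤ h := by rw [hh]; linarith
  have hh0 : 0 < h := by positivity
  have hhA : h * A = l / 20 := by rw [hh, mul_right_comm, hηA]; ring
  have hqh : q * h ≤ l / 20 := by
    calc q * h ≤ A * h := by gcongr
      _ = l / 20 := by rw [mul_comm, hhA]
  set m := ⌊h / 4⌋₊ with hm
  have hm1 : (m : ℝ) ≤ h / 4 := Nat.floor_le (by positivity)
  have hm2 : h / 4 - 1 ≤ m := (Nat.sub_one_lt_floor _).le
  have hmh : h / 8 ≤ m := by linarith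
  have hm0 : 1 ≤ m := by
    have : (0 : ℝ) < m := by linarith
    exact_mod_cast this
  set D := ⌈l / 20⌉₊ with hD
  have hD1 : l / 20 ≤ D := Nat.le_ceil _
  have hD2 : (D : ℝ) ≤ l / 20 + 1 := (Nat.ceil_lt_add_one (by positivity)).le
  have hA1 : 1 ≤ A := Real.one_le_exp (by linarith)
  have hhD : h ≤ D := by
    refine le_trans ?_ hD1
    rw [← hhA]; exact le_mul_of_one_le_right hh0.le hA1
  set w := 1 / 6 * Real.exp (-h / s) with hw
  have hmain := ofReal_le_minimaxRegret (k := k) (n := n) (m := m) (D := D) hk hn1 hm0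
    (by
      have : ((2 * m + k : ℕ) : ℝ) ≤ D := by push_cast; linarith
      exact_mod_cast this)
    (h := ⟨h, hh0.le⟩) hh0 (w := w) (by positivity)
    (mul_le_of_le_one_right (by norm_num) (Real.exp_le_one_iff.2 (by
      rw [neg_div]; linarith [div_pos hh0 hs])))
    (fun y hy => ?_) (z := A) hA1 ?_ (G := subexpPriors s) (fun π hπ ht t ht0 => ?_)
  · refine le_trans (ENNReal.ofReal_le_ofReal ?_) hmain
    unfold subexpRate
    change η ^ (2 * k + 1) / 8 ^ (k + 1) / 384 * l ^ (2 * k + 1)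
      ≤ (m : ℝ) ^ (k + 1) * h ^ k / 384
    have e : ∀ t u : ℝ, t ^ (2 * k + 1) / 8 ^ (k + 1) / 384 * u ^ (2 * k + 1)
        = (t * u / 8) ^ (k + 1) * (t * u) ^ k / 384 := fun t u => by
      rw [div_pow, mul_pow, mul_pow]; ring
    calc η ^ (2 * k + 1) / 8 ^ (k + 1) / 384 * l ^ (2 * k + 1)
        = (h / 8) ^ (k + 1) * h ^ k / 384 := e η l
      _ ≤ _ := by gcongr
  · have hyh : (y : ℝ) ≤ h := by
      have : (y : ℝ) ≤ 2 * m + k := by exact_mod_cast hy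
      linarith
    refine factorial_mul_le_of_exp_le (a := 0) (b := h / s + 2) hn1 hh0 ?_ ?_ ?_
    · rw [Real.exp_zero, one_mul]; exact factorial_le_pow_cast hyh
    · rw [show -(h / s + 2) = -2 + -h / s by ring, Real.exp_add]
      exact mul_le_mul_of_nonneg_right exp_neg_two_le (Real.exp_pos _).le
    · change 0 + 9 * D + 3 * h + (h / s + 2) ≤ l
      have : 3 * h + h / s = q * h := by rw [hq]; ring
      linarith
  · refine natCast_mul_exp_div_le hn1 ?_
    change l + h * (A - 1) + 4 ≤ D * lam
    have : l / 20 * 41 ≤ D * lam := by gcongr; linarith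
    linarith
  · rcases le_or_gt t h with hth | hth
    · refine (ht t ht0).trans (ENNReal.ofReal_le_ofReal ?_)
      have : Real.exp (-h / s) ≤ Real.exp (-t / s) := by gcongr
      have := Real.exp_pos (-t / s)
      linarith
    · have h0 : (π : Measure ℝ≥0) {θ | (θ : ℝ) ≤ h}ᶜ = 0 :=
        (prob_compl_eq_zero_iff (measurableSet_le_param h)).2 hπ
      have : (π : Measure ℝ≥0) {θ | t ≤ (θ : ℝ)} = 0 := measure_mono_null (fun θ hθ => by
        have : t ≤ (θ : ℝ) := hθ
        change ¬ ((θ : ℝ) ≤ h)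
        linarith) h0
      rw [this]; exact zero_le

lemma boundedRate_nonneg (k : ℕ) {n : ℕ} (hn : 16 ≤ n) : 0 ≤ boundedRate k n := by
  have := one_le_log_div_log_log hn
  unfold boundedRate; positivity

lemma subexpRate_nonneg (k : ℕ) {n : ℕ} (hn : 16 ≤ n) : 0 ≤ subexpRate k n := by
  have := one_lt_log_of_sixteen_le hn
  unfold subexpRate; positivity

theorem exists_boundedRate_le_minimaxRegret {k : ℕ} (hk : 1 ≤ k) {h : ℝ} (hh : 0 < h) :
    ∃ c : ℝ, 0 < c ∧ ∀ n : ℕ, 16 ≤ n →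
      ENNReal.ofReal (c * boundedRate k n) ≤ minimaxRegret k n (boundedPriors h) := by
  refine exists_ofReal_mul_le_of_eventually (fun n hn => ?_)
    (fun n hn => boundedRate_nonneg k hn) (by positivity)
    (eventually_boundedRate_le hk hh)
  refine minimaxRegret_pos hk (by omega) (θ := ⟨h / 2, by positivity⟩) (θ' := ⟨h, hh.le⟩)
    (half_pos hh) (half_lt_self hh) (pointPrior_mem_boundedPriors (half_le_self hh.le))
    (pointPrior_mem_boundedPriors le_rfl)

theorem exists_subexpRate_le_minimaxRegret {k : ℕ} (hk : 1 ≤ k) {s : ℝ} (hs : 0 < s) :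
    ∃ c : ℝ, 0 < c ∧ ∀ n : ℕ, 16 ≤ n →
      ENNReal.ofReal (c * subexpRate k n) ≤ minimaxRegret k n (subexpPriors s) := by
  obtain ⟨c, hc, hev⟩ := eventually_subexpRate_le hk hs
  refine exists_ofReal_mul_le_of_eventually (fun n hn => ?_)
    (fun n hn => subexpRate_nonneg k hn) hc hev
  refine minimaxRegret_pos hk (by omega) (θ := ⟨s / 2 / 2, by positivity⟩)
    (θ' := ⟨s / 2, by positivity⟩) (half_pos (half_pos hs)) (half_lt_self (half_pos hs))
    (pointPrior_mem_subexpPriors hs (half_le_self (half_pos hs).le))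
    (pointPrior_mem_subexpPriors hs le_rfl)

end PoissonEB

end

/-! ### Assembly of the bounds -/

open PoissonEB in
theorem mainTheorem1 (k : ℕ) (hk : 1 ≤ k) :
    -- bounded priors
    (∃ n₀ : ℕ, ∀ h : ℝ, 0 < h →
      (∃ c₁ c₂ : ℝ, 0 < c₁ ∧ 0 < c₂ ∧ ∀ n : ℕ, n₀ ≤ n →
        ENNReal.ofReal (c₁ * PoissonEB.boundedRate k n)
          ≤ PoissonEB.minimaxRegret k n (PoissonEB.boundedPriors h) ∧
        PoissonEB.minimaxRegret k n (PoissonEB.boundedPriors h)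
          ≤ ENNReal.ofReal (c₂ * PoissonEB.boundedRate k n) ∧
        -- modified Robbins
        PoissonEB.worstRegret k (PoissonEB.boundedPriors h) (PoissonEB.robbins k n)
          ≤ ENNReal.ofReal (c₂ * PoissonEB.boundedRate k n) ∧
        -- NPMLE
        (∃ πhat : (Fin n → ℕ) → PoissonEB.Prior,
          PoissonEB.IsNPMLE (PoissonEB.boundedPriors h) πhat) ∧
        (∀ πhat : (Fin n → ℕ) → PoissonEB.Prior,
          PoissonEB.IsNPMLE (PoissonEB.boundedPriors h) πhat →
          PoissonEB.worstRegret k (PoissonEB.boundedPriors h) (PoissonEB.plugIn k πhat)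
            ≤ ENNReal.ofReal (c₂ * PoissonEB.boundedRate k n)) ∧
        -- empirical risk minimization
        (∃ T : PoissonEB.Estimator n,
          PoissonEB.IsERM k (PoissonEB.clippedMonotoneClass (h ^ k)) T) ∧
        (∀ T : PoissonEB.Estimator n,
          PoissonEB.IsERM k (PoissonEB.clippedMonotoneClass (h ^ k)) T →
          PoissonEB.worstRegret k (PoissonEB.boundedPriors h) T
            ≤ ENNReal.ofReal (c₂ * PoissonEB.boundedRate k n))) ∧
      -- general minimum distance estimators
      (∀ a₁ a₂ : ℝ, 0 < a₁ → 0 < a₂ → ∃ c : ℝ, 0 < c ∧ ∀ n : ℕ, n₀ ≤ n →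
        ∀ d : (ℕ → ℝ) → (ℕ → ℝ) → ENNReal, PoissonEB.IsAdmissibleDivergence a₁ a₂ d →
        ∀ πhat : (Fin n → ℕ) → PoissonEB.Prior,
          PoissonEB.IsMinDistance d (PoissonEB.boundedPriors h) πhat →
          PoissonEB.worstRegret k (PoissonEB.boundedPriors h) (PoissonEB.plugIn k πhat)
            ≤ ENNReal.ofReal (c * PoissonEB.boundedRate k n))) ∧
    -- subexponential priors
    (∃ n₀ : ℕ, ∀ s : ℝ, 0 < s →
      (∃ c₃ c₄ : ℝ, 0 < c₃ ∧ 0 < c₄ ∧ ∀ n : ℕ, n₀ ≤ n →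
        ENNReal.ofReal (c₃ * PoissonEB.subexpRate k n)
          ≤ PoissonEB.minimaxRegret k n (PoissonEB.subexpPriors s) ∧
        PoissonEB.minimaxRegret k n (PoissonEB.subexpPriors s)
          ≤ ENNReal.ofReal (c₄ * PoissonEB.subexpRate k n) ∧
        -- modified Robbins
        PoissonEB.worstRegret k (PoissonEB.subexpPriors s) (PoissonEB.robbins k n)
          ≤ ENNReal.ofReal (c₄ * PoissonEB.subexpRate k n) ∧
        -- NPMLE
        (∃ πhat : (Fin n → ℕ) → PoissonEB.Prior, PoissonEB.IsNPMLE Set.univ πhat) ∧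
        (∀ πhat : (Fin n → ℕ) → PoissonEB.Prior, PoissonEB.IsNPMLE Set.univ πhat →
          PoissonEB.worstRegret k (PoissonEB.subexpPriors s) (PoissonEB.plugIn k πhat)
            ≤ ENNReal.ofReal (c₄ * PoissonEB.subexpRate k n)) ∧
        -- empirical risk minimization
        (∃ T : PoissonEB.Estimator n, PoissonEB.IsERM k PoissonEB.monotoneClass T) ∧
        (∀ T : PoissonEB.Estimator n, PoissonEB.IsERM k PoissonEB.monotoneClass T →
          PoissonEB.worstRegret k (PoissonEB.subexpPriors s) T
            ≤ ENNReal.ofReal (c₄ * PoissonEB.subexpRate k n))) ∧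
      -- general minimum distance estimators
      (∀ a₁ a₂ : ℝ, 0 < a₁ → 0 < a₂ → ∃ c : ℝ, 0 < c ∧ ∀ n : ℕ, n₀ ≤ n →
        ∀ d : (ℕ → ℝ) → (ℕ → ℝ) → ENNReal, PoissonEB.IsAdmissibleDivergence a₁ a₂ d →
        ∀ πhat : (Fin n → ℕ) → PoissonEB.Prior,
          PoissonEB.IsMinDistance d Set.univ πhat →
          PoissonEB.worstRegret k (PoissonEB.subexpPriors s) (PoissonEB.plugIn k πhat)
            ≤ ENNReal.ofReal (c * PoissonEB.subexpRate k n))) := by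
  -- From n = 16 on, log n > 1, so log log n > 0 and both rates are at least 1.
  refine ⟨⟨16, fun h hh => ⟨?_, fun a₁ a₂ h₁ h₂ => ?_⟩⟩, ⟨16, fun s hs => ⟨?_, fun a₁ a₂ h₁ h₂ => ?_⟩⟩⟩
  · obtain ⟨c, hc, hlow⟩ := exists_boundedRate_le_minimaxRegret hk hh
    obtain ⟨C₁, hC₁, hrob⟩ := exists_worstRegret_robbins_boundedPriors_le hk hh
    obtain ⟨C₂, hC₂, hplug⟩ := exists_worstRegret_plugIn_boundedPriors_le hk hh zero_le_one
    obtain ⟨C₃, hC₃, herm⟩ := exists_worstRegret_erm_boundedPriors_le hk hh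
    have hmono : ∀ {C : ℝ} {n : ℕ}, 16 ≤ n → C ≤ C₁ + C₂ + C₃ →
        ENNReal.ofReal (C * boundedRate k n) ≤ ENNReal.ofReal ((C₁ + C₂ + C₃) * boundedRate k n) :=
      fun hn hC => ENNReal.ofReal_le_ofReal
        (mul_le_mul_of_nonneg_right hC (boundedRate_nonneg k hn))
    refine ⟨c, C₁ + C₂ + C₃, hc, by positivity, fun n hn => ?_⟩
    have hr := (hrob n hn).trans (hmono hn (by linarith))
    refine ⟨hlow n hn, (iInf_le _ _).trans hr, hr, exists_isNPMLE_boundedPriors hh.le n,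
      fun πhat hmax => ?_, exists_isERM fun X => exists_isMinOn_clippedMonotoneClass k X
        (by positivity), fun T hT => (herm n hn T hT).trans (hmono hn (by linarith))⟩
    exact (hplug n hn πhat (fun X => (hmax X).1) fun π hπ =>
      hmax.isHellingerMin (by omega) (θ := ⟨h, hh.le⟩) hh
        (pointPrior_mem_boundedPriors le_rfl) hπ).trans (hmono hn (by linarith))
  · obtain ⟨C, hC, hplug⟩ :=
      exists_worstRegret_plugIn_boundedPriors_le hk hh (div_pos h₂ h₁).le
    exact ⟨C, hC, fun n hn d hd πhat hmin => hplug n hn πhat (fun X => (hmin X).1) fun π hπ =>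
      hmin.isHellingerMin h₁ hd (by omega) hπ⟩
  · obtain ⟨c, hc, hlow⟩ := exists_subexpRate_le_minimaxRegret hk hs
    obtain ⟨C₁, hC₁, hrob⟩ := exists_worstRegret_robbins_subexpPriors_le hk hs
    obtain ⟨C₂, hC₂, hplug⟩ := exists_worstRegret_plugIn_subexpPriors_le k hs zero_le_one
    obtain ⟨C₃, hC₃, herm⟩ := exists_worstRegret_erm_subexpPriors_le hk hs
    have hmono : ∀ {C : ℝ} {n : ℕ}, 16 ≤ n → C ≤ C₁ + C₂ + C₃ →
        ENNReal.ofReal (C * subexpRate k n) ≤ ENNReal.ofReal ((C₁ + C₂ + C₃) * subexpRate k n) :=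
      fun hn hC => ENNReal.ofReal_le_ofReal
        (mul_le_mul_of_nonneg_right hC (subexpRate_nonneg k hn))
    refine ⟨c, C₁ + C₂ + C₃, hc, by positivity, fun n hn => ?_⟩
    have hr := (hrob n hn).trans (hmono hn (by linarith))
    refine ⟨hlow n hn, (iInf_le _ _).trans hr, hr, exists_isNPMLE_univ n,
      fun πhat hmax => ?_, exists_isERM fun X => exists_isMinOn_monotoneClass k X,
      fun T hT => (herm n hn T hT).trans (hmono hn (by linarith))⟩
    exact (hplug n hn πhat (fun X K hX => hmax.mem_boundedPriors (by omega) hX) fun π =>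
      hmax.isHellingerMin (by omega) one_pos trivial trivial).trans (hmono hn (by linarith))
  · obtain ⟨C, hC, hplug⟩ :=
      exists_worstRegret_plugIn_subexpPriors_le k hs (div_pos h₂ h₁).le
    exact ⟨C, hC, fun n hn d hd πhat hmin => hplug n hn πhat
      (fun X K hX => hmin.mem_boundedPriors hd (by omega) hX) fun π =>
      hmin.isHellingerMin h₁ hd (by omega) trivial⟩
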